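/- Let $\mathbb D$ be the Poincaré disc with its hyperbolic metric $d$ of curvature $-1$ and boundary $\mathbb S^1$. Let $h$ be a hyperbolic and $p$ a parabolic orientation-preserving isometry of $\mathbb D$ in Schottky position: for some $z_0\in\mathbb D$ (for instance $z_0=0$), writing $D(g)=\{z\in\mathbb D: d(z,g z_0)\le d(z,z_0)\}$, the closures in $\overline{\mathbb D}=\mathbb D\cup\mathbb S^1$ of $D(h)\cup D(h^{-1})$ and of $D(p)\cup D(p^{-1})$ are disjoint. Let $\Gamma=\langle h,p\rangle$, so that $\Sigma=\Gamma\backslash\mathbb D$ is a pair of pants with one cusp, let $\pi:\mathbb D\to\Sigma$ be the projection and $\Lambda=\overline{\Gamma\cdot 0}\cap\mathbb S^1$ the limit set. Let $\Lambda_\infty$ be the set of limit points diverging on average, i.e. of those $\xi\in\Lambda$ such that, for every unit speed geodesic ray $\tilde\sigma:[0,\infty)\to\mathbb D$ ending at $\xi$ and every compact $W\subset\Sigma$, $$\lim_{T\to+\infty}\frac1T\int_0^T\chi_W(\pi(\tilde\sigma(t)))\,dt=0.$$ Let $\mathbb S^1$ carry the visual metric $d_0(\xi,\eta)=e^{-\langle\xi,\eta\rangle_0}$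 for $\xi\ne\eta$, $d_0(\xi,\xi)=0$, where $\langle\xi,\eta\rangle_0=\frac12(\beta_\xi(0,z)+\beta_\eta(0,z))$ for any point $z$ of the geodesic $(\xi,\eta)$ and $\beta_\xi(z,w)=\lim_{t\to+\infty}(d(z,\xi_t)-d(w,\xi_t))$ along a geodesic ray $t\mapsto\xi_t$ ending at $\xi$. Then the Hausdorff dimension of $\Lambda_\infty$ is equal to the critical exponent of the parabolic subgroup $\langle p\rangle$, that is, to $\inf\{s\ge 0:\sum_{g\in\langle p\rangle}e^{-s\,d(0,g0)}<\infty\}$, and both are equal to $\frac12$: $$\dim_H(\Lambda_\infty)=\delta_{\langle p\rangle}=\frac12 .$$ -/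

import Mathlib

open Filter Topology Set MeasureTheory
open scoped Complex.UnitDisc ENNReal NNReal ComplexConjugate

noncomputable section

namespace HypDisc

/-! ### The Poincaré disc -/

/-- The hyperbolic distance (curvature `-1`) of the Poincaré disc:
`sinh (d(z,w)/2) = |z-w| / √((1-|z|²)(1-|w|²))`. -/
def hdist (z w : 𝔻) : ℝ :=
  2 * Real.arsinh (‖(z : ℂ) - w‖ / √((1 - ‖(z : ℂ)‖ ^ 2) * (1 - ‖(w : ℂ)‖ ^ 2)))

/-- `g` is the orientation preserving isometry `z ↦ (a z + b) / (b̄ z + ā)` of the Poincaré disc,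
with `|a|² - |b|² = 1`, that is, the action of a matrix of `SU(1,1)` with trace `2 Re a`. -/
def IsMobius (g : Equiv.Perm 𝔻) (a b : ℂ) : Prop :=
  ‖a‖ ^ 2 - ‖b‖ ^ 2 = 1 ∧
    ∀ z : 𝔻, ((g z : 𝔻) : ℂ) = (a * (z : ℂ) + b) / (conj b * (z : ℂ) + conj a)

/-- Hyperbolic isometries: `|trace| > 2`. -/
def IsHyperbolic (g : Equiv.Perm 𝔻) : Prop :=
  ∃ a b : ℂ, IsMobius g a b ∧ 1 < |a.re|

/-- Parabolic isometries: `|trace| = 2`, not the identity. -/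
def IsParabolic (g : Equiv.Perm 𝔻) : Prop :=
  g ≠ 1 ∧ ∃ a b : ℂ, IsMobius g a b ∧ |a.re| = 1

/-- The closed half-plane `D(g)` containing `g z₀` and bounded by the bisector of
`[z₀, g z₀]`. -/
def halfPlane (z₀ : 𝔻) (g : Equiv.Perm 𝔻) : Set 𝔻 :=
  {z | hdist z (g z₀) ≤ hdist z z₀}

/-- The closure in the closed unit disc of a subset of the Poincaré disc. -/
def closureInClosedDisc (S : Set 𝔻) : Set ℂ :=
  closure ((fun z : 𝔻 => (z : ℂ)) '' S)

/-- The Schottky condition on the pair `h, p` relative to the base point `z₀`. -/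
def IsSchottkyPair (z₀ : 𝔻) (h p : Equiv.Perm 𝔻) : Prop :=
  Disjoint (closureInClosedDisc (halfPlane z₀ h ∪ halfPlane z₀ h⁻¹))
    (closureInClosedDisc (halfPlane z₀ p ∪ halfPlane z₀ p⁻¹))

/-! ### Limit points diverging on average -/

/-- The limit set: boundary points that are accumulated by the orbit of `0`. -/
def limitSet (Γ : Subgroup (Equiv.Perm 𝔻)) : Set Circle :=
  {ξ | (ξ : ℂ) ∈ closureInClosedDisc (MulAction.orbit Γ (0 : 𝔻))}

/-- The quotient surface `Γ \ 𝔻`, with the quotient topology. -/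
abbrev Surface (Γ : Subgroup (Equiv.Perm 𝔻)) : Type :=
  Quotient (MulAction.orbitRel Γ 𝔻)

/-- The projection `𝔻 → Γ \ 𝔻`. -/
def proj (Γ : Subgroup (Equiv.Perm 𝔻)) (z : 𝔻) : Surface Γ :=
  Quotient.mk (MulAction.orbitRel Γ 𝔻) z

/-- `σ`, restricted to `[0,∞)`, is a unit speed geodesic ray of the Poincaré disc. -/
def IsGeodesicRay (σ : ℝ → 𝔻) : Prop :=
  ∀ s t : ℝ, 0 ≤ s → 0 ≤ t → hdist (σ s) (σ t) = |s - t|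

/-- `σ t` tends to the boundary point `ξ` as `t → ∞`. -/
def EndsAt (σ : ℝ → 𝔻) (ξ : Circle) : Prop :=
  Tendsto (fun t => ((σ t : 𝔻) : ℂ)) atTop (𝓝 (ξ : ℂ))

/-- The set `Λ_∞` of limit points diverging on average. The geodesic rays of the surface are the
projections of the geodesic rays of the disc. -/
def divergingOnAverage (Γ : Subgroup (Equiv.Perm 𝔻)) : Set Circle :=
  {ξ | ξ ∈ limitSet Γ ∧
    ∀ σ : ℝ → 𝔻, IsGeodesicRay σ → EndsAt σ ξ →
      ∀ W : Set (Surface Γ), IsCompact W →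
        Tendsto (fun T : ℝ => (1 / T) * ∫ t in (0 : ℝ)..T,
          W.indicator (fun _ => (1 : ℝ)) (proj Γ (σ t))) atTop (𝓝 0)}

/-- The critical exponent: the infimum of the `s ≥ 0` for which the Poincaré series
`∑_{g ∈ P} exp (-s d(0, g 0))` converges. -/
def criticalExponent (P : Subgroup (Equiv.Perm 𝔻)) : ℝ≥0∞ :=
  ⨅ (s : ℝ≥0) (_ : ∑' g : P, ENNReal.ofReal
    (Real.exp (-(s : ℝ) * hdist 0 ((g : Equiv.Perm 𝔻) 0))) ≠ ∞), (s : ℝ≥0∞)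

/-! ### The visual metric on the circle -/

theorem abs_tanh_lt_one' (t : ℝ) : |Real.tanh t| < 1 := by
  have hc : 0 < Real.cosh t := Real.cosh_pos t
  rw [Real.tanh_eq_sinh_div_cosh, abs_div, abs_of_pos hc, div_lt_one hc, abs_lt]
  constructor <;> nlinarith [Real.cosh_sq t, Real.sinh_lt_cosh t, Real.cosh_add_sinh t,
    Real.exp_pos t]

/-- The unit speed geodesic ray from `0` to `ξ`. -/
def ray (ξ : Circle) (t : ℝ) : 𝔻 :=
  Complex.UnitDisc.mk ((Real.tanh (t / 2) : ℝ) * (ξ : ℂ)) (by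
    rw [norm_mul, Circle.norm_coe, mul_one, Complex.norm_real, Real.norm_eq_abs]
    exact abs_tanh_lt_one' _)

/-- The Busemann cocycle `β_ξ(z, w) = lim (d(z, ξ_t) - d(w, ξ_t))`. -/
def busemann (ξ : Circle) (z w : 𝔻) : ℝ :=
  limUnder atTop (fun t : ℝ => hdist z (ray ξ t) - hdist w (ray ξ t))

theorem norm_lt_of_ne {ξ η : Circle} (h : ξ ≠ η) :
    ‖((ξ : ℂ) + η) / (2 + ‖(ξ : ℂ) - η‖ : ℝ)‖ < 1 := by
  have h0 : 0 < ‖(ξ : ℂ) - η‖ := norm_pos_iff.2 (sub_ne_zero.2 (fun e => h (Circle.ext e)))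
  rw [norm_div, Complex.norm_real, Real.norm_eq_abs, abs_of_pos (by linarith),
    div_lt_one (by linarith)]
  have := norm_add_le (ξ : ℂ) (η : ℂ)
  simp only [Circle.norm_coe] at this
  linarith

/-- The point closest to `0` of the geodesic `(ξ, η)`. -/
def geodesicPoint (ξ η : Circle) (h : ξ ≠ η) : 𝔻 :=
  Complex.UnitDisc.mk (((ξ : ℂ) + η) / (2 + ‖(ξ : ℂ) - η‖ : ℝ)) (norm_lt_of_ne h)

/-- The Gromov product based at `0`, which is `(β_ξ(0,z) + β_η(0,z)) / 2` for any point `z` of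
the geodesic `(ξ, η)`. -/
def gromovProduct (ξ η : Circle) (h : ξ ≠ η) : ℝ :=
  (busemann ξ 0 (geodesicPoint ξ η h) + busemann η 0 (geodesicPoint ξ η h)) / 2

open Classical in
/-- The visual distance based at `0`. -/
def visualDist (ξ η : Circle) : ℝ :=
  if h : ξ = η then 0 else Real.exp (-gromovProduct ξ η h)

theorem tendsto_tanh_half : Tendsto (fun t : ℝ => Real.tanh (t / 2)) atTop (𝓝 1) := by
  have h1 : Tendsto (fun t : ℝ => Real.exp (-t)) atTop (𝓝 0) :=
    Real.tendsto_exp_neg_atTop_nhds_zero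
  have h2 : Tendsto (fun t : ℝ => (1 - Real.exp (-t)) / (1 + Real.exp (-t))) atTop
      (𝓝 ((1 - 0) / (1 + 0))) :=
    (tendsto_const_nhds.sub h1).div (tendsto_const_nhds.add h1) (by norm_num)
  simp only [sub_zero, add_zero, div_one] at h2
  refine h2.congr (fun t => ?_)
  rw [Real.tanh_eq_sinh_div_cosh, Real.sinh_eq, Real.cosh_eq]
  have e : Real.exp (-t) = Real.exp (-(t / 2)) * Real.exp (-(t / 2)) := by
    rw [← Real.exp_add]; ring_nf
  have e2 : Real.exp (t / 2) * Real.exp (-(t / 2)) = 1 := by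
    rw [← Real.exp_add]; simp
  have p1 := Real.exp_pos (t / 2)
  have p2 := Real.exp_pos (-(t / 2))
  rw [e]
  rw [div_eq_div_iff (by positivity) (by positivity)]
  linear_combination (-Real.exp (-(t / 2)) * 1) * e2

theorem tendsto_hdist_ray (ξ : Circle) (z : 𝔻) :
    Tendsto (fun t : ℝ => hdist z (ray ξ t) - t) atTop
      (𝓝 (Real.log (‖(z : ℂ) - ξ‖ ^ 2 / (1 - ‖(z : ℂ)‖ ^ 2)))) := by
  have hz : 0 < 1 - ‖(z : ℂ)‖ ^ 2 := by linarith [z.sq_norm_lt_one]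
  have hne : 0 < ‖(z : ℂ) - ξ‖ := by
    refine norm_pos_iff.2 (sub_ne_zero.2 (fun e => z.norm_ne_one ?_))
    rw [e, Circle.norm_coe]
  set K : ℝ := √(1 - ‖(z : ℂ)‖ ^ 2) with hK
  have hKpos : 0 < K := Real.sqrt_pos.2 hz
  set A : ℝ → ℝ := fun t => ‖(z : ℂ) - (ray ξ t : ℂ)‖ / K with hA
  have hray : Tendsto (fun t : ℝ => ((ray ξ t : 𝔻) : ℂ)) atTop (𝓝 (ξ : ℂ)) := by
    have h1 : Tendsto (fun t : ℝ => ((Real.tanh (t / 2) : ℝ) : ℂ) * (ξ : ℂ)) atTop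
        (𝓝 (((1 : ℝ) : ℂ) * (ξ : ℂ))) :=
      ((Complex.continuous_ofReal.tendsto 1).comp tendsto_tanh_half).mul_const _
    simpa [ray] using h1
  have hAt : Tendsto A atTop (𝓝 (‖(z : ℂ) - ξ‖ / K)) :=
    ((tendsto_const_nhds.sub hray).norm).div_const _
  set c : ℝ → ℝ := fun t => (1 + Real.exp (-t)) / 2 with hc
  have hct : Tendsto c atTop (𝓝 (1 / 2)) := by
    have := (tendsto_const_nhds (x := (1 : ℝ))).add Real.tendsto_exp_neg_atTop_nhds_zero
    simpa using this.div_const 2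
  have hlim : Tendsto (fun t => 2 * Real.log (c t * A t + √(Real.exp (-t) + (c t * A t) ^ 2)))
      atTop (𝓝 (2 * Real.log (1 / 2 * (‖(z : ℂ) - ξ‖ / K)
        + √(0 + (1 / 2 * (‖(z : ℂ) - ξ‖ / K)) ^ 2)))) := by
    have hcA := hct.mul hAt
    refine Tendsto.const_mul 2 (Tendsto.log ?_ ?_)
    · exact hcA.add ((Real.tendsto_exp_neg_atTop_nhds_zero.add (hcA.pow 2)).sqrt)
    · positivity
  have hval : 2 * Real.log (1 / 2 * (‖(z : ℂ) - ξ‖ / K)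
        + √(0 + (1 / 2 * (‖(z : ℂ) - ξ‖ / K)) ^ 2))
      = Real.log (‖(z : ℂ) - ξ‖ ^ 2 / (1 - ‖(z : ℂ)‖ ^ 2)) := by
    rw [zero_add, Real.sqrt_sq (by positivity)]
    have : ‖(z : ℂ) - ξ‖ ^ 2 / (1 - ‖(z : ℂ)‖ ^ 2) = (‖(z : ℂ) - ξ‖ / K) ^ 2 := by
      rw [div_pow, hK, Real.sq_sqrt hz.le]
    rw [this, Real.log_pow]
    push_cast
    ring_nf
  rw [hval] at hlim
  refine hlim.congr (fun t => ?_)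
  have hcosh : 0 < Real.cosh (t / 2) := Real.cosh_pos _
  have hn : 1 - ‖((ray ξ t : 𝔻) : ℂ)‖ ^ 2 = (Real.cosh (t / 2) ^ 2)⁻¹ := by
    have : ‖((ray ξ t : 𝔻) : ℂ)‖ ^ 2 = Real.tanh (t / 2) ^ 2 := by
      simp only [ray, Complex.UnitDisc.coe_mk, norm_mul, Circle.norm_coe, mul_one,
        Complex.norm_real, Real.norm_eq_abs, sq_abs]
    rw [this, Real.tanh_eq_sinh_div_cosh, div_pow, Real.sinh_sq]
    field_simp
    ring
  have harg : ‖(z : ℂ) - (ray ξ t : ℂ)‖ /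
      √((1 - ‖(z : ℂ)‖ ^ 2) * (1 - ‖((ray ξ t : 𝔻) : ℂ)‖ ^ 2)) = Real.cosh (t / 2) * A t := by
    rw [hn, Real.sqrt_mul hz.le, Real.sqrt_inv, Real.sqrt_sq hcosh.le, hA, ← hK]
    field_simp
  have e2 : Real.exp (t / 2) * c t = Real.cosh (t / 2) := by
    rw [hc, Real.cosh_eq, mul_div_assoc', mul_add, mul_one, ← Real.exp_add]
    ring_nf
  have e3 : Real.exp (t / 2) ^ 2 * Real.exp (-t) = 1 := by
    rw [← Real.exp_nat_mul, ← Real.exp_add]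
    simp; ring_nf
  have hApos : 0 ≤ A t := by positivity
  have hcpos : 0 < c t := by positivity
  have key : Real.cosh (t / 2) * A t + √(1 + (Real.cosh (t / 2) * A t) ^ 2)
      = Real.exp (t / 2) * (c t * A t + √(Real.exp (-t) + (c t * A t) ^ 2)) := by
    have : 1 + (Real.cosh (t / 2) * A t) ^ 2
        = Real.exp (t / 2) ^ 2 * (Real.exp (-t) + (c t * A t) ^ 2) := by
      rw [mul_add, e3, ← e2]; ring
    rw [this, Real.sqrt_mul (by positivity), Real.sqrt_sq (Real.exp_pos _).le, ← e2]
    ring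
  unfold hdist
  rw [harg, Real.arsinh, key, Real.log_mul (Real.exp_pos _).ne' (by positivity), Real.log_exp]
  ring

theorem busemann_eq (ξ : Circle) (z w : 𝔻) :
    busemann ξ z w = Real.log (‖(z : ℂ) - ξ‖ ^ 2 / (1 - ‖(z : ℂ)‖ ^ 2))
      - Real.log (‖(w : ℂ) - ξ‖ ^ 2 / (1 - ‖(w : ℂ)‖ ^ 2)) := by
  refine Tendsto.limUnder_eq ?_
  refine ((tendsto_hdist_ray ξ z).sub (tendsto_hdist_ray ξ w)).congr (fun t => ?_)
  ring

/-- The visual distance is half the Euclidean one. -/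
theorem visualDist_eq (ξ η : Circle) : visualDist ξ η = ‖(ξ : ℂ) - η‖ / 2 := by
  unfold visualDist
  split_ifs with h
  · simp [h]
  have h0 : 0 < ‖(ξ : ℂ) - η‖ := norm_pos_iff.2 (sub_ne_zero.2 (fun e => h (Circle.ext e)))
  set s : ℝ := ‖(ξ : ℂ) - η‖ / 2 with hs
  have hspos : 0 < s := by positivity
  have n1 : (ξ : ℂ).re ^ 2 + (ξ : ℂ).im ^ 2 = 1 := by
    have := Circle.normSq_coe ξ
    rw [Complex.normSq_apply] at this; linarith
  have n2 : (η : ℂ).re ^ 2 + (η : ℂ).im ^ 2 = 1 := by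
    have := Circle.normSq_coe η
    rw [Complex.normSq_apply] at this; linarith
  have n3 : ((ξ : ℂ).re - (η : ℂ).re) ^ 2 + ((ξ : ℂ).im - (η : ℂ).im) ^ 2 = 4 * s ^ 2 := by
    have : ‖(ξ : ℂ) - η‖ ^ 2 = 4 * s ^ 2 := by rw [hs]; ring
    rw [← this, ← Complex.normSq_eq_norm_sq, Complex.normSq_apply]
    simp only [Complex.sub_re, Complex.sub_im]; ring
  set z := geodesicPoint ξ η h with hzdef
  have hzc : (z : ℂ) = ((ξ : ℂ) + η) / ((2 * (1 + s) : ℝ) : ℂ) := by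
    rw [hzdef, geodesicPoint, Complex.UnitDisc.coe_mk]
    congr 2
    rw [hs]; ring
  have hzre : (z : ℂ).re = ((ξ : ℂ).re + (η : ℂ).re) / (2 * (1 + s)) := by
    rw [hzc, Complex.div_ofReal_re, Complex.add_re]
  have hzim : (z : ℂ).im = ((ξ : ℂ).im + (η : ℂ).im) / (2 * (1 + s)) := by
    rw [hzc, Complex.div_ofReal_im, Complex.add_im]
  have hz1 : 1 - ‖(z : ℂ)‖ ^ 2 = 2 * s / (1 + s) := by
    rw [← Complex.normSq_eq_norm_sq, Complex.normSq_apply, hzre, hzim]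
    field_simp
    linear_combination (-2) * n1 - 2 * n2 + n3
  have aux : ∀ x y u v : ℝ, x ^ 2 + y ^ 2 = 1 → u ^ 2 + v ^ 2 = 1 →
      (x - u) ^ 2 + (y - v) ^ 2 = 4 * s ^ 2 →
      ((x + u) / (2 * (1 + s)) - x) * ((x + u) / (2 * (1 + s)) - x)
        + ((y + v) / (2 * (1 + s)) - y) * ((y + v) / (2 * (1 + s)) - y)
        = 2 * s ^ 2 / (1 + s) := by
    intro x y u v h1 h2 h3
    have hx : ∀ x u : ℝ, (x + u) / (2 * (1 + s)) - x
        = (u - (1 + 2 * s) * x) / (2 * (1 + s)) := by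
      intro x u; field_simp; ring
    have hr : 2 * s ^ 2 / (1 + s)
        = (8 * s ^ 2 * (1 + s)) / ((2 * (1 + s)) * (2 * (1 + s))) := by
      field_simp; ring
    rw [hx, hx, div_mul_div_comm, div_mul_div_comm, ← add_div, hr]
    congr 1
    linear_combination (2 * s * (1 + 2 * s)) * h1 - 2 * s * h2 + (1 + 2 * s) * h3
  have hzξ : ‖(z : ℂ) - ξ‖ ^ 2 = 2 * s ^ 2 / (1 + s) := by
    rw [← Complex.normSq_eq_norm_sq, Complex.normSq_apply, Complex.sub_re, Complex.sub_im,
      hzre, hzim]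
    exact aux _ _ _ _ n1 n2 n3
  have hzη : ‖(z : ℂ) - η‖ ^ 2 = 2 * s ^ 2 / (1 + s) := by
    rw [← Complex.normSq_eq_norm_sq, Complex.normSq_apply, Complex.sub_re, Complex.sub_im,
      hzre, hzim, add_comm (ξ : ℂ).re, add_comm (ξ : ℂ).im]
    exact aux _ _ _ _ n2 n1 (by rw [← n3]; ring)
  have hq : 2 * s ^ 2 / (1 + s) / (2 * s / (1 + s)) = s := by
    field_simp
  rw [gromovProduct, busemann_eq, busemann_eq, ← hzdef, hz1, hzξ, hzη, hq]
  have e0 : ∀ ζ : Circle, Real.log (‖((0 : 𝔻) : ℂ) - ζ‖ ^ 2 / (1 - ‖((0 : 𝔻) : ℂ)‖ ^ 2)) = 0 := by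
    intro ζ
    simp [Circle.norm_coe]
  rw [e0, e0]
  have : -((0 - Real.log s + (0 - Real.log s)) / 2) = Real.log s := by ring
  rw [this, Real.exp_log hspos]

/-- The circle endowed with the visual distance. -/
structure VisualCircle where
  /-- The underlying point of the unit circle. -/
  toCircle : Circle

instance : MetricSpace VisualCircle where
  dist ξ η := visualDist ξ.toCircle η.toCircle
  dist_self ξ := by simp [visualDist]
  dist_comm ξ η := by
    simp only [visualDist_eq]
    rw [norm_sub_rev]
  dist_triangle ξ η ζ := by
    simp only [visualDist_eq]
    have := norm_sub_le_norm_sub_add_norm_sub (ξ.toCircle : ℂ) (η.toCircle : ℂ) (ζ.toCircle : ℂ)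
    linarith
  eq_of_dist_eq_zero := by
    rintro ⟨ξ⟩ ⟨η⟩ h
    simp only [visualDist_eq] at h
    congr 1
    exact Circle.ext (sub_eq_zero.1 (norm_eq_zero.1 (by linarith)))

end HypDisc

end

/-!
The parabolic group `⟨p⟩` has critical exponent `1 / 2` because `1 - |pⁿ 0|²`, which is comparable to
`exp (-d(0, pⁿ 0))`, decays exactly like `n⁻²`. The number `defect z = 1 - |z|²` is used throughout
in place of the distance to the base point.

The Schottky condition yields ping-pong, with disjoint closures: in a reduced word `w w'` of powers
of `h` and `p` the points `w⁻¹ z₀` and `w' z₀` are uniformly apart. Hence the defect is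
submultiplicative along reduced words, up to a factor for each letter, and all orbit points with
prefix `w` lie in a disc about `w z₀`, the shadow of `w`, of radius comparable to the defect of
`w z₀` (`IsSchottky.exists_prefix_bound`). For both generators the defect of `gⁿ z₀` is `O(n⁻²)`.

*Upper bound.* Outside a countable set, every limit point `ξ` lies in the shadows of all the prefixes
of arbitrarily long reduced words. The ray to `ξ` passes at bounded distance from the orbit points of
these prefixes, so in a time `T` it spends in a fixed compact part of the surface at least a constant
times the number of prefixes visited. If `ξ` diverges on average, the defect of the prefix of length
`k` is therefore smaller than `exp (-M k)`, for every `M` and large `k`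
(`IsSchottky.exists_defect_le_exp`). For `1 / 2 < t < s` the sum over the words of length `k` of the
`t`-th powers of the defects is at most `2 A ^ k`, with `A` the sum over a single letter; the
remaining power `s - t` contributes `exp (-M (s - t) k)`. With `M` large the covers by shadows show
that the `s`-dimensional measure vanishes (`IsSchottky.dimH_le`).

*Lower bound.* The words `p^{n₀} h p^{n₁} h ⋯` with `2 ^ i ≤ n_i < 2 ^ (i + 1)` lead to limit points
`ξ`. During the `i`-th excursion, of duration about `2 i log 2`, the ray is in a bounded part of the
surface only for a bounded time at the beginning and at the end: in between it enters the horoball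
at the fixed point of a conjugate of `p`, by Ptolemy's inequality
(`IsSchottky.exists_excursion_bound`). So `ξ` diverges on average (`IsSchottky.excursion_limit_mem`).
The number of choices of the first `k` exponents is `2 ^ S` with `S = ∑ i < k, i`, and two limit
points which differ at the next one are at distance at least `4 ^ (-S)`, up to a factor `r ^ k`,
which is negligible as `S` is quadratic in `k`. Reading the exponents as the digits of a number gives
a map onto `[0, 1)` which is Hölder continuous of every exponent less than `1 / 2`
(`IsSchottky.le_dimH`).
-/

noncomputable section

namespace HypDisc

/-! ### The hyperbolic metric of the disc -/

/-- The quantity `1 - |z|²`. Up to bounded factors it is `exp (-d(0, z))`, and it governs both the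
hyperbolic distance and the change of Euclidean distances under isometries. -/
def defect (z : 𝔻) : ℝ := 1 - ‖(z : ℂ)‖ ^ 2

lemma defect_pos (z : 𝔻) : 0 < defect z := by
  unfold defect; linarith [z.sq_norm_lt_one]

lemma defect_le_one (z : 𝔻) : defect z ≤ 1 := by
  unfold defect; linarith [sq_nonneg ‖(z : ℂ)‖]

lemma continuous_defect : Continuous defect := by
  unfold defect
  have := Complex.UnitDisc.continuous_coe
  fun_prop

lemma sinh_half_hdist (z w : 𝔻) :
    Real.sinh (hdist z w / 2) = ‖(z : ℂ) - w‖ / √(defect z * defect w) := by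
  unfold hdist defect
  rw [mul_div_cancel_left₀ _ two_ne_zero, Real.sinh_arsinh]

lemma continuous_hdist (z : 𝔻) : Continuous (hdist z) := by
  have hc := Complex.UnitDisc.continuous_coe
  have hd := continuous_defect
  change Continuous fun w : 𝔻 => 2 * Real.arsinh (‖(z : ℂ) - w‖ / √(defect z * defect w))
  refine continuous_const.mul (Real.continuous_arsinh.comp (Continuous.div (by fun_prop)
    (by fun_prop) fun w => ?_))
  exact (Real.sqrt_pos.2 (mul_pos (defect_pos z) (defect_pos w))).ne'

lemma hdist_nonneg (z w : 𝔻) : 0 ≤ hdist z w := by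
  unfold hdist
  have : 0 ≤ Real.arsinh (‖(z : ℂ) - w‖ / √((1 - ‖(z : ℂ)‖ ^ 2) * (1 - ‖(w : ℂ)‖ ^ 2))) :=
    Real.arsinh_nonneg_iff.2 (by positivity)
  linarith

lemma hdist_comm (z w : 𝔻) : hdist z w = hdist w z := by
  unfold hdist
  rw [norm_sub_rev, mul_comm (1 - ‖(z : ℂ)‖ ^ 2)]

lemma hdist_self (z : 𝔻) : hdist z z = 0 := by simp [hdist]

/-- The inverse Cayley transform `z ↦ i (1 + z) / (1 - z)`. -/
def toUpperHalfPlane (z : 𝔻) : UpperHalfPlane :=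
  ⟨Complex.I * ((1 + z) / (1 - z)), by
    have h1 : (1 - (z : ℂ)) ≠ 0 := sub_ne_zero.2 (Ne.symm z.coe_ne_one)
    have h2 : 0 < Complex.normSq (1 - (z : ℂ)) := Complex.normSq_pos.2 h1
    have h3 := z.normSq_lt_one
    rw [Complex.normSq_apply] at h3
    rw [Complex.I_mul_im, Complex.div_re, ← add_div]
    refine div_pos ?_ h2
    simp only [Complex.add_re, Complex.one_re, Complex.sub_re, Complex.add_im, Complex.one_im,
      Complex.sub_im]
    nlinarith⟩

lemma im_toUpperHalfPlane (z : 𝔻) :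
    (toUpperHalfPlane z).im = defect z / ‖1 - (z : ℂ)‖ ^ 2 := by
  change (Complex.I * ((1 + (z : ℂ)) / (1 - z))).im = _
  rw [Complex.I_mul_im, Complex.div_re, ← add_div, ← Complex.normSq_eq_norm_sq, defect,
    ← Complex.normSq_eq_norm_sq]
  congr 1
  rw [Complex.normSq_apply]
  simp only [Complex.add_re, Complex.one_re, Complex.sub_re, Complex.add_im, Complex.one_im,
    Complex.sub_im]
  ring

lemma dist_toUpperHalfPlane (z w : 𝔻) :
    dist (toUpperHalfPlane z) (toUpperHalfPlane w) = hdist z w := by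
  have hz : (1 - (z : ℂ)) ≠ 0 := sub_ne_zero.2 (Ne.symm z.coe_ne_one)
  have hw : (1 - (w : ℂ)) ≠ 0 := sub_ne_zero.2 (Ne.symm w.coe_ne_one)
  have hz' := norm_pos_iff.2 hz
  have hw' := norm_pos_iff.2 hw
  have e1 : (((toUpperHalfPlane z : UpperHalfPlane) : ℂ) - (toUpperHalfPlane w : ℂ))
      = 2 * Complex.I * ((z : ℂ) - w) / ((1 - z) * (1 - w)) := by
    change Complex.I * ((1 + (z : ℂ)) / (1 - z)) - Complex.I * ((1 + (w : ℂ)) / (1 - w)) = _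
    field_simp
    ring
  rw [UpperHalfPlane.dist_eq, hdist, dist_eq_norm, e1, im_toUpperHalfPlane, im_toUpperHalfPlane]
  congr 2
  have e2 : √(defect z / ‖1 - (z : ℂ)‖ ^ 2 * (defect w / ‖1 - (w : ℂ)‖ ^ 2))
      = √(defect z * defect w) / (‖1 - (z : ℂ)‖ * ‖1 - (w : ℂ)‖) := by
    rw [div_mul_div_comm, ← mul_pow, Real.sqrt_div' _ (by positivity),
      Real.sqrt_sq (by positivity)]
  have e3 : 0 < √(defect z * defect w) := Real.sqrt_pos.2 (mul_pos (defect_pos z) (defect_pos w))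
  rw [e2, norm_div, norm_mul, norm_mul, norm_mul, Complex.norm_I]
  change _ = ‖(z : ℂ) - w‖ / √(defect z * defect w)
  simp only [Complex.norm_ofNat]
  field_simp

lemma hdist_triangle (z w v : 𝔻) : hdist z v ≤ hdist z w + hdist w v := by
  simp only [← dist_toUpperHalfPlane]
  exact dist_triangle _ _ _

lemma sq_sinh_half_hdist (z w : 𝔻) :
    Real.sinh (hdist z w / 2) ^ 2 * (defect z * defect w) = ‖(z : ℂ) - w‖ ^ 2 := by
  have := mul_pos (defect_pos z) (defect_pos w)
  rw [sinh_half_hdist, div_pow, Real.sq_sqrt this.le, div_mul_cancel₀ _ this.ne']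

lemma norm_sub_eq_sinh (z w : 𝔻) :
    ‖(z : ℂ) - w‖ = Real.sinh (hdist z w / 2) * (√(defect z) * √(defect w)) := by
  have h1 := Real.sqrt_pos.2 (defect_pos z)
  have h2 := Real.sqrt_pos.2 (defect_pos w)
  rw [sinh_half_hdist, Real.sqrt_mul (defect_pos z).le]
  field_simp

lemma sq_cosh_half_hdist_zero (z : 𝔻) : Real.cosh (hdist 0 z / 2) ^ 2 = 1 / defect z := by
  have h := sq_sinh_half_hdist 0 z
  have h0 : defect 0 = 1 := by simp [defect]
  rw [h0, one_mul, Complex.UnitDisc.coe_zero, zero_sub, norm_neg] at h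
  rw [eq_div_iff (defect_pos z).ne', Real.cosh_sq, add_mul, h, defect]
  ring

lemma exp_neg_hdist_le_defect (z : 𝔻) : Real.exp (-hdist 0 z) ≤ defect z := by
  have h := sq_cosh_half_hdist_zero z
  have h2 : Real.cosh (hdist 0 z / 2) ≤ Real.exp (hdist 0 z / 2) := by
    rw [← Real.cosh_add_sinh]
    linarith [Real.sinh_nonneg_iff.2 (by linarith [hdist_nonneg 0 z] : 0 ≤ hdist 0 z / 2)]
  have h3 : Real.cosh (hdist 0 z / 2) ^ 2 ≤ Real.exp (hdist 0 z) := by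
    refine (pow_le_pow_left₀ (Real.cosh_pos _).le h2 2).trans_eq ?_
    rw [← Real.exp_nat_mul]; congr 1; push_cast; ring
  rw [h] at h3
  rw [Real.exp_neg, ← one_div]
  exact (one_div_le (Real.exp_pos _) (defect_pos z)).2 h3

lemma defect_le_exp_neg_hdist (z : 𝔻) : defect z ≤ 4 * Real.exp (-hdist 0 z) := by
  have h := sq_cosh_half_hdist_zero z
  have h2 : Real.exp (hdist 0 z / 2) ≤ 2 * Real.cosh (hdist 0 z / 2) := by
    rw [Real.cosh_eq]; linarith [Real.exp_pos (-(hdist 0 z / 2))]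
  have h3 : Real.exp (hdist 0 z) ≤ 4 * (1 / defect z) := by
    rw [← h]
    refine le_trans (le_of_eq ?_) ((pow_le_pow_left₀ (Real.exp_pos _).le h2 2).trans_eq ?_)
    · rw [← Real.exp_nat_mul]; congr 1; push_cast; ring
    · ring
  have hd := defect_pos z
  have he := Real.exp_pos (hdist 0 z)
  rw [Real.exp_neg]
  rw [mul_one_div, le_div_iff₀ hd] at h3
  rw [← div_eq_mul_inv, le_div_iff₀ he]
  linarith

lemma eq_of_hdist_eq_zero {z w : 𝔻} (h : hdist z w = 0) : z = w := by
  have := sq_sinh_half_hdist z w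
  rw [h] at this
  simp only [zero_div, Real.sinh_zero] at this
  have h2 : ‖(z : ℂ) - w‖ = 0 := by
    have : ‖(z : ℂ) - w‖ ^ 2 = 0 := by rw [← this]; ring
    exact pow_eq_zero_iff two_ne_zero |>.1 this
  exact Complex.UnitDisc.coe_inj.1 (sub_eq_zero.1 (norm_eq_zero.1 h2))

lemma hdist_pos_of_ne {z w : 𝔻} (h : z ≠ w) : 0 < hdist z w :=
  lt_of_le_of_ne (hdist_nonneg z w) fun e => h (eq_of_hdist_eq_zero e.symm)

lemma sinh_half_le_exp (x : ℝ) : Real.sinh (x / 2) ≤ Real.exp (x / 2) := by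
  rw [← Real.cosh_add_sinh]; linarith [Real.cosh_pos (x / 2)]

/-- `hdist z w ≤ hdist z' w'` in terms of `sinh (d / 2)`. -/
lemma hdist_le_iff {z w z' w' : 𝔻} :
    hdist z w ≤ hdist z' w' ↔ Real.sinh (hdist z w / 2) ≤ Real.sinh (hdist z' w' / 2) := by
  rw [Real.sinh_le_sinh]
  constructor <;> intro h <;> linarith

/-- Comparison of the defects of two points at bounded distance. -/
lemma defect_le_mul_defect (z w : 𝔻) : defect z ≤ 4 * Real.exp (hdist z w) * defect w := by
  have h1 := defect_le_exp_neg_hdist z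
  have h2 := exp_neg_hdist_le_defect w
  have h3 := hdist_triangle 0 z w
  have h4 : Real.exp (-hdist 0 z) ≤ Real.exp (hdist z w) * Real.exp (-hdist 0 w) := by
    rw [← Real.exp_add]; exact Real.exp_le_exp.2 (by linarith)
  calc defect z ≤ 4 * (Real.exp (hdist z w) * Real.exp (-hdist 0 w)) := by linarith
    _ ≤ 4 * (Real.exp (hdist z w) * defect w) := by gcongr
    _ = _ := by ring

/-! ### Möbius transformations -/

/-- The orientation preserving isometries of the disc. -/
def IsIsom (g : Equiv.Perm 𝔻) : Prop := ∃ a b, IsMobius g a b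

lemma norm_conj_mul_lt {a b : ℂ} (hab : ‖a‖ ^ 2 - ‖b‖ ^ 2 = 1) (z : 𝔻) :
    ‖conj b * (z : ℂ)‖ < ‖conj a‖ := by
  rw [norm_mul, Complex.norm_conj, Complex.norm_conj]
  have h1 : ‖b‖ * ‖(z : ℂ)‖ ≤ ‖b‖ := mul_le_of_le_one_right (norm_nonneg _) z.norm_lt_one.le
  have h2 : ‖b‖ < ‖a‖ := by nlinarith [norm_nonneg a, norm_nonneg b]
  linarith

lemma mobius_den_ne {a b : ℂ} (hab : ‖a‖ ^ 2 - ‖b‖ ^ 2 = 1) (z : 𝔻) :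
    conj b * (z : ℂ) + conj a ≠ 0 := fun h => by
  have h1 := norm_conj_mul_lt hab z
  rw [eq_neg_of_add_eq_zero_left h, norm_neg] at h1
  exact lt_irrefl _ h1

lemma mul_conj_eq {a b : ℂ} (hab : ‖a‖ ^ 2 - ‖b‖ ^ 2 = 1) :
    a * conj a - b * conj b = 1 := by
  rw [Complex.mul_conj, Complex.mul_conj, Complex.normSq_eq_norm_sq, Complex.normSq_eq_norm_sq]
  exact_mod_cast hab

lemma IsMobius.sub {g : Equiv.Perm 𝔻} {a b : ℂ} (hg : IsMobius g a b) (z w : 𝔻) :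
    ((g z : 𝔻) : ℂ) - (g w : 𝔻)
      = ((z : ℂ) - w) / ((conj b * z + conj a) * (conj b * w + conj a)) := by
  have hz := mobius_den_ne hg.1 z
  have hw := mobius_den_ne hg.1 w
  rw [hg.2, hg.2, div_sub_div _ _ hz hw]
  congr 1
  linear_combination ((z : ℂ) - w) * mul_conj_eq hg.1

lemma IsMobius.defect_apply {g : Equiv.Perm 𝔻} {a b : ℂ} (hg : IsMobius g a b) (z : 𝔻) :
    defect (g z) = defect z / ‖conj b * (z : ℂ) + conj a‖ ^ 2 := by
  have hz := norm_pos_iff.2 (mobius_den_ne hg.1 z)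
  rw [defect, hg.2, norm_div, div_pow, eq_div_iff (by positivity), sub_mul,
    div_mul_cancel₀ _ (by positivity), one_mul]
  have hab := hg.1
  unfold defect
  simp only [← Complex.normSq_eq_norm_sq, Complex.normSq_apply, Complex.add_re, Complex.mul_re,
    Complex.conj_re, Complex.conj_im, Complex.add_im, Complex.mul_im] at hab ⊢
  linear_combination (1 - (z : ℂ).re * (z : ℂ).re - (z : ℂ).im * (z : ℂ).im) * hab

lemma IsIsom.hdist_eq {g : Equiv.Perm 𝔻} (hg : IsIsom g) (z w : 𝔻) :
    hdist (g z) (g w) = hdist z w := by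
  obtain ⟨a, b, hg⟩ := hg
  have hz := norm_pos_iff.2 (mobius_den_ne hg.1 z)
  have hw := norm_pos_iff.2 (mobius_den_ne hg.1 w)
  have e : Real.sinh (hdist (g z) (g w) / 2) = Real.sinh (hdist z w / 2) := by
    rw [sinh_half_hdist, sinh_half_hdist, hg.sub, hg.defect_apply, hg.defect_apply, div_mul_div_comm,
      ← mul_pow, Real.sqrt_div' _ (by positivity), Real.sqrt_sq (by positivity), norm_div,
      norm_mul, div_div_div_cancel_right₀ (mul_pos hz hw).ne']
  have := Real.sinh_injective e
  linarith

lemma isMobius_one : IsMobius 1 1 0 := by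
  refine ⟨by simp, fun z => by simp⟩

lemma IsMobius.mul {f g : Equiv.Perm 𝔻} {a b c d : ℂ} (hf : IsMobius f a b)
    (hg : IsMobius g c d) : IsMobius (f * g) (a * c + b * conj d) (a * d + b * conj c) := by
  constructor
  · have h1 := hf.1
    have h2 := hg.1
    simp only [← Complex.normSq_eq_norm_sq, Complex.normSq_apply, Complex.add_re, Complex.mul_re,
      Complex.conj_re, Complex.conj_im, Complex.add_im, Complex.mul_im] at h1 h2 ⊢
    linear_combination (c.re * c.re + c.im * c.im - d.re * d.re - d.im * d.im) * h1 + h2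
  · intro z
    have hz := mobius_den_ne hg.1 z
    have hgz := mobius_den_ne hf.1 (g z)
    rw [hg.2] at hgz
    rw [Equiv.Perm.mul_apply, hf.2, hg.2]
    simp only [map_add, map_mul, Complex.conj_conj]
    have e1 : a * ((c * (z : ℂ) + d) / (conj d * z + conj c)) + b
        = ((a * c + b * conj d) * z + (a * d + b * conj c)) / (conj d * z + conj c) := by
      rw [mul_div_assoc', div_add' _ _ _ hz]; ring
    have e2 : conj b * ((c * (z : ℂ) + d) / (conj d * z + conj c)) + conj a
        = ((conj a * conj d + conj b * c) * z + (conj a * conj c + conj b * d))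
          / (conj d * z + conj c) := by
      rw [mul_div_assoc', div_add' _ _ _ hz]; ring
    rw [e1, e2, div_div_div_cancel_right₀ hz]

lemma IsMobius.inv {g : Equiv.Perm 𝔻} {a b : ℂ} (hg : IsMobius g a b) :
    IsMobius g⁻¹ (conj a) (-b) := by
  refine ⟨by simpa using hg.1, fun z => ?_⟩
  set w := g⁻¹ z with hw
  have hz : z = g w := by simp [hw]
  have hd := mobius_den_ne hg.1 w
  have hab := mul_conj_eq hg.1
  rw [hz, hg.2]
  simp only [map_neg, Complex.conj_conj]
  have e1 : conj a * ((a * (w : ℂ) + b) / (conj b * w + conj a)) + -b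
      = w / (conj b * w + conj a) := by
    rw [mul_div_assoc', div_add' _ _ _ hd]; congr 1; linear_combination (w : ℂ) * hab
  have e2 : -conj b * ((a * (w : ℂ) + b) / (conj b * w + conj a)) + a
      = 1 / (conj b * w + conj a) := by
    rw [mul_div_assoc', div_add' _ _ _ hd]; congr 1; linear_combination hab
  rw [e1, e2, div_div_div_cancel_right₀ hd, div_one]

lemma IsMobius.neg {g : Equiv.Perm 𝔻} {a b : ℂ} (hg : IsMobius g a b) :
    IsMobius g (-a) (-b) := by
  refine ⟨by simpa using hg.1, fun z => ?_⟩
  rw [hg.2]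
  simp only [map_neg]
  rw [← neg_div_neg_eq]
  ring_nf

/-- The group of orientation preserving isometries of the disc. -/
def isomGroup : Subgroup (Equiv.Perm 𝔻) where
  carrier := {g | IsIsom g}
  one_mem' := ⟨1, 0, isMobius_one⟩
  mul_mem' := by
    rintro f g ⟨a, b, hf⟩ ⟨c, d, hg⟩
    exact ⟨_, _, hf.mul hg⟩
  inv_mem' := by
    rintro g ⟨a, b, hg⟩
    exact ⟨_, _, hg.inv⟩

lemma IsIsom.continuous {g : Equiv.Perm 𝔻} (hg : IsIsom g) : Continuous g := by
  obtain ⟨a, b, hg⟩ := hg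
  rw [Complex.UnitDisc.isEmbedding_coe.continuous_iff]
  have : ((↑) : 𝔻 → ℂ) ∘ g = fun z : 𝔻 => (a * (z : ℂ) + b) / (conj b * z + conj a) := by
    ext z; exact hg.2 z
  rw [this]
  have hc := Complex.UnitDisc.continuous_coe
  exact Continuous.div (by fun_prop) (by fun_prop) fun z => mobius_den_ne hg.1 z

lemma IsIsom.inv {g : Equiv.Perm 𝔻} (hg : IsIsom g) : IsIsom g⁻¹ := isomGroup.inv_mem hg

lemma IsIsom.mul {f g : Equiv.Perm 𝔻} (hf : IsIsom f) (hg : IsIsom g) : IsIsom (f * g) :=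
  isomGroup.mul_mem hf hg

lemma IsIsom.zpow {g : Equiv.Perm 𝔻} (hg : IsIsom g) (n : ℤ) : IsIsom (g ^ n) :=
  isomGroup.zpow_mem hg n

lemma IsIsom.hdist_inv_apply {g : Equiv.Perm 𝔻} (hg : IsIsom g) (z w : 𝔻) :
    hdist (g⁻¹ z) w = hdist z (g w) := by
  rw [← hg.hdist_eq (g⁻¹ z) w]; simp

/-- The defect of `g⁻¹ z₀` is comparable to that of `g z₀`. -/
lemma IsIsom.defect_inv_le {g : Equiv.Perm 𝔻} (hg : IsIsom g) (z₀ : 𝔻) :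
    defect (g⁻¹ z₀) ≤ 4 * Real.exp (2 * hdist 0 z₀) * defect (g z₀) := by
  have h1 := defect_le_exp_neg_hdist (g⁻¹ z₀)
  have h2 := exp_neg_hdist_le_defect (g z₀)
  have h3 := hdist_triangle z₀ 0 (g⁻¹ z₀)
  have h4 : hdist z₀ (g⁻¹ z₀) = hdist z₀ (g z₀) := by
    rw [hdist_comm, hg.hdist_inv_apply]
  have h5 := hdist_triangle 0 z₀ (g z₀)
  have h6 := hdist_comm 0 z₀
  have h7 : Real.exp (-hdist 0 (g⁻¹ z₀))
      ≤ Real.exp (2 * hdist 0 z₀) * Real.exp (-hdist 0 (g z₀)) := by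
    rw [← Real.exp_add]; exact Real.exp_le_exp.2 (by linarith)
  calc defect (g⁻¹ z₀) ≤ 4 * (Real.exp (2 * hdist 0 z₀) * Real.exp (-hdist 0 (g z₀))) := by
        linarith
    _ ≤ 4 * (Real.exp (2 * hdist 0 z₀) * defect (g z₀)) := by gcongr
    _ = _ := by ring

/-- Isometries contract the defect at most as much as they contract that of the base point. -/
lemma IsIsom.mul_defect_le {g : Equiv.Perm 𝔻} (hg : IsIsom g) (z₀ u : 𝔻) :
    defect (g z₀) * defect u ≤ 16 * Real.exp (hdist 0 z₀) * defect (g u) := by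
  have h1 := defect_le_exp_neg_hdist (g z₀)
  have h2 := defect_le_exp_neg_hdist u
  have h3 := exp_neg_hdist_le_defect (g u)
  have h4 := hdist_triangle 0 (g z₀) (g u)
  have h5 := hdist_triangle z₀ 0 u
  have h6 := hdist_comm 0 z₀
  rw [hg.hdist_eq] at h4
  have h7 : Real.exp (-hdist 0 (g z₀)) * Real.exp (-hdist 0 u)
      ≤ Real.exp (hdist 0 z₀) * Real.exp (-hdist 0 (g u)) := by
    rw [← Real.exp_add, ← Real.exp_add]; exact Real.exp_le_exp.2 (by linarith)
  calc defect (g z₀) * defect u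
      ≤ (4 * Real.exp (-hdist 0 (g z₀))) * (4 * Real.exp (-hdist 0 u)) :=
        mul_le_mul h1 h2 (defect_pos _).le (by positivity)
    _ ≤ 16 * (Real.exp (hdist 0 z₀) * Real.exp (-hdist 0 (g u))) := by linarith
    _ ≤ 16 * (Real.exp (hdist 0 z₀) * defect (g u)) := by gcongr
    _ = _ := by ring

/-- If `g⁻¹ z₀` and `y` are `δ`-apart in the Euclidean sense, then the geodesic from `z₀` to `g y`
passes near `g z₀`; in terms of defects, `g` contracts that of `y` by at least the factor
`defect (g z₀)`. -/
lemma IsIsom.defect_apply_le {g : Equiv.Perm 𝔻} (hg : IsIsom g) {z₀ y : 𝔻} {δ : ℝ} (hδ : 0 < δ)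
    (h : δ ≤ ‖((g⁻¹ z₀ : 𝔻) : ℂ) - y‖) :
    defect (g y) ≤ 16 * Real.exp (2 * hdist 0 z₀) / (defect z₀ * δ ^ 2)
      * (defect (g z₀) * defect y) := by
  have h1 := sq_sinh_half_hdist z₀ (g y)
  have h2 := sq_sinh_half_hdist (g⁻¹ z₀) y
  rw [hg.hdist_inv_apply] at h2
  set s := Real.sinh (hdist z₀ (g y) / 2) ^ 2
  have h3 : ‖(z₀ : ℂ) - (g y : 𝔻)‖ ^ 2 ≤ 4 := by
    have : ‖(z₀ : ℂ) - (g y : 𝔻)‖ ≤ 2 := by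
      refine (norm_sub_le _ _).trans ?_
      linarith [z₀.norm_lt_one, (g y).norm_lt_one]
    nlinarith [norm_nonneg ((z₀ : ℂ) - (g y : 𝔻))]
  have h4 : δ ^ 2 ≤ ‖((g⁻¹ z₀ : 𝔻) : ℂ) - y‖ ^ 2 := pow_le_pow_left₀ hδ.le h 2
  have h5 := hg.defect_inv_le z₀
  have q0 := defect_pos z₀
  have q1 := defect_pos (g y)
  have q2 := defect_pos y
  have q3 := defect_pos (g z₀)
  have q4 := defect_pos (g⁻¹ z₀)
  have hs : 0 ≤ s := sq_nonneg _
  rw [div_mul_eq_mul_div, le_div_iff₀ (by positivity)]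
  set E := 4 * Real.exp (2 * hdist 0 z₀)
  have e : 16 * Real.exp (2 * hdist 0 z₀) = 4 * E := by ring
  rw [e]
  calc defect (g y) * (defect z₀ * δ ^ 2)
      ≤ defect (g y) * (defect z₀ * (s * (defect (g⁻¹ z₀) * defect y))) := by
        rw [h2]; gcongr
    _ = (s * (defect z₀ * defect (g y))) * (defect (g⁻¹ z₀) * defect y) := by ring
    _ ≤ 4 * ((E * defect (g z₀)) * defect y) := by
        rw [h1]; gcongr
    _ = _ := by ring

/-- The shadow estimate: under the same hypothesis `g y` is close to `g z₀`. -/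
lemma IsIsom.norm_sub_apply_le {g : Equiv.Perm 𝔻} (hg : IsIsom g) {z₀ y : 𝔻} {δ : ℝ}
    (hδ : 0 < δ) (h : δ ≤ ‖((g⁻¹ z₀ : 𝔻) : ℂ) - y‖) :
    ‖((g z₀ : 𝔻) : ℂ) - (g y : 𝔻)‖
      ≤ 8 * Real.exp (hdist 0 z₀) / (defect z₀ * δ) * defect (g z₀) := by
  have h1 := sq_sinh_half_hdist (g z₀) (g y)
  have h2 := sq_sinh_half_hdist z₀ y
  rw [hg.hdist_eq] at h1
  have h3 := hg.defect_apply_le hδ h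
  have q0 := defect_pos z₀
  have q1 := defect_pos (g y)
  have q2 := defect_pos y
  have q3 := defect_pos (g z₀)
  set s := Real.sinh (hdist z₀ y / 2) ^ 2
  have hs : 0 ≤ s := sq_nonneg _
  have h4 : ‖(z₀ : ℂ) - y‖ ^ 2 ≤ 4 := by
    have : ‖(z₀ : ℂ) - y‖ ≤ 2 := by
      refine (norm_sub_le _ _).trans ?_
      linarith [z₀.norm_lt_one, y.norm_lt_one]
    nlinarith [norm_nonneg ((z₀ : ℂ) - y)]
  have e2 : Real.exp (2 * hdist 0 z₀) = Real.exp (hdist 0 z₀) ^ 2 := by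
    rw [← Real.exp_nat_mul]; push_cast; rfl
  refine (sq_le_sq₀ (norm_nonneg _) (by positivity)).1 ?_
  rw [← h1]
  calc s * (defect (g z₀) * defect (g y))
      ≤ s * (defect (g z₀) * (16 * Real.exp (2 * hdist 0 z₀) / (defect z₀ * δ ^ 2)
          * (defect (g z₀) * defect y))) := by gcongr
    _ = (s * (defect z₀ * defect y)) *
        (16 * Real.exp (2 * hdist 0 z₀) / (defect z₀ ^ 2 * δ ^ 2) * defect (g z₀) ^ 2) := by
        field_simp
    _ ≤ 4 * (16 * Real.exp (2 * hdist 0 z₀) / (defect z₀ ^ 2 * δ ^ 2) * defect (g z₀) ^ 2) := by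
        rw [h2]; gcongr
    _ = _ := by rw [e2]; ring

/-! ### Powers of hyperbolic and parabolic isometries -/

/-- Non-trivial isometries without fixed point in the disc, normalized by the choice of the lift
to `SU(1,1)` with positive trace. -/
def IsNonElliptic (g : Equiv.Perm 𝔻) : Prop := ∃ a b, IsMobius g a b ∧ 1 ≤ a.re ∧ b ≠ 0

lemma IsNonElliptic.isIsom {g : Equiv.Perm 𝔻} (hg : IsNonElliptic g) : IsIsom g := by
  obtain ⟨a, b, h, -⟩ := hg
  exact ⟨a, b, h⟩

lemma IsNonElliptic.inv {g : Equiv.Perm 𝔻} (hg : IsNonElliptic g) : IsNonElliptic g⁻¹ := by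
  obtain ⟨a, b, h, h1, h2⟩ := hg
  exact ⟨_, _, h.inv, by simpa using h1, by simpa using h2⟩

lemma IsHyperbolic.isNonElliptic {g : Equiv.Perm 𝔻} (hg : IsHyperbolic g) :
    IsNonElliptic g := by
  obtain ⟨a, b, h, h1⟩ := hg
  have hb : b ≠ 0 := by
    rintro rfl
    have h2 := h.1
    have h3 := Complex.abs_re_le_norm a
    simp only [norm_zero] at h2
    nlinarith
  rcases le_total 0 a.re with h0 | h0
  · rw [abs_of_nonneg h0] at h1
    exact ⟨a, b, h, h1.le, hb⟩
  · rw [abs_of_nonpos h0] at h1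
    exact ⟨-a, -b, h.neg, by simpa using h1.le, by simpa using hb⟩

lemma IsParabolic.exists_isMobius {g : Equiv.Perm 𝔻} (hg : IsParabolic g) :
    ∃ a b, IsMobius g a b ∧ a.re = 1 ∧ b ≠ 0 := by
  obtain ⟨hne, a, b, h, h1⟩ := hg
  have main : ∀ a b : ℂ, IsMobius g a b → a.re = 1 → b ≠ 0 := by
    rintro a b h h1 rfl
    apply hne
    have h2 := h.1
    rw [norm_zero, ← Complex.normSq_eq_norm_sq, Complex.normSq_apply, h1] at h2
    have h3 : a.im = 0 := by
      have : a.im * a.im = 0 := by linarith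
      simpa using this
    have ha : a = 1 := Complex.ext (by simpa using h1) (by simpa using h3)
    refine Equiv.ext fun z => Complex.UnitDisc.coe_inj.1 ?_
    rw [h.2, ha]; simp
  rcases le_total 0 a.re with h0 | h0
  · rw [abs_of_nonneg h0] at h1
    exact ⟨a, b, h, h1, main a b h h1⟩
  · rw [abs_of_nonpos h0] at h1
    exact ⟨-a, -b, h.neg, by simpa using h1, main _ _ h.neg (by simpa using h1)⟩

lemma IsParabolic.isNonElliptic {g : Equiv.Perm 𝔻} (hg : IsParabolic g) : IsNonElliptic g := by
  obtain ⟨a, b, h, h1, h2⟩ := hg.exists_isMobius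
  exact ⟨a, b, h, h1.ge, h2⟩

/-- The sequence `U_{n-1}(τ)` of Chebyshev polynomials of the second kind: a matrix `A` of
determinant `1` and trace `2τ` satisfies `A ^ n = U_{n-1}(τ) A - U_{n-2}(τ)`. -/
def powCoeff (τ : ℝ) : ℕ → ℝ
  | 0 => 0
  | 1 => 1
  | n + 2 => 2 * τ * powCoeff τ (n + 1) - powCoeff τ n

lemma le_powCoeff {τ : ℝ} (hτ : 1 ≤ τ) (n : ℕ) :
    (n : ℝ) ≤ powCoeff τ n ∧ powCoeff τ n + 1 ≤ powCoeff τ (n + 1) := by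
  induction n with
  | zero => simp [powCoeff]
  | succ n ih =>
    obtain ⟨h1, h2⟩ := ih
    have h3 : (0 : ℝ) ≤ n := n.cast_nonneg
    refine ⟨by push_cast; linarith, ?_⟩
    rw [powCoeff]
    nlinarith

lemma powCoeff_one (n : ℕ) : powCoeff 1 n = n := by
  induction n using Nat.strong_induction_on with
  | _ n ih =>
    match n with
    | 0 => simp [powCoeff]
    | 1 => simp [powCoeff]
    | n + 2 =>
      rw [powCoeff, ih n (by omega), ih (n + 1) (by omega)]
      push_cast; ring

lemma IsMobius.pow_succ {g : Equiv.Perm 𝔻} {a b : ℂ} (hg : IsMobius g a b) (n : ℕ) :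
    IsMobius (g ^ (n + 1)) (powCoeff a.re (n + 1) * a - powCoeff a.re n)
      (powCoeff a.re (n + 1) * b) := by
  induction n with
  | zero => simpa [powCoeff] using hg
  | succ n ih =>
    have h := ih.mul hg
    rw [← _root_.pow_succ] at h
    have h2 : conj a = 2 * a.re - a := by
      apply Complex.ext <;> simp; ring
    have hab := mul_conj_eq hg.1
    rw [h2] at hab h
    convert h using 1
    · simp only [powCoeff]; push_cast; linear_combination (powCoeff a.re (n + 1) : ℂ) * hab
    · simp only [powCoeff]; push_cast; ring

lemma IsMobius.mul_one_sub_le {g : Equiv.Perm 𝔻} {a b : ℂ} (hg : IsMobius g a b) (z : 𝔻) :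
    ‖b‖ * (1 - ‖(z : ℂ)‖) ≤ ‖conj b * (z : ℂ) + conj a‖ := by
  have h1 : ‖conj a‖ - ‖conj b * (z : ℂ)‖ ≤ ‖conj b * (z : ℂ) + conj a‖ := by
    have := norm_sub_le (conj b * (z : ℂ) + conj a) (conj b * (z : ℂ))
    rw [add_sub_cancel_left] at this
    linarith
  rw [norm_mul, Complex.norm_conj, Complex.norm_conj] at h1
  have h2 := hg.1
  nlinarith [norm_nonneg a, norm_nonneg b]

/-- The defect decays at least quadratically along the orbits of a cyclic group generated by a
hyperbolic or parabolic element. -/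
lemma IsNonElliptic.exists_defect_pow_le {g : Equiv.Perm 𝔻} (hg : IsNonElliptic g) (z : 𝔻) :
    ∃ C : ℝ, 0 < C ∧ ∀ n : ℕ, defect ((g ^ n) z) ≤ C / (n + 1) ^ 2 := by
  obtain ⟨a, b, h, h1, hb⟩ := hg
  have hz : 0 < 1 - ‖(z : ℂ)‖ := sub_pos.2 z.norm_lt_one
  have hb' := norm_pos_iff.2 hb
  refine ⟨1 + 4 / (‖b‖ * (1 - ‖(z : ℂ)‖)) ^ 2, by positivity, fun n => ?_⟩
  rw [le_div_iff₀ (by positivity)]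
  rcases n with _ | n
  · have : 0 < 4 / (‖b‖ * (1 - ‖(z : ℂ)‖)) ^ 2 := by positivity
    simpa using (defect_le_one z).trans (by linarith)
  have h2 := (h.pow_succ n).mul_one_sub_le z
  rw [(h.pow_succ n).defect_apply]
  have h3 := (le_powCoeff h1 (n + 1)).1
  rw [norm_mul, Complex.norm_real, Real.norm_eq_abs,
    abs_of_nonneg ((Nat.cast_nonneg _).trans h3)] at h2
  set D := ‖conj ((powCoeff a.re (n + 1) : ℂ) * b) * (z : ℂ)
      + conj (powCoeff a.re (n + 1) * a - powCoeff a.re n : ℂ)‖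
  have h4 : ((n + 1 : ℕ) : ℝ) * (‖b‖ * (1 - ‖(z : ℂ)‖)) ≤ D := by
    rw [← mul_assoc]
    exact le_trans (by gcongr) h2
  set e := ‖b‖ * (1 - ‖(z : ℂ)‖) with he
  have hepos : 0 < e := by positivity
  have hn : (0 : ℝ) ≤ n := n.cast_nonneg
  push_cast at h4 ⊢
  have hD : 0 < D := lt_of_lt_of_le (by positivity) h4
  have h5 : (n + 1 : ℝ) ^ 2 * e ^ 2 ≤ D ^ 2 := by
    rw [← mul_pow]; exact pow_le_pow_left₀ (by positivity) h4 2
  have h6 : ((n : ℝ) + 1 + 1) ^ 2 ≤ 4 * (n + 1) ^ 2 := by nlinarith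
  calc defect z / D ^ 2 * ((n : ℝ) + 1 + 1) ^ 2
      ≤ 1 / ((n + 1) ^ 2 * e ^ 2) * (4 * (n + 1) ^ 2) := by
        gcongr
        exact defect_le_one z
    _ = 4 / e ^ 2 := by field_simp
    _ ≤ _ := by linarith

lemma IsNonElliptic.exists_defect_zpow_le {g : Equiv.Perm 𝔻} (hg : IsNonElliptic g) (z : 𝔻) :
    ∃ C : ℝ, 0 < C ∧ ∀ n : ℤ, defect ((g ^ n) z) ≤ C / ((n.natAbs : ℝ) + 1) ^ 2 := by
  obtain ⟨C, hC, h⟩ := hg.exists_defect_pow_le z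
  obtain ⟨C', hC', h'⟩ := hg.inv.exists_defect_pow_le z
  refine ⟨max C C', lt_max_of_lt_left hC, fun n => ?_⟩
  rcases n.natAbs_eq with e | e
  · have := h n.natAbs
    rw [← zpow_natCast, ← e] at this
    exact this.trans (by gcongr; exact le_max_left _ _)
  · have := h' n.natAbs
    rw [← zpow_natCast, inv_zpow', ← e] at this
    exact this.trans (by gcongr; exact le_max_right _ _)

lemma IsParabolic.inv {g : Equiv.Perm 𝔻} (hg : IsParabolic g) : IsParabolic g⁻¹ := by
  obtain ⟨h0, a, b, h, h1⟩ := hg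
  exact ⟨inv_ne_one.2 h0, _, _, h.inv, by simpa using h1⟩

/-- For parabolic elements the decay of the defect is exactly quadratic. -/
lemma IsParabolic.exists_le_defect_pow {g : Equiv.Perm 𝔻} (hg : IsParabolic g) (z : 𝔻) :
    ∃ c : ℝ, 0 < c ∧ ∀ n : ℕ, c / (n + 1) ^ 2 ≤ defect ((g ^ n) z) := by
  obtain ⟨a, b, h, h1, hb⟩ := hg.exists_isMobius
  have q := defect_pos z
  refine ⟨defect z / (‖a‖ + ‖b‖ + 1) ^ 2, by positivity, fun n => ?_⟩
  rcases n with _ | n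
  · simp only [pow_zero, Equiv.Perm.one_apply]
    norm_num
    refine div_le_self q.le ?_
    nlinarith [norm_nonneg a, norm_nonneg b]
  have hm := h.pow_succ n
  rw [hm.defect_apply, div_div]
  have hd := norm_pos_iff.2 (mobius_den_ne hm.1 z)
  gcongr
  rw [← mul_pow]
  refine pow_le_pow_left₀ (norm_nonneg _) ?_ 2
  rw [h1, powCoeff_one, powCoeff_one]
  refine (norm_add_le _ _).trans ?_
  rw [norm_mul, Complex.norm_conj, Complex.norm_conj, norm_mul]
  have e1 : ‖(((n + 1 : ℕ) : ℝ) : ℂ) * a - ((n : ℝ) : ℂ)‖ ≤ (n + 1) * ‖a‖ + n := by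
    refine (norm_sub_le _ _).trans ?_
    rw [norm_mul, Complex.norm_real, Complex.norm_real, Real.norm_natCast, Real.norm_natCast]
    push_cast; rfl
  have e2 : ‖(((n + 1 : ℕ) : ℝ) : ℂ)‖ = n + 1 := by
    rw [Complex.norm_real, Real.norm_natCast]; push_cast; rfl
  have e3 : ((n : ℝ) + 1) * ‖b‖ * ‖(z : ℂ)‖ ≤ (n + 1) * ‖b‖ :=
    mul_le_of_le_one_right (by positivity) z.norm_lt_one.le
  have e4 : ((n : ℝ) + 1) * ‖b‖ * ‖(z : ℂ)‖ + ((n + 1) * ‖a‖ + n)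
      ≤ (‖a‖ + ‖b‖ + 1) * (((n + 1 : ℕ) : ℝ) + 1) := by
    push_cast
    nlinarith [norm_nonneg a, norm_nonneg b, (n.cast_nonneg : (0 : ℝ) ≤ n)]
  rw [e2]
  exact (add_le_add_right e1 _).trans e4

lemma IsParabolic.exists_le_defect_zpow {g : Equiv.Perm 𝔻} (hg : IsParabolic g) (z : 𝔻) :
    ∃ c : ℝ, 0 < c ∧ ∀ n : ℤ, c / ((n.natAbs : ℝ) + 1) ^ 2 ≤ defect ((g ^ n) z) := by
  obtain ⟨C, hC, h⟩ := hg.exists_le_defect_pow z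
  obtain ⟨C', hC', h'⟩ := hg.inv.exists_le_defect_pow z
  refine ⟨min C C', lt_min hC hC', fun n => ?_⟩
  rcases n.natAbs_eq with e | e
  · have := h n.natAbs
    rw [← zpow_natCast g, ← e] at this
    exact le_trans (by gcongr; exact min_le_left _ _) this
  · have := h' n.natAbs
    rw [← zpow_natCast g⁻¹, inv_zpow', ← e] at this
    exact le_trans (by gcongr; exact min_le_right _ _) this

lemma tendsto_div_natAbs_sq (C : ℝ) :
    Tendsto (fun n : ℤ => C / ((n.natAbs : ℝ) + 1) ^ 2) cofinite (𝓝 0) := by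
  have h1 : Tendsto (fun n : ℕ => C / ((n : ℝ) + 1) ^ 2) atTop (𝓝 0) := by
    refine Tendsto.div_atTop tendsto_const_nhds ?_
    exact (tendsto_pow_atTop two_ne_zero).comp
      (tendsto_atTop_add_const_right _ _ tendsto_natCast_atTop_atTop)
  refine h1.comp ?_
  rw [← Nat.cofinite_eq_atTop]
  refine Filter.Tendsto.cofinite_of_finite_preimage_singleton fun m => ?_
  refine (Set.toFinite ({(m : ℤ), -(m : ℤ)} : Set ℤ)).subset fun n hn => ?_
  have : n.natAbs = m := hn
  simp only [Set.mem_insert_iff, Set.mem_singleton_iff]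
  omega

lemma IsMobius.sinh_apply {g : Equiv.Perm 𝔻} {a b : ℂ} (hg : IsMobius g a b) (z w : 𝔻) :
    Real.sinh (hdist z (g w) / 2)
      = ‖(z : ℂ) * (conj b * w + conj a) - (a * w + b)‖ / √(defect z * defect w) := by
  have hd := mobius_den_ne hg.1 w
  have hd' := norm_pos_iff.2 hd
  have hq := Real.sqrt_pos.2 (mul_pos (defect_pos z) (defect_pos w))
  rw [sinh_half_hdist, hg.defect_apply, ← mul_div_assoc, Real.sqrt_div' _ (by positivity),
    Real.sqrt_sq hd'.le, hg.2, div_div_eq_mul_div, ← norm_mul, sub_mul, div_mul_cancel₀ _ hd]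

/-- Along the orbits of the cyclic group generated by `g`, the function `sinh (d(z, ·) / 2)` is
convex. -/
lemma IsNonElliptic.two_mul_sinh_le {g : Equiv.Perm 𝔻} (hg : IsNonElliptic g) (z w : 𝔻) :
    2 * Real.sinh (hdist z w / 2)
      ≤ Real.sinh (hdist z (g w) / 2) + Real.sinh (hdist z (g⁻¹ w) / 2) := by
  obtain ⟨a, b, h, h1, -⟩ := hg
  have hq := Real.sqrt_pos.2 (mul_pos (defect_pos z) (defect_pos w))
  rw [h.sinh_apply, h.inv.sinh_apply, sinh_half_hdist, ← add_div, ← mul_div_assoc]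
  gcongr
  refine le_trans ?_ (norm_add_le _ _)
  have h2 : conj a = 2 * a.re - a := by
    apply Complex.ext <;> simp; ring
  have e : (z : ℂ) * (conj b * w + conj a) - (a * w + b) +
      (z * (conj (-b) * w + conj (conj a)) - (conj a * w + -b))
      = (2 * a.re : ℝ) * ((z : ℂ) - w) := by
    rw [Complex.conj_conj, map_neg, h2]; push_cast; ring
  rw [e, norm_mul, Complex.norm_real, Real.norm_eq_abs, abs_of_nonneg (by linarith)]
  gcongr
  linarith

/-- The two half-planes of `g` in the Schottky condition. -/
def pingSet (z₀ : 𝔻) (g : Equiv.Perm 𝔻) : Set 𝔻 := halfPlane z₀ g ∪ halfPlane z₀ g⁻¹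

/-- The ping-pong property. -/
lemma IsNonElliptic.zpow_mem_pingSet {g : Equiv.Perm 𝔻} (hg : IsNonElliptic g) {z₀ z : 𝔻}
    (hz : z ∉ pingSet z₀ g) {n : ℤ} (hn : n ≠ 0) : (g ^ n) z ∈ pingSet z₀ g := by
  set f : ℤ → ℝ := fun n => Real.sinh (hdist z ((g ^ n) z₀) / 2) with hf
  have hconv : ∀ n, 2 * f n ≤ f (n + 1) + f (n - 1) := fun n => by
    have := hg.two_mul_sinh_le z ((g ^ n) z₀)
    rwa [← Equiv.Perm.mul_apply, ← Equiv.Perm.mul_apply, ← zpow_one_add, ← zpow_neg_one,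
      ← zpow_add, add_comm 1, neg_add_eq_sub] at this
  have hz1 : f 0 < f 1 := by
    by_contra hcon
    refine hz (Or.inl (hdist_le_iff.2 ?_))
    simpa [hf] using not_lt.1 hcon
  have hz2 : f 0 < f (-1) := by
    by_contra hcon
    refine hz (Or.inr (hdist_le_iff.2 ?_))
    simpa [hf] using not_lt.1 hcon
  have hpos : ∀ m : ℕ, f m < f (m + 1) := fun m => by
    induction m with
    | zero => simpa using hz1
    | succ m ih =>
      have := hconv (m + 1)
      rw [add_sub_cancel_right] at this
      push_cast
      linarith
  have hneg : ∀ m : ℕ, f (-m) < f (-m - 1) := fun m => by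
    induction m with
    | zero => simpa using hz2
    | succ m ih =>
      have := hconv (-m - 1)
      rw [sub_add_cancel] at this
      push_cast
      rw [neg_add']
      linarith
  have hgi := hg.isIsom.zpow n
  have key : ∀ k : ℤ, hdist ((g ^ n) z) ((g ^ k) z₀) = hdist z ((g ^ (k - n)) z₀) := fun k => by
    rw [← hgi.hdist_eq z, ← Equiv.Perm.mul_apply (g ^ n) (g ^ (k - n)), ← zpow_add,
      add_sub_cancel]
  have key0 := key 0
  have key1 := key 1
  have key2 := key (-1)
  rw [zpow_zero, Equiv.Perm.one_apply] at key0
  rw [zpow_one] at key1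
  rw [zpow_neg_one] at key2
  rcases lt_or_gt_of_ne hn with h | h
  · right
    change hdist _ _ ≤ hdist _ _
    rw [key2, key0, hdist_le_iff]
    obtain ⟨m, hm⟩ : ∃ m : ℕ, n = -(m + 1) := ⟨(-n - 1).toNat, by omega⟩
    have := hpos m
    have e1 : -1 - n = m := by omega
    have e2 : 0 - n = m + 1 := by omega
    rw [e1, e2]
    exact this.le
  · left
    change hdist _ _ ≤ hdist _ _
    rw [key1, key0, hdist_le_iff]
    obtain ⟨m, hm⟩ : ∃ m : ℕ, n = m + 1 := ⟨(n - 1).toNat, by omega⟩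
    have := hneg m
    have e1 : 1 - n = -m := by omega
    have e2 : 0 - n = -m - 1 := by omega
    rw [e1, e2]
    exact this.le

lemma IsNonElliptic.apply_ne {g : Equiv.Perm 𝔻} (hg : IsNonElliptic g) (z : 𝔻) : g z ≠ z := by
  intro h
  have hn : ∀ n : ℕ, (g ^ n) z = z := fun n => by
    induction n with
    | zero => simp
    | succ n ih => rw [pow_succ, Equiv.Perm.mul_apply, h, ih]
  obtain ⟨C, hC, hd⟩ := hg.exists_defect_pow_le z
  obtain ⟨n, hn'⟩ := exists_nat_gt (C / defect z)
  have h1 := hd n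
  have q := defect_pos z
  rw [hn, le_div_iff₀ (by positivity)] at h1
  rw [div_lt_iff₀ q] at hn'
  have : (n : ℝ) ≤ (n + 1) ^ 2 := by nlinarith [(n.cast_nonneg : (0 : ℝ) ≤ n)]
  nlinarith

lemma half_hdist_le_of_mem_pingSet {g : Equiv.Perm 𝔻} (hg : IsIsom g) {z₀ z : 𝔻}
    (h : z ∈ pingSet z₀ g) : hdist z₀ (g z₀) / 2 ≤ hdist z₀ z := by
  rcases h with h | h
  · have h1 : hdist z (g z₀) ≤ hdist z z₀ := h
    have := hdist_triangle z₀ z (g z₀)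
    rw [hdist_comm z z₀] at h1
    linarith
  · have h1 : hdist z (g⁻¹ z₀) ≤ hdist z z₀ := h
    have := hdist_triangle z₀ z (g⁻¹ z₀)
    rw [hdist_comm z z₀] at h1
    rw [← hg.hdist_inv_apply, hdist_comm (g⁻¹ z₀)]
    linarith

lemma IsIsom.norm_sub_le {f : Equiv.Perm 𝔻} (hf : IsIsom f) (z₀ z w : 𝔻) :
    ‖((f z : 𝔻) : ℂ) - (f w : 𝔻)‖ ≤ Real.sinh (hdist z w / 2) *
      (16 * Real.exp (hdist 0 z₀) / defect (f⁻¹ z₀) * (defect z + defect w)) := by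
  have h1 := hf.inv.mul_defect_le z₀ (f z)
  have h2 := hf.inv.mul_defect_le z₀ (f w)
  rw [show f⁻¹ (f z) = z from f.symm_apply_apply z] at h1
  rw [show f⁻¹ (f w) = w from f.symm_apply_apply w] at h2
  have q := defect_pos (f⁻¹ z₀)
  have qz := defect_pos (f z)
  have qw := defect_pos (f w)
  rw [norm_sub_eq_sinh, hf.hdist_eq]
  have hs : 0 ≤ Real.sinh (hdist z w / 2) :=
    Real.sinh_nonneg_iff.2 (by linarith [hdist_nonneg z w])
  refine mul_le_mul_of_nonneg_left ?_ hs
  have h3 : √(defect (f z)) * √(defect (f w)) ≤ defect (f z) + defect (f w) := by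
    nlinarith [Real.sq_sqrt qz.le, Real.sq_sqrt qw.le, Real.sqrt_nonneg (defect (f z)),
      Real.sqrt_nonneg (defect (f w)), sq_nonneg (√(defect (f z)) - √(defect (f w)))]
  refine h3.trans ?_
  rw [div_mul_eq_mul_div, le_div_iff₀ q]
  linarith

/-- Orbits of cyclic groups of hyperbolic or parabolic isometries converge in the closed disc, and
so do their images. -/
lemma IsNonElliptic.exists_tendsto {g : Equiv.Perm 𝔻} (hg : IsNonElliptic g)
    {f : Equiv.Perm 𝔻} (hf : IsIsom f) (z : 𝔻) :
    ∃ x : ℂ, Tendsto (fun n : ℕ => ((f ((g ^ n) z) : 𝔻) : ℂ)) atTop (𝓝 x) := by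
  obtain ⟨C, hC, hd⟩ := hg.exists_defect_pow_le z
  apply cauchySeq_tendsto_of_complete
  have hgi : ∀ n : ℕ, IsIsom (g ^ n) := fun n => isomGroup.pow_mem hg.isIsom n
  set K := Real.sinh (hdist z (g z) / 2) * (16 * Real.exp (hdist 0 z) / defect (f⁻¹ z)) with hK
  have hs : 0 ≤ Real.sinh (hdist z (g z) / 2) :=
    Real.sinh_nonneg_iff.2 (by linarith [hdist_nonneg z (g z)])
  have q := defect_pos (f⁻¹ z)
  have hK0 : 0 ≤ K := by positivity
  refine cauchySeq_of_dist_le_of_summable (fun n : ℕ => K * (2 * C) * (1 / ((n : ℝ) + 1) ^ 2))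
    (fun n => ?_) ?_
  · rw [dist_eq_norm]
    refine (hf.norm_sub_le z _ _).trans ?_
    rw [pow_succ, Equiv.Perm.mul_apply, (hgi n).hdist_eq, ← mul_assoc, ← hK, mul_assoc K]
    refine mul_le_mul_of_nonneg_left ?_ hK0
    have h1 := hd n
    have h2 := hd (n + 1)
    rw [pow_succ, Equiv.Perm.mul_apply] at h2
    have h3 : C / (((n + 1 : ℕ) : ℝ) + 1) ^ 2 ≤ C / ((n : ℝ) + 1) ^ 2 := by
      push_cast; gcongr; linarith
    have e : 2 * C * (1 / ((n : ℝ) + 1) ^ 2) = C / ((n : ℝ) + 1) ^ 2 + C / ((n : ℝ) + 1) ^ 2 := by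
      ring
    linarith
  · refine Summable.mul_left _ ?_
    have := (summable_nat_add_iff 1).2 (Real.summable_one_div_nat_pow.2 one_lt_two)
    simpa using this

/-- The fixed point on the circle of a parabolic element, with its horofunction
`z ↦ |z - ζ| / √(1 - |z|²)`. -/
lemma IsParabolic.exists_fixedPoint {g : Equiv.Perm 𝔻} (hg : IsParabolic g) :
    ∃ ζ : ℂ, ‖ζ‖ = 1 ∧ ∀ (n : ℤ) (z : 𝔻), ‖(((g ^ n) z : 𝔻) : ℂ) - ζ‖ / √(defect ((g ^ n) z))
      = ‖(z : ℂ) - ζ‖ / √(defect z) := by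
  obtain ⟨a, b, h, h1, hb⟩ := hg.exists_isMobius
  have hb' : conj b ≠ 0 := by simpa using hb
  have hconj : conj a = 2 - a := by
    apply Complex.ext <;> simp [h1]; norm_num
  have hab := mul_conj_eq h.1
  have h0 : ∀ z : 𝔻, ‖((g z : 𝔻) : ℂ) - (a - 1) / conj b‖ / √(defect (g z))
      = ‖(z : ℂ) - (a - 1) / conj b‖ / √(defect z) := fun z => by
    have hd := mobius_den_ne h.1 z
    have hd' := norm_pos_iff.2 hd
    have hq := Real.sqrt_pos.2 (defect_pos z)
    have e : ((g z : 𝔻) : ℂ) - (a - 1) / conj b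
        = ((z : ℂ) - (a - 1) / conj b) / (conj b * z + conj a) := by
      rw [h.2, eq_div_iff hd, sub_mul, div_mul_cancel₀ _ hd]
      apply mul_right_cancel₀ hb'
      have : (a - 1) / conj b * conj b = a - 1 := div_mul_cancel₀ _ hb'
      rw [hconj] at hab ⊢
      linear_combination (-(conj b * z + (2 - a)) + 1) * this - hab
    rw [e, h.defect_apply, norm_div, Real.sqrt_div' _ (by positivity), Real.sqrt_sq hd'.le,
      div_div_div_cancel_right₀ hd'.ne']
  refine ⟨(a - 1) / conj b, ?_, fun n => ?_⟩
  · rw [norm_div, Complex.norm_conj, div_eq_one_iff_eq (norm_ne_zero_iff.2 hb)]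
    have h2 := h.1
    refine (sq_eq_sq₀ (norm_nonneg _) (norm_nonneg _)).1 ?_
    simp only [← Complex.normSq_eq_norm_sq, Complex.normSq_apply, Complex.sub_re,
      Complex.sub_im, Complex.one_re, Complex.one_im, h1] at h2 ⊢
    linarith
  · induction n with
    | zero => simp
    | succ n ih =>
      intro z
      rw [zpow_add_one, Equiv.Perm.mul_apply, ih, h0]
    | pred n ih =>
      intro z
      rw [zpow_sub_one, Equiv.Perm.mul_apply, ih, ← h0 (g⁻¹ z)]
      simp

/-! ### Alternating words in a Schottky pair -/

/-- A pair of hyperbolic or parabolic isometries whose ping-pong sets have disjoint closures in the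
closed disc. Disjointness is recorded as a positive Euclidean distance, and the base point is
adjoined to one of the two sets so that empty words need no special treatment. -/
structure IsSchottky (gen : Bool → Equiv.Perm 𝔻) (z₀ : 𝔻) : Prop where
  nonElliptic : ∀ b, IsNonElliptic (gen b)
  separated : ∃ δ : ℝ, 0 < δ ∧ ∀ b, ∀ x ∈ insert z₀ (pingSet z₀ (gen !b)),
    ∀ y ∈ pingSet z₀ (gen b), δ ≤ ‖(x : ℂ) - y‖

/-- The word `gen b ^ n₁ * gen (!b) ^ n₂ * gen b ^ n₃ * ⋯` with the list of exponents
`[n₁, n₂, …]`. It is reduced when no exponent vanishes. -/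
def word (gen : Bool → Equiv.Perm 𝔻) : Bool → List ℤ → Equiv.Perm 𝔻
  | _, [] => 1
  | b, n :: l => gen b ^ n * word gen (!b) l

/-- The generator whose power has to follow a word in an alternating word. -/
def nextLetter : Bool → List ℤ → Bool
  | b, [] => b
  | b, _ :: l => nextLetter (!b) l

lemma word_append (gen : Bool → Equiv.Perm 𝔻) (b : Bool) (l l' : List ℤ) :
    word gen b (l ++ l') = word gen b l * word gen (nextLetter b l) l' := by
  induction l generalizing b with
  | nil => simp [word, nextLetter]
  | cons n l ih => simp [word, nextLetter, ih, mul_assoc]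

lemma nextLetter_append (b : Bool) (l l' : List ℤ) :
    nextLetter b (l ++ l') = nextLetter (nextLetter b l) l' := by
  induction l generalizing b with
  | nil => simp [nextLetter]
  | cons n l ih => simp [nextLetter, ih]

lemma word_mem_closure (gen : Bool → Equiv.Perm 𝔻) (b : Bool) (l : List ℤ) :
    word gen b l ∈ Subgroup.closure {gen true, gen false} := by
  induction l generalizing b with
  | nil => exact one_mem _
  | cons n l ih =>
    refine mul_mem (zpow_mem (Subgroup.subset_closure ?_) n) (ih _)
    cases b <;> simp

lemma exists_zpow_mul_word (gen : Bool → Equiv.Perm 𝔻) (b' : Bool) (n : ℤ) (b : Bool)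
    (l : List ℤ) (hl : (0 : ℤ) ∉ l) :
    ∃ c l', (0 : ℤ) ∉ l' ∧ gen b' ^ n * word gen b l = word gen c l' := by
  rcases eq_or_ne n 0 with rfl | hn
  · exact ⟨b, l, hl, by simp⟩
  rcases l with _ | ⟨m, l⟩
  · exact ⟨b', [n], by simpa using hn.symm, by simp [word]⟩
  rcases eq_or_ne b b' with rfl | hb
  · rcases eq_or_ne (n + m) 0 with h | h
    · refine ⟨!b, l, fun h' => hl (List.mem_cons_of_mem _ h'), ?_⟩
      rw [word, ← mul_assoc, ← zpow_add, h, zpow_zero, one_mul]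
    · refine ⟨b, (n + m) :: l, ?_, ?_⟩
      · simp only [List.mem_cons, not_or] at hl ⊢
        exact ⟨h.symm, hl.2⟩
      · rw [word, word, ← mul_assoc, ← zpow_add]
  · refine ⟨b', n :: m :: l, ?_, ?_⟩
    · simp only [List.mem_cons, not_or] at hl ⊢
      exact ⟨hn.symm, hl⟩
    · have : b = !b' := by cases b <;> cases b' <;> simp_all
      rw [this]; rfl

lemma exists_word_of_mem_closure (gen : Bool → Equiv.Perm 𝔻) {g : Equiv.Perm 𝔻}
    (hg : g ∈ Subgroup.closure {gen true, gen false}) :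
    ∃ b l, (0 : ℤ) ∉ l ∧ g = word gen b l := by
  have hs : ∀ x ∈ ({gen true, gen false} : Set (Equiv.Perm 𝔻)), ∃ b, x = gen b := by
    rintro x (rfl | rfl)
    · exact ⟨_, rfl⟩
    · exact ⟨_, rfl⟩
  induction hg using Subgroup.closure_induction_left with
  | one => exact ⟨true, [], by simp, rfl⟩
  | mul_left x hx y hy ih =>
    obtain ⟨b, rfl⟩ := hs x hx
    obtain ⟨c, l, hl, rfl⟩ := ih
    simpa using exists_zpow_mul_word gen b 1 c l hl
  | inv_mul_cancel x hx y hy ih =>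
    obtain ⟨b, rfl⟩ := hs x hx
    obtain ⟨c, l, hl, rfl⟩ := ih
    simpa using exists_zpow_mul_word gen b (-1) c l hl

section Schottky

variable {gen : Bool → Equiv.Perm 𝔻} {z₀ : 𝔻}

lemma IsSchottky.isIsom_of_mem (hS : IsSchottky gen z₀) {g : Equiv.Perm 𝔻}
    (hg : g ∈ Subgroup.closure {gen true, gen false}) : IsIsom g := by
  have : Subgroup.closure {gen true, gen false} ≤ isomGroup := by
    rw [Subgroup.closure_le]
    rintro x (rfl | rfl)
    · exact (hS.nonElliptic _).isIsom
    · exact (hS.nonElliptic _).isIsom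
  exact this hg

lemma IsSchottky.isIsom_word (hS : IsSchottky gen z₀) (b : Bool) (l : List ℤ) :
    IsIsom (word gen b l) := hS.isIsom_of_mem (word_mem_closure gen b l)

lemma IsSchottky.notMem_pingSet (hS : IsSchottky gen z₀) {b : Bool} {x : 𝔻}
    (hx : x ∈ insert z₀ (pingSet z₀ (gen !b))) : x ∉ pingSet z₀ (gen b) := fun h => by
  obtain ⟨δ, hδ, h'⟩ := hS.separated
  have := h' b x hx x h
  rw [sub_self, norm_zero] at this
  linarith

lemma IsSchottky.word_apply_mem (hS : IsSchottky gen z₀) (b : Bool) (l : List ℤ)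
    (hl : (0 : ℤ) ∉ l) : word gen b l z₀ ∈ insert z₀ (pingSet z₀ (gen b)) := by
  induction l generalizing b with
  | nil => simp [word]
  | cons n l ih =>
    simp only [List.mem_cons, not_or] at hl
    exact Or.inr ((hS.nonElliptic b).zpow_mem_pingSet (hS.notMem_pingSet (ih _ hl.2))
      (Ne.symm hl.1))

lemma IsSchottky.word_apply_mem_pingSet (hS : IsSchottky gen z₀) (b : Bool) {l : List ℤ}
    (hl : (0 : ℤ) ∉ l) (hne : l ≠ []) : word gen b l z₀ ∈ pingSet z₀ (gen b) := by
  rcases l with _ | ⟨n, l⟩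
  · exact absurd rfl hne
  · simp only [List.mem_cons, not_or] at hl
    exact (hS.nonElliptic b).zpow_mem_pingSet
      (hS.notMem_pingSet (hS.word_apply_mem _ _ hl.2)) (Ne.symm hl.1)

lemma IsSchottky.word_inv_apply_mem (hS : IsSchottky gen z₀) (b : Bool) (l : List ℤ)
    (hl : (0 : ℤ) ∉ l) {y : 𝔻} (hy : y ∈ insert z₀ (pingSet z₀ (gen !b))) :
    (word gen b l)⁻¹ y ∈ insert z₀ (pingSet z₀ (gen !(nextLetter b l))) := by
  induction l generalizing b y with
  | nil => simpa [word, nextLetter] using hy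
  | cons n l ih =>
    simp only [List.mem_cons, not_or] at hl
    rw [word, mul_inv_rev, Equiv.Perm.mul_apply, ← zpow_neg]
    refine ih _ hl.2 (Or.inr ?_)
    rw [Bool.not_not]
    exact (hS.nonElliptic b).zpow_mem_pingSet (hS.notMem_pingSet hy)
      (neg_ne_zero.2 (Ne.symm hl.1))

/-- In a reduced word `w w'`, the points `w⁻¹ z₀` and `w' z₀` are uniformly apart; hence the defect
is submultiplicative along reduced words, up to a factor, and the orbit points with prefix `w` lie
in a Euclidean ball about `w z₀` of radius comparable to its defect. -/
lemma IsSchottky.exists_prefix_bound (hS : IsSchottky gen z₀) :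
    ∃ K : ℝ, 1 ≤ K ∧ ∀ b l l', (0 : ℤ) ∉ l → (0 : ℤ) ∉ l' →
      defect (word gen b (l ++ l') z₀)
        ≤ K * (defect (word gen b l z₀) * defect (word gen (nextLetter b l) l' z₀)) ∧
      ‖((word gen b l z₀ : 𝔻) : ℂ) - (word gen b (l ++ l') z₀ : 𝔻)‖
        ≤ K * defect (word gen b l z₀) := by
  obtain ⟨δ, hδ, hsep⟩ := hS.separated
  have q0 := defect_pos z₀
  have q1 := defect_le_one z₀
  set K1 := 16 * Real.exp (2 * hdist 0 z₀) / (defect z₀ * δ ^ 2)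
  set K2 := 8 * Real.exp (hdist 0 z₀) / (defect z₀ * δ)
  have hK1 : 0 < K1 := by positivity
  have hK2 : 0 < K2 := by positivity
  have hi : 1 ≤ 1 / defect z₀ := by rw [le_div_iff₀ q0]; linarith
  refine ⟨1 / defect z₀ + K1 + K2, by linarith, fun b l l' hl hl' => ?_⟩
  have hg := hS.isIsom_word b l
  have qg := defect_pos (word gen b l z₀)
  rw [word_append, Equiv.Perm.mul_apply]
  rcases eq_or_ne l' [] with rfl | hne
  · simp only [word, Equiv.Perm.one_apply, sub_self, norm_zero]
    refine ⟨?_, by positivity⟩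
    calc defect (word gen b l z₀)
        = 1 / defect z₀ * (defect (word gen b l z₀) * defect z₀) := by field_simp
      _ ≤ _ := by gcongr; linarith
  · have h := hsep (nextLetter b l) _ (hS.word_inv_apply_mem b l hl (Set.mem_insert _ _)) _
      (hS.word_apply_mem_pingSet (nextLetter b l) hl' hne)
    have qy := defect_pos (word gen (nextLetter b l) l' z₀)
    refine ⟨(hg.defect_apply_le hδ h).trans ?_, (hg.norm_sub_apply_le hδ h).trans ?_⟩
    · exact mul_le_mul_of_nonneg_right (by linarith) (by positivity)
    · exact mul_le_mul_of_nonneg_right (by linarith) (by positivity)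

/-- The defect of the endpoint of a reduced word is bounded by a product over its letters. -/
lemma IsSchottky.exists_defect_word_le (hS : IsSchottky gen z₀) :
    ∃ C : ℝ, 0 < C ∧ ∀ b l, (0 : ℤ) ∉ l →
      defect (word gen b l z₀) ≤ (l.map fun n : ℤ => C / ((n.natAbs : ℝ) + 1) ^ 2).prod := by
  obtain ⟨K, hK, hb⟩ := hS.exists_prefix_bound
  obtain ⟨C1, hC1, h1⟩ := (hS.nonElliptic true).exists_defect_zpow_le z₀
  obtain ⟨C2, hC2, h2⟩ := (hS.nonElliptic false).exists_defect_zpow_le z₀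
  refine ⟨K * max C1 C2, by positivity, fun b l hl => ?_⟩
  induction l generalizing b with
  | nil => simpa using defect_le_one _
  | cons n l ih =>
    simp only [List.mem_cons, not_or] at hl
    have h := (hb b [n] l (by simpa using hl.1) hl.2).1
    rw [List.singleton_append] at h
    refine h.trans ?_
    rw [List.map_cons, List.prod_cons, mul_div_assoc, mul_assoc]
    refine mul_le_mul_of_nonneg_left ?_ (by linarith)
    refine mul_le_mul ?_ (ih _ hl.2) (defect_pos _).le (by positivity)
    simp only [word, mul_one]
    cases b
    · exact (h2 n).trans (by gcongr; exact le_max_right _ _)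
    · exact (h1 n).trans (by gcongr; exact le_max_left _ _)

/-- Non-trivial reduced words move the base point by a definite amount. -/
lemma IsSchottky.exists_le_hdist_word (hS : IsSchottky gen z₀) :
    ∃ r : ℝ, 0 < r ∧ ∀ b l, (0 : ℤ) ∉ l → l ≠ [] → r ≤ hdist z₀ (word gen b l z₀) := by
  have h1 := hdist_pos_of_ne ((hS.nonElliptic true).apply_ne z₀).symm
  have h2 := hdist_pos_of_ne ((hS.nonElliptic false).apply_ne z₀).symm
  refine ⟨min (hdist z₀ (gen true z₀) / 2) (hdist z₀ (gen false z₀) / 2),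
    lt_min (by linarith) (by linarith), fun b l hl hne => ?_⟩
  have h := half_hdist_le_of_mem_pingSet (hS.nonElliptic b).isIsom
    (hS.word_apply_mem_pingSet b hl hne)
  cases b
  · exact (min_le_right _ _).trans h
  · exact (min_le_left _ _).trans h

end Schottky

/-- The closures in the Schottky condition are compact, so that their disjointness yields a
positive distance. -/
lemma IsSchottkyPair.isSchottky {h p : Equiv.Perm 𝔻} (hh : IsHyperbolic h) (hp : IsParabolic p)
    {z₀ : 𝔻} (hS : IsSchottkyPair z₀ h p) : IsSchottky (fun b => cond b h p) z₀ := by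
  have hne : ∀ b, IsNonElliptic (cond b h p) := fun b => by
    cases b
    · exact hp.isNonElliptic
    · exact hh.isNonElliptic
  refine ⟨hne, ?_⟩
  have hcomp : ∀ S : Set 𝔻, IsCompact (closureInClosedDisc S) := fun S => by
    refine (isCompact_closedBall (0 : ℂ) 1).of_isClosed_subset isClosed_closure ?_
    refine closure_minimal ?_ Metric.isClosed_closedBall
    rintro _ ⟨z, -, rfl⟩
    simpa using z.norm_lt_one.le
  obtain ⟨r, hr, hsep⟩ := Metric.exists_pos_forall_lt_edist
    (hcomp (halfPlane z₀ h ∪ halfPlane z₀ h⁻¹)) (hcomp (halfPlane z₀ p ∪ halfPlane z₀ p⁻¹)).isClosed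
    hS
  have hmem : ∀ (S : Set 𝔻) (x : 𝔻), x ∈ S → (x : ℂ) ∈ closureInClosedDisc S := fun S x hx =>
    subset_closure ⟨x, hx, rfl⟩
  have hsep' : ∀ x ∈ pingSet z₀ h, ∀ y ∈ pingSet z₀ p, (r : ℝ) ≤ ‖(x : ℂ) - y‖ :=
    fun x hx y hy => by
      have := hsep x (hmem _ x hx) y (hmem _ y hy)
      rw [edist_nndist, ENNReal.coe_lt_coe] at this
      rw [← dist_eq_norm]
      exact this.le
  -- the base point lies at a positive distance from the half-planes
  have hbase : ∀ b, ∃ ρ : ℝ, 0 < ρ ∧ ∀ y ∈ pingSet z₀ (cond b h p), ρ ≤ ‖(z₀ : ℂ) - y‖ :=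
    fun b => by
      set t := hdist z₀ ((cond b h p) z₀) / 2 with ht
      have htpos : 0 < t := by
        have := hdist_pos_of_ne ((hne b).apply_ne z₀).symm
        positivity
      have hcl : IsClosed {x : 𝔻 | t ≤ hdist z₀ x} := by
        exact isClosed_le continuous_const (continuous_hdist z₀)
      have hopen : {x : 𝔻 | t ≤ hdist z₀ x}ᶜ ∈ 𝓝 z₀ := by
        refine hcl.isOpen_compl.mem_nhds ?_
        simpa [hdist_self] using htpos
      rw [Complex.UnitDisc.isEmbedding_coe.nhds_eq_comap, Filter.mem_comap] at hopen
      obtain ⟨V, hV, hsub⟩ := hopen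
      obtain ⟨ρ, hρ, hball⟩ := Metric.mem_nhds_iff.1 hV
      refine ⟨ρ, hρ, fun y hy => ?_⟩
      by_contra hcon
      have hyV : y ∈ ((↑) : 𝔻 → ℂ) ⁻¹' V := hball (by
        rw [Metric.mem_ball, dist_comm, dist_eq_norm]; exact not_le.1 hcon)
      exact hsub hyV (half_hdist_le_of_mem_pingSet (hne b).isIsom hy)
  obtain ⟨ρ1, hρ1, h1⟩ := hbase true
  obtain ⟨ρ2, hρ2, h2⟩ := hbase false
  refine ⟨min r (min ρ1 ρ2), lt_min hr (lt_min hρ1 hρ2), fun b x hx y hy => ?_⟩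
  rcases hx with rfl | hx
  · cases b
    · exact ((min_le_right _ _).trans (min_le_right _ _)).trans (h2 y hy)
    · exact ((min_le_right _ _).trans (min_le_left _ _)).trans (h1 y hy)
  · refine (min_le_left _ _).trans ?_
    cases b
    · exact hsep' x hx y hy
    · rw [norm_sub_rev]
      exact hsep' y hy x hx

/-! ### Geodesic rays and shadows -/

lemma coe_ray (ξ : Circle) (t : ℝ) :
    ((ray ξ t : 𝔻) : ℂ) = (Real.tanh (t / 2) : ℝ) * (ξ : ℂ) := by
  rw [ray, Complex.UnitDisc.coe_mk]

lemma defect_ray (ξ : Circle) (t : ℝ) : defect (ray ξ t) = (Real.cosh (t / 2) ^ 2)⁻¹ := by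
  have hc := Real.cosh_pos (t / 2)
  rw [defect, coe_ray, norm_mul, Circle.norm_coe, mul_one, Complex.norm_real,
    Real.norm_eq_abs, sq_abs, Real.tanh_eq_sinh_div_cosh, div_pow, Real.sinh_sq]
  field_simp
  ring

lemma hdist_ray (ξ : Circle) (s t : ℝ) : hdist (ray ξ s) (ray ξ t) = |s - t| := by
  have hs := Real.cosh_pos (s / 2)
  have ht := Real.cosh_pos (t / 2)
  have e : Real.sinh (hdist (ray ξ s) (ray ξ t) / 2) = Real.sinh (|s - t| / 2) := by
    rw [sinh_half_hdist, defect_ray, defect_ray, coe_ray, coe_ray,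
      ← sub_mul, ← Complex.ofReal_sub, norm_mul, Circle.norm_coe, mul_one, Complex.norm_real,
      Real.norm_eq_abs, ← mul_inv, ← mul_pow, Real.sqrt_inv, Real.sqrt_sq (by positivity),
      div_inv_eq_mul, Real.tanh_eq_sinh_div_cosh, Real.tanh_eq_sinh_div_cosh]
    have e2 : |s - t| / 2 = |s / 2 - t / 2| := by
      rw [← sub_div, abs_div, abs_of_pos (two_pos : (0 : ℝ) < 2)]
    rw [e2, ← Real.abs_sinh, Real.sinh_sub]
    rw [← abs_of_pos (mul_pos hs ht), ← abs_mul]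
    congr 1
    field_simp
  have := Real.sinh_injective e
  linarith

lemma isGeodesicRay_ray (ξ : Circle) : IsGeodesicRay (ray ξ) := fun s t _ _ => hdist_ray ξ s t

lemma endsAt_ray (ξ : Circle) : EndsAt (ray ξ) ξ := by
  have h1 : Tendsto (fun t : ℝ => ((Real.tanh (t / 2) : ℝ) : ℂ) * (ξ : ℂ)) atTop
      (𝓝 (((1 : ℝ) : ℂ) * (ξ : ℂ))) :=
    ((Complex.continuous_ofReal.tendsto 1).comp tendsto_tanh_half).mul_const _
  simpa [EndsAt, coe_ray] using h1

lemma continuous_ray (ξ : Circle) : Continuous (ray ξ) := by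
  rw [Complex.UnitDisc.isEmbedding_coe.continuous_iff]
  have : ((↑) : 𝔻 → ℂ) ∘ ray ξ
      = fun t : ℝ => ((Real.sinh (t / 2) / Real.cosh (t / 2) : ℝ) : ℂ) * (ξ : ℂ) := by
    ext t
    rw [Function.comp_apply, coe_ray, Real.tanh_eq_sinh_div_cosh]
  rw [this]
  have : Continuous fun t : ℝ => Real.sinh (t / 2) / Real.cosh (t / 2) :=
    Continuous.div (Real.continuous_sinh.comp (by fun_prop))
      (Real.continuous_cosh.comp (by fun_prop)) fun t => (Real.cosh_pos _).ne'
  exact (Complex.continuous_ofReal.comp this).mul continuous_const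

lemma tanh_half_hdist_zero (z : 𝔻) : Real.tanh (hdist 0 z / 2) = ‖(z : ℂ)‖ := by
  have hc := Real.cosh_pos (hdist 0 z / 2)
  have h1 := sq_sinh_half_hdist 0 z
  have h2 := sq_cosh_half_hdist_zero z
  have q := defect_pos z
  have h0 : defect 0 = 1 := by simp [defect]
  rw [h0, one_mul, Complex.UnitDisc.coe_zero, zero_sub, norm_neg] at h1
  have hs : 0 ≤ Real.sinh (hdist 0 z / 2) :=
    Real.sinh_nonneg_iff.2 (by linarith [hdist_nonneg 0 z])
  rw [Real.tanh_eq_sinh_div_cosh]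
  refine (sq_eq_sq₀ (by positivity) (norm_nonneg _)).1 ?_
  rw [div_pow, h2, ← h1]
  field_simp

/-- If `ξ` is within a multiple of the defect of `z`, then the ray from `0` to `ξ` passes at
bounded distance from `z`, at time `d(0, z)`. -/
lemma hdist_ray_le_of_shadow {z : 𝔻} {ξ : Circle} {K : ℝ} (h : ‖(z : ℂ) - ξ‖ ≤ K * defect z) :
    hdist z (ray ξ (hdist 0 z)) ≤ 2 * Real.arsinh (K + 1) := by
  have q := defect_pos z
  have e : defect (ray ξ (hdist 0 z)) = defect z := by
    rw [defect_ray, sq_cosh_half_hdist_zero, one_div, inv_inv]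
  have h1 : Real.sinh (hdist z (ray ξ (hdist 0 z)) / 2) ≤ K + 1 := by
    rw [sinh_half_hdist, e, Real.sqrt_mul_self q.le, div_le_iff₀ q, coe_ray,
      tanh_half_hdist_zero]
    have h2 : (z : ℂ) - (‖(z : ℂ)‖ : ℝ) * (ξ : ℂ)
        = ((z : ℂ) - ξ) + ((1 - ‖(z : ℂ)‖ : ℝ) : ℂ) * ξ := by push_cast; ring
    rw [h2]
    refine (norm_add_le _ _).trans ?_
    rw [norm_mul, Circle.norm_coe, mul_one, Complex.norm_real, Real.norm_eq_abs,
      abs_of_pos (sub_pos.2 z.norm_lt_one)]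
    have h3 : 1 - ‖(z : ℂ)‖ ≤ defect z := by
      unfold defect; nlinarith [norm_nonneg (z : ℂ), z.norm_lt_one]
    linarith
  have h2 : hdist z (ray ξ (hdist 0 z)) / 2 ≤ Real.arsinh (K + 1) := by
    rwa [← Real.sinh_le_sinh, Real.sinh_arsinh]
  linarith

lemma sinh_sub_le {a b : ℝ} (hb : 0 ≤ b) : Real.sinh (a - b) ≤ Real.exp (-b) * Real.sinh a := by
  rw [Real.sinh_eq, Real.sinh_eq, mul_div_assoc', mul_sub, ← Real.exp_add, ← Real.exp_add]
  have : Real.exp (-b + -a) ≤ Real.exp (-(a - b)) := Real.exp_le_exp.2 (by linarith)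
  have e : Real.exp (a - b) = Real.exp (-b + a) := by ring_nf
  rw [e]; linarith

/-- All geodesic rays ending at the same point are at bounded distance from each other. -/
lemma IsGeodesicRay.exists_hdist_ray_le {σ : ℝ → 𝔻} (hσ : IsGeodesicRay σ) {ξ : Circle}
    (hξ : EndsAt σ ξ) : ∃ C : ℝ, ∀ t, 0 ≤ t → hdist (σ t) (ray ξ t) ≤ C := by
  set w := σ 0 with hw
  have qw := defect_pos w
  set K := √(4 / defect w * Real.exp (hdist 0 w)) with hK
  refine ⟨2 * Real.arsinh (K + 1) + hdist 0 w, fun t ht => ?_⟩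
  have qt := defect_pos (σ t)
  have hwt : hdist w (σ t) = t := by rw [hw, hσ 0 t le_rfl ht, zero_sub, abs_neg, abs_of_nonneg ht]
  have hlim : Tendsto (fun s => ‖((σ t : 𝔻) : ℂ) - (σ s : 𝔻)‖ ^ 2) atTop
      (𝓝 (‖((σ t : 𝔻) : ℂ) - ξ‖ ^ 2)) := ((tendsto_const_nhds.sub hξ).norm).pow 2
  have hbound : ‖((σ t : 𝔻) : ℂ) - ξ‖ ^ 2 ≤ 4 / defect w * (Real.exp (-t) * defect (σ t)) := by
    refine le_of_tendsto hlim ?_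
    filter_upwards [eventually_gt_atTop t] with s hs
    have hs0 : 0 < s := ht.trans_lt hs
    have h1 := sq_sinh_half_hdist (σ t) (σ s)
    have h2 := sq_sinh_half_hdist w (σ s)
    rw [hσ t s ht hs0.le, abs_sub_comm, abs_of_pos (sub_pos.2 hs)] at h1
    rw [hw, hσ 0 s le_rfl hs0.le, zero_sub, abs_neg, abs_of_pos hs0, ← hw] at h2
    have h3 : Real.sinh ((s - t) / 2) ^ 2 ≤ Real.exp (-t) * Real.sinh (s / 2) ^ 2 := by
      have h4 : Real.sinh ((s - t) / 2) ≤ Real.exp (-(t / 2)) * Real.sinh (s / 2) := by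
        rw [sub_div]; exact sinh_sub_le (by linarith)
      have h5 : 0 ≤ Real.sinh ((s - t) / 2) := Real.sinh_nonneg_iff.2 (by linarith)
      refine (pow_le_pow_left₀ h5 h4 2).trans_eq ?_
      rw [mul_pow, ← Real.exp_nat_mul]; congr 2; push_cast; ring
    have h4 : ‖(w : ℂ) - (σ s : 𝔻)‖ ^ 2 ≤ 4 := by
      have : ‖(w : ℂ) - (σ s : 𝔻)‖ ≤ 2 := by
        refine (norm_sub_le _ _).trans ?_
        linarith [w.norm_lt_one, (σ s).norm_lt_one]
      nlinarith [norm_nonneg ((w : ℂ) - (σ s : 𝔻))]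
    have qs := defect_pos (σ s)
    rw [← h1, div_mul_eq_mul_div, le_div_iff₀ qw]
    calc Real.sinh ((s - t) / 2) ^ 2 * (defect (σ t) * defect (σ s)) * defect w
        ≤ (Real.exp (-t) * Real.sinh (s / 2) ^ 2) * (defect (σ t) * defect (σ s)) * defect w := by
          gcongr
      _ = (Real.sinh (s / 2) ^ 2 * (defect w * defect (σ s))) * (Real.exp (-t) * defect (σ t)) := by
          ring
      _ ≤ 4 * (Real.exp (-t) * defect (σ t)) := by rw [h2]; gcongr
  have h0 : |hdist 0 (σ t) - t| ≤ hdist 0 w := by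
    have h1 := hdist_triangle 0 w (σ t)
    have h2 := hdist_triangle w 0 (σ t)
    rw [hdist_comm w 0] at h2
    rw [abs_le]; constructor <;> linarith
  have hexp : Real.exp (-t) ≤ Real.exp (hdist 0 w) * defect (σ t) := by
    refine le_trans ?_ (mul_le_mul_of_nonneg_left (exp_neg_hdist_le_defect (σ t))
      (Real.exp_pos _).le)
    rw [← Real.exp_add, Real.exp_le_exp]
    linarith [(abs_le.1 h0).2]
  have hsh : ‖((σ t : 𝔻) : ℂ) - ξ‖ ≤ K * defect (σ t) := by
    refine (sq_le_sq₀ (norm_nonneg _) (by positivity)).1 (hbound.trans ?_)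
    rw [mul_pow, hK, Real.sq_sqrt (by positivity)]
    calc 4 / defect w * (Real.exp (-t) * defect (σ t))
        ≤ 4 / defect w * ((Real.exp (hdist 0 w) * defect (σ t)) * defect (σ t)) := by gcongr
      _ = _ := by ring
  have h1 := hdist_ray_le_of_shadow hsh
  have h2 := hdist_triangle (σ t) (ray ξ (hdist 0 (σ t))) (ray ξ t)
  rw [hdist_ray] at h2
  linarith

lemma norm_sub_le_sqrt_defect (z w : 𝔻) :
    ‖(z : ℂ) - w‖ ≤ Real.sinh (hdist z w / 2) * √(defect w) := by
  have hs : 0 ≤ Real.sinh (hdist z w / 2) :=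
    Real.sinh_nonneg_iff.2 (by linarith [hdist_nonneg z w])
  rw [norm_sub_eq_sinh]
  refine mul_le_mul_of_nonneg_left ?_ hs
  exact mul_le_of_le_one_left (Real.sqrt_nonneg _) (Real.sqrt_le_one.2 (defect_le_one z))

/-- Convergence to a boundary point does not depend on the base point of the orbit. -/
lemma tendsto_of_hdist_eq {α : Type*} {F : Filter α} {x y : α → 𝔻} {D : ℝ}
    (hxy : ∀ n, hdist (x n) (y n) = D) {ξ : Circle}
    (hy : Tendsto (fun n => ((y n : 𝔻) : ℂ)) F (𝓝 (ξ : ℂ))) :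
    Tendsto (fun n => ((x n : 𝔻) : ℂ)) F (𝓝 (ξ : ℂ)) := by
  have h1 : Tendsto (fun n => defect (y n)) F (𝓝 0) := by
    have : Tendsto (fun n => 1 - ‖((y n : 𝔻) : ℂ)‖ ^ 2) F (𝓝 (1 - ‖(ξ : ℂ)‖ ^ 2)) :=
      tendsto_const_nhds.sub (hy.norm.pow 2)
    simpa [defect, Circle.norm_coe] using this
  have h2 : Tendsto (fun n => Real.sinh (D / 2) * √(defect (y n))) F (𝓝 0) := by
    have := h1.sqrt.const_mul (Real.sinh (D / 2))
    simpa using this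
  have h3 : Tendsto (fun n => ((x n : 𝔻) : ℂ) - (y n : 𝔻)) F (𝓝 0) := by
    refine squeeze_zero_norm (fun n => ?_) h2
    rw [← hxy n]
    exact norm_sub_le_sqrt_defect _ _
  simpa using h3.add hy

/-! ### Coding of the limit set -/

section Coding

variable {gen : Bool → Equiv.Perm 𝔻} {z₀ : 𝔻}

lemma exists_seq_of_mem_limitSet {Γ : Subgroup (Equiv.Perm 𝔻)} (hΓ : ∀ g ∈ Γ, IsIsom g)
    {ξ : Circle} (hξ : ξ ∈ limitSet Γ) (z₀ : 𝔻) :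
    ∃ γ : ℕ → Equiv.Perm 𝔻, (∀ n, γ n ∈ Γ) ∧
      Tendsto (fun n => ((γ n z₀ : 𝔻) : ℂ)) atTop (𝓝 (ξ : ℂ)) := by
  obtain ⟨x, hx, hlim⟩ := mem_closure_iff_seq_limit.1 hξ
  have : ∀ n, ∃ g ∈ Γ, ((g 0 : 𝔻) : ℂ) = x n := fun n => by
    obtain ⟨y, ⟨g, rfl⟩, hy⟩ := hx n
    exact ⟨g, g.2, hy⟩
  choose γ hγ hγx using this
  refine ⟨γ, hγ, tendsto_of_hdist_eq (y := fun n => γ n 0) (D := hdist z₀ 0)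
    (fun n => (hΓ _ (hγ n)).hdist_eq _ _) ?_⟩
  simpa only [hγx] using hlim

lemma mem_limitSet_of_tendsto {Γ : Subgroup (Equiv.Perm 𝔻)} (hΓ : ∀ g ∈ Γ, IsIsom g)
    {ξ : Circle} {z₀ : 𝔻} {γ : ℕ → Equiv.Perm 𝔻} (hγ : ∀ n, γ n ∈ Γ)
    (hlim : Tendsto (fun n => ((γ n z₀ : 𝔻) : ℂ)) atTop (𝓝 (ξ : ℂ))) : ξ ∈ limitSet Γ := by
  refine mem_closure_of_tendsto (tendsto_of_hdist_eq (x := fun n => γ n 0) (D := hdist 0 z₀)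
    (fun n => (hΓ _ (hγ n)).hdist_eq _ _) hlim) (Eventually.of_forall fun n => ?_)
  exact ⟨γ n 0, ⟨⟨γ n, hγ n⟩, rfl⟩, rfl⟩

/-- The limit points without an infinite coding: the translates of the fixed points of the
generators. -/
def fixedPointOrbit (gen : Bool → Equiv.Perm 𝔻) (z₀ : 𝔻) : Set Circle :=
  {ξ | ∃ b l c,
    Tendsto (fun n : ℕ => ((word gen b l ((gen c ^ n) z₀) : 𝔻) : ℂ)) atTop (𝓝 (ξ : ℂ)) ∨
    Tendsto (fun n : ℕ => ((word gen b l (((gen c)⁻¹ ^ n) z₀) : 𝔻) : ℂ)) atTop (𝓝 (ξ : ℂ))}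

lemma countable_fixedPointOrbit (gen : Bool → Equiv.Perm 𝔻) (z₀ : 𝔻) :
    (fixedPointOrbit gen z₀).Countable := by
  have hsub : ∀ f : ℕ → ℂ, {ξ : Circle | Tendsto f atTop (𝓝 (ξ : ℂ))}.Countable := fun f =>
    Set.Subsingleton.countable fun ξ hξ η hη => Circle.ext (tendsto_nhds_unique hξ hη)
  have : fixedPointOrbit gen z₀ = ⋃ i : Bool × List ℤ × Bool,
      ({ξ : Circle | Tendsto (fun n : ℕ => ((word gen i.1 i.2.1 ((gen i.2.2 ^ n) z₀) : 𝔻) : ℂ))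
        atTop (𝓝 (ξ : ℂ))} ∪
      {ξ : Circle | Tendsto (fun n : ℕ => ((word gen i.1 i.2.1 (((gen i.2.2)⁻¹ ^ n) z₀) : 𝔻) : ℂ))
        atTop (𝓝 (ξ : ℂ))}) := by
    ext ξ
    simp only [fixedPointOrbit, Set.mem_ofPred_eq, Set.mem_iUnion, Set.mem_union, Prod.exists]
  rw [this]
  exact Set.countable_iUnion fun i => (hsub _).union (hsub _)

/-- A limit of the sequence `w g ^ m z₀` along exponents `m → ∞` is a translate of a fixed point. -/
lemma IsSchottky.mem_fixedPointOrbit (hS : IsSchottky gen z₀) {b : Bool} {l : List ℤ} {c : Bool}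
    {α : Type*} {F : Filter α} [F.NeBot] {m : α → ℤ} (hm : Tendsto m F cofinite) {ξ : Circle}
    (hξ : Tendsto (fun i => ((word gen b l ((gen c ^ m i) z₀) : 𝔻) : ℂ)) F (𝓝 (ξ : ℂ))) :
    ξ ∈ fixedPointOrbit gen z₀ := by
  set f : ℤ → ℂ := fun m => ((word gen b l ((gen c ^ m) z₀) : 𝔻) : ℂ) with hf
  obtain ⟨x, hx⟩ := (hS.nonElliptic c).exists_tendsto (hS.isIsom_word b l) z₀
  obtain ⟨y, hy⟩ := (hS.nonElliptic c).inv.exists_tendsto (hS.isIsom_word b l) z₀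
  by_contra hcon
  have hxξ : x ≠ ξ := by
    rintro rfl
    exact hcon ⟨b, l, c, Or.inl hx⟩
  have hyξ : y ≠ ξ := by
    rintro rfl
    exact hcon ⟨b, l, c, Or.inr hy⟩
  have h1 : Tendsto f atTop (𝓝 x) := by
    rw [← Nat.map_cast_int_atTop, tendsto_map'_iff]
    simpa [hf, Function.comp_def] using hx
  have h2 : Tendsto f atBot (𝓝 y) := by
    have h3 : Tendsto (fun m => f (-m)) atTop (𝓝 y) := by
      rw [← Nat.map_cast_int_atTop, tendsto_map'_iff]
      simpa [hf, Function.comp_def] using hy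
    simpa [Function.comp_def] using h3.comp tendsto_neg_atBot_atTop
  have h3 : Tendsto f cofinite (𝓝 y ⊔ 𝓝 x) := by
    rw [Int.cofinite_eq]
    exact h2.sup_sup h1
  exact (h3.comp hm).not_tendsto (disjoint_sup_left.2
    ⟨disjoint_nhds_nhds.2 hyξ, disjoint_nhds_nhds.2 hxξ⟩) hξ

/-- Every limit point outside a countable set has, for each `k`, a reduced word of length `k` all
of whose prefixes have `ξ` in their shadow. -/
lemma IsSchottky.exists_coding (hS : IsSchottky gen z₀) :
    ∃ K : ℝ, 1 ≤ K ∧ ∀ ξ ∈ limitSet (Subgroup.closure {gen true, gen false}),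
      ξ ∉ fixedPointOrbit gen z₀ → ∀ k : ℕ, ∃ (b : Bool) (l : List ℤ), l.length = k ∧ (0 : ℤ) ∉ l ∧
        ∀ i, ‖((word gen b (l.take i) z₀ : 𝔻) : ℂ) - ξ‖
          ≤ K * defect (word gen b (l.take i) z₀) := by
  obtain ⟨K, hK, hpre⟩ := hS.exists_prefix_bound
  refine ⟨K, hK, fun ξ hξ hexc k => ?_⟩
  obtain ⟨γ, hγ, hlim⟩ := exists_seq_of_mem_limitSet (fun g hg => hS.isIsom_of_mem hg) hξ z₀
  choose B L hL0 hγ' using fun n => exists_word_of_mem_closure gen (hγ n)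
  have hcode : ∀ k : ℕ, ∃ (b : Bool) (l : List ℤ), l.length = k ∧ (0 : ℤ) ∉ l ∧
      ∃ᶠ n in atTop, B n = b ∧ l <+: L n := by
    intro k
    induction k with
    | zero =>
      have : ∃ᶠ n in (atTop : Filter ℕ), B n = true ∨ B n = false :=
        (Eventually.of_forall fun n => by cases B n <;> simp).frequently
      rw [frequently_or_distrib] at this
      rcases this with h | h
      · exact ⟨true, [], rfl, by simp, h.mono fun n hn => ⟨hn, List.nil_prefix⟩⟩
      · exact ⟨false, [], rfl, by simp, h.mono fun n hn => ⟨hn, List.nil_prefix⟩⟩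
    | succ k ih =>
      obtain ⟨b, l, hlen, hl, hfreq⟩ := ih
      suffices h : ∃ m : ℤ, ∃ᶠ n in atTop, B n = b ∧ l ++ [m] <+: L n by
        obtain ⟨m, hm⟩ := h
        refine ⟨b, l ++ [m], by simp [hlen], ?_, hm⟩
        obtain ⟨n, hn⟩ := hm.exists
        exact fun h0 => hL0 n (hn.2.subset h0)
      by_contra! hcon
      have hne : ∀ᶠ n in atTop, γ n z₀ ≠ word gen b l z₀ := by
        have h1 : (ξ : ℂ) ≠ (word gen b l z₀ : 𝔻) := fun h => by
          have := (word gen b l z₀).norm_ne_one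
          rw [← h, Circle.norm_coe] at this
          exact this rfl
        filter_upwards [hlim.eventually_ne h1] with n hn h
        exact hn (by rw [h])
      set F : Filter ℕ := atTop ⊓ 𝓟 {n | (B n = b ∧ l <+: L n) ∧ γ n z₀ ≠ word gen b l z₀} with hF
      have : F.NeBot := by
        rw [hF]
        exact frequently_mem_iff_neBot.1 (hfreq.and_eventually hne)
      set m : ℕ → ℤ := fun n => ((L n).drop k).headD 0 with hm
      have hsplit : ∀ᶠ n in F, B n = b ∧ l ++ [m n] <+: L n := by
        have : ∀ᶠ n in F, (B n = b ∧ l <+: L n) ∧ γ n z₀ ≠ word gen b l z₀ :=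
          mem_inf_of_right (mem_principal_self _)
        filter_upwards [this] with n hn
        obtain ⟨⟨hB, t, ht⟩, hn⟩ := hn
        rcases t with _ | ⟨x, t⟩
        · exfalso
          apply hn
          rw [hγ' n, hB, ← ht, List.append_nil]
        · have : m n = x := by
            rw [hm]; dsimp only
            rw [← ht, ← hlen, List.drop_left]
            rfl
          exact ⟨hB, t, by rw [this, ← ht]; simp⟩
      have hcof : Tendsto m F cofinite := by
        rw [Tendsto, le_cofinite_iff_eventually_ne]
        intro x
        rw [eventually_map]
        filter_upwards [hsplit, (hcon x).filter_mono inf_le_left] with n h1 h2 h3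
        rw [h3] at h1
        exact h2 h1.1 h1.2
      apply hexc
      refine hS.mem_fixedPointOrbit (b := b) (l := l) (c := nextLetter b l) hcof ?_
      obtain ⟨C, hC, hdec⟩ := (hS.nonElliptic (nextLetter b l)).exists_defect_zpow_le z₀
      have hlim' : Tendsto (fun n => ((γ n z₀ : 𝔻) : ℂ)) F (𝓝 (ξ : ℂ)) :=
        hlim.mono_left inf_le_left
      have hzero : Tendsto (fun n => ((word gen b l ((gen (nextLetter b l) ^ m n) z₀) : 𝔻) : ℂ)
          - (γ n z₀ : 𝔻)) F (𝓝 0) := by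
        have h1 := ((tendsto_div_natAbs_sq C).comp hcof).const_mul
          (K * (K * defect (word gen b l z₀)))
        rw [mul_zero] at h1
        refine squeeze_zero_norm' ?_ h1
        filter_upwards [hsplit] with n hn
        obtain ⟨hB, t, ht⟩ := hn
        have h0 := hL0 n
        rw [← ht] at h0
        simp only [List.mem_append, not_or] at h0
        have h2 := (hpre b (l ++ [m n]) t (by simp only [List.mem_append, not_or]; exact h0.1)
          h0.2).2
        have h3 := (hpre b l [m n] h0.1.1 h0.1.2).1
        have e1 : word gen b (l ++ [m n]) z₀ = word gen b l ((gen (nextLetter b l) ^ m n) z₀) := by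
          rw [word_append]; simp [word]
        rw [ht, ← hB, ← hγ' n, hB, e1] at h2
        rw [e1] at h3
        simp only [word, mul_one] at h3
        refine h2.trans ?_
        rw [mul_assoc]
        refine mul_le_mul_of_nonneg_left (h3.trans ?_) (by linarith)
        rw [mul_assoc]
        refine mul_le_mul_of_nonneg_left ?_ (by linarith)
        exact mul_le_mul_of_nonneg_left (hdec _) (defect_pos _).le
      simpa using hzero.add hlim'
  obtain ⟨b, l, hlen, hl, hfreq⟩ := hcode k
  refine ⟨b, l, hlen, hl, fun i => ?_⟩
  refine le_of_tendsto_of_frequently ((tendsto_const_nhds.sub hlim).norm)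
    (hfreq.mono fun n hn => ?_)
  obtain ⟨t, ht⟩ := (List.take_prefix i l).trans hn.2
  have h0 := hL0 n
  rw [← ht] at h0
  simp only [List.mem_append, not_or] at h0
  have := (hpre b _ t h0.1 h0.2).2
  rwa [ht, ← hn.1, ← hγ' n, hn.1] at this

end Coding

/-! ### Recurrence of coded rays to a compact set -/

lemma isCompact_setOf_le_defect {c : ℝ} (hc : 0 < c) : IsCompact {z : 𝔻 | c ≤ defect z} := by
  rw [Complex.UnitDisc.isEmbedding_coe.isCompact_iff]
  have : ((↑) : 𝔻 → ℂ) '' {z : 𝔻 | c ≤ defect z} = {x : ℂ | c ≤ 1 - ‖x‖ ^ 2} := by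
    ext x
    constructor
    · rintro ⟨z, hz, rfl⟩
      exact hz
    · intro hx
      have hx' : c ≤ 1 - ‖x‖ ^ 2 := hx
      have : ‖x‖ < 1 := by nlinarith [norm_nonneg x]
      exact ⟨Complex.UnitDisc.mk x this, hx, rfl⟩
  rw [this]
  refine (isCompact_closedBall (0 : ℂ) 1).of_isClosed_subset
    (isClosed_le continuous_const (by fun_prop)) fun x hx => ?_
  have hx' : c ≤ 1 - ‖x‖ ^ 2 := hx
  rw [mem_closedBall_zero_iff]
  nlinarith [norm_nonneg x]

lemma isCompact_hdist_le (z₀ : 𝔻) (R : ℝ) : IsCompact {z : 𝔻 | hdist z₀ z ≤ R} := by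
  refine (isCompact_setOf_le_defect (c := defect z₀ / (4 * Real.exp R))
    (by have := defect_pos z₀; positivity)).of_isClosed_subset
    (isClosed_le (continuous_hdist z₀) continuous_const) fun z hz => ?_
  have hz' : hdist z₀ z ≤ R := hz
  change defect z₀ / (4 * Real.exp R) ≤ defect z
  have q := defect_pos z
  rw [div_le_iff₀ (by positivity)]
  refine (defect_le_mul_defect z₀ z).trans ?_
  rw [mul_comm]
  gcongr

lemma proj_mem_image_iff (Γ : Subgroup (Equiv.Perm 𝔻)) (K : Set 𝔻) (z : 𝔻) :
    proj Γ z ∈ proj Γ '' K ↔ ∃ g ∈ Γ, g z ∈ K := by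
  constructor
  · rintro ⟨y, hy, hyz⟩
    obtain ⟨g, hg⟩ := MulAction.orbitRel_apply.1 (Quotient.exact hyz)
    refine ⟨g, g.2, ?_⟩
    have : (g : Equiv.Perm 𝔻) z = y := hg
    rwa [this]
  · rintro ⟨g, hg, hgz⟩
    exact ⟨g z, hgz, Quotient.sound (MulAction.orbitRel_apply.2 ⟨⟨g, hg⟩, rfl⟩)⟩

lemma isCompact_proj_image (Γ : Subgroup (Equiv.Perm 𝔻)) {K : Set 𝔻} (hK : IsCompact K) :
    IsCompact (proj Γ '' K) := hK.image continuous_quotient_mk'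

section Schottky

variable {gen : Bool → Equiv.Perm 𝔻} {z₀ : 𝔻}

lemma countable_closure (gen : Bool → Equiv.Perm 𝔻) :
    Countable (Subgroup.closure {gen true, gen false}) := by
  refine Set.countable_coe_iff.2 ?_
  refine (Set.countable_range fun i : Bool × List ℤ => word gen i.1 i.2).mono fun g hg => ?_
  obtain ⟨b, l, -, rfl⟩ := exists_word_of_mem_closure gen hg
  exact ⟨(b, l), rfl⟩

lemma IsSchottky.measurableSet_visits (hS : IsSchottky gen z₀) (R : ℝ) (ξ : Circle) :
    MeasurableSet {t : ℝ | proj (Subgroup.closure {gen true, gen false}) (ray ξ t) ∈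
      proj (Subgroup.closure {gen true, gen false}) '' {z | hdist z₀ z ≤ R}} := by
  have := countable_closure gen
  have e : {t : ℝ | proj (Subgroup.closure {gen true, gen false}) (ray ξ t) ∈
      proj (Subgroup.closure {gen true, gen false}) '' {z | hdist z₀ z ≤ R}}
      = ⋃ g : Subgroup.closure {gen true, gen false},
        {t : ℝ | hdist z₀ ((g : Equiv.Perm 𝔻) (ray ξ t)) ≤ R} := by
    ext t
    rw [Set.mem_ofPred_eq, proj_mem_image_iff]
    simp
  rw [e]
  refine MeasurableSet.iUnion fun g => (isClosed_le ?_ continuous_const).measurableSet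
  exact (continuous_hdist z₀).comp ((hS.isIsom_of_mem g.2).continuous.comp (continuous_ray ξ))

lemma IsSchottky.finite_orbit_inter_ball (hS : IsSchottky gen z₀) (R : ℝ) :
    {x : 𝔻 | ∃ g ∈ Subgroup.closure {gen true, gen false}, g z₀ = x ∧ hdist z₀ x ≤ R}.Finite := by
  obtain ⟨r, hr, hmin⟩ := hS.exists_le_hdist_word
  obtain ⟨t, -, htfin, htcov⟩ :=
    (isCompact_closedBall (toUpperHalfPlane z₀) R).finite_cover_balls (half_pos hr)
  have hcov : ∀ x : 𝔻, hdist z₀ x ≤ R → ∃ y ∈ t, dist (toUpperHalfPlane x) y < r / 2 := by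
    intro x hx
    have : toUpperHalfPlane x ∈ Metric.closedBall (toUpperHalfPlane z₀) R := by
      rwa [Metric.mem_closedBall, dist_comm, dist_toUpperHalfPlane]
    simpa using htcov this
  choose! f hft hfd using hcov
  refine Set.Finite.of_injOn (f := f) (t := t) ?_ ?_ htfin
  · rintro x ⟨g, hg, -, hx⟩
    exact hft x hx
  · rintro _ ⟨g, hg, rfl, hx⟩ _ ⟨g', hg', rfl, hx'⟩ hff
    by_contra hne
    have h1 : hdist (g z₀) (g' z₀) < r := by
      rw [← dist_toUpperHalfPlane]
      have h2 := hfd _ hx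
      have h3 := hfd _ hx'
      rw [← hff, dist_comm] at h3
      linarith [dist_triangle (toUpperHalfPlane (g z₀)) (f (g z₀)) (toUpperHalfPlane (g' z₀))]
    obtain ⟨b, l, hl, hw⟩ := exists_word_of_mem_closure gen (mul_mem (inv_mem hg) hg')
    have h2 : hdist z₀ (word gen b l z₀) = hdist (g z₀) (g' z₀) := by
      rw [← hw, Equiv.Perm.mul_apply, hdist_comm, (hS.isIsom_of_mem hg).hdist_inv_apply, hdist_comm]
    rcases eq_or_ne l [] with rfl | hl'
    · simp only [word] at hw
      exact hne (by rw [inv_mul_eq_one.1 hw])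
    · have := hmin b l hl hl'
      linarith

/-- A ball of given radius contains boundedly many of the orbit points attached to the prefixes of
a reduced word. -/
lemma IsSchottky.exists_card_prefix_le (hS : IsSchottky gen z₀) (R : ℝ) :
    ∃ N : ℕ, ∀ (b : Bool) (l : List ℤ), (0 : ℤ) ∉ l → ∀ (y : 𝔻) (s : Finset ℕ),
      (∀ i ∈ s, i ≤ l.length ∧ hdist (word gen b (l.take i) z₀) y ≤ R) → s.card ≤ N := by
  obtain ⟨r, hr, hmin⟩ := hS.exists_le_hdist_word
  have hfin := hS.finite_orbit_inter_ball (R + R)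
  refine ⟨Set.ncard {x : 𝔻 | ∃ g ∈ Subgroup.closure {gen true, gen false}, g z₀ = x ∧
    hdist z₀ x ≤ R + R}, fun b l hl y s hs => ?_⟩
  rcases s.eq_empty_or_nonempty with rfl | ⟨i₀, hi₀⟩
  · simp
  set g₀ := word gen b (l.take i₀) with hg₀
  have hg₀i := hS.isIsom_word b (l.take i₀)
  rw [← Set.ncard_coe_finset]
  refine Set.ncard_le_ncard_of_injOn (fun i => g₀⁻¹ (word gen b (l.take i) z₀)) ?_ ?_ hfin
  · intro i hi
    refine ⟨g₀⁻¹ * word gen b (l.take i),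
      mul_mem (inv_mem (word_mem_closure _ _ _)) (word_mem_closure _ _ _), rfl, ?_⟩
    rw [hdist_comm, hg₀i.hdist_inv_apply]
    have h1 := (hs i hi).2
    have h2 := (hs i₀ hi₀).2
    have h3 := hdist_triangle (word gen b (l.take i) z₀) y (g₀ z₀)
    rw [hdist_comm y] at h3
    linarith
  · have key : ∀ i j, i < j → j ≤ l.length →
        word gen b (l.take i) z₀ ≠ word gen b (l.take j) z₀ := by
      intro i j hij hj h
      have e : l.take j = l.take i ++ (l.take j).drop i := by
        conv_lhs => rw [← List.take_append_drop i (l.take j), List.take_take, min_eq_left hij.le]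
      rw [e, word_append, Equiv.Perm.mul_apply, EmbeddingLike.apply_eq_iff_eq] at h
      have h0 : (0 : ℤ) ∉ (l.take j).drop i := fun h0 =>
        hl (List.mem_of_mem_take (List.mem_of_mem_drop h0))
      have hne : (l.take j).drop i ≠ [] := by
        intro h'
        have := congrArg List.length h'
        simp at this
        omega
      have := hmin (nextLetter b (l.take i)) _ h0 hne
      rw [← h, hdist_self] at this
      linarith
    intro i hi j hj hij
    have hij' : word gen b (l.take i) z₀ = word gen b (l.take j) z₀ := g₀⁻¹.injective hij
    rcases lt_trichotomy i j with h | h | h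
    · exact absurd hij' (key i j h (hs j hj).1)
    · exact h
    · exact absurd hij'.symm (key j i h (hs i hi).1)

/-- A coded ray spends in a fixed compact part of the surface a time proportional to the length of
the code. -/
lemma IsSchottky.exists_length_le_integral (hS : IsSchottky gen z₀) (K : ℝ) :
    ∃ (N : ℕ) (R : ℝ), ∀ (ξ : Circle) (b : Bool) (l : List ℤ), (0 : ℤ) ∉ l →
      (∀ i, ‖((word gen b (l.take i) z₀ : 𝔻) : ℂ) - ξ‖
        ≤ K * defect (word gen b (l.take i) z₀)) →
      ∀ T : ℝ, 0 ≤ T → (∀ i < l.length, hdist 0 (word gen b (l.take i) z₀) + 1 ≤ T) →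
      (l.length : ℝ) ≤ N * ∫ t in (0 : ℝ)..T,
        (proj (Subgroup.closure {gen true, gen false}) '' {z | hdist z₀ z ≤ R}).indicator
          (fun _ => (1 : ℝ)) (proj (Subgroup.closure {gen true, gen false}) (ray ξ t)) := by
  set D := 2 * Real.arsinh (K + 1) with hD
  obtain ⟨N, hN⟩ := hS.exists_card_prefix_le (D + 1)
  refine ⟨N, D + 1, fun ξ b l hl hsh T hT0 hT => ?_⟩
  set Γ := Subgroup.closure {gen true, gen false} with hΓ
  set S := {t : ℝ | proj Γ (ray ξ t) ∈ proj Γ '' {z | hdist z₀ z ≤ D + 1}} with hSdef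
  have hSm : MeasurableSet S := hS.measurableSet_visits (D + 1) ξ
  set τ : ℕ → ℝ := fun i => hdist 0 (word gen b (l.take i) z₀) with hτ
  have hnear : ∀ i t, t ∈ Set.Ioc (τ i) (τ i + 1) →
      hdist (word gen b (l.take i) z₀) (ray ξ t) ≤ D + 1 := by
    intro i t ht
    have h1 := hdist_ray_le_of_shadow (hsh i)
    have h2 := hdist_triangle (word gen b (l.take i) z₀) (ray ξ (τ i)) (ray ξ t)
    rw [hdist_ray, abs_sub_comm, abs_of_pos (sub_pos.2 ht.1)] at h2
    linarith [ht.2]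
  have e1 : ∀ t, (proj Γ '' {z | hdist z₀ z ≤ D + 1}).indicator (fun _ => (1 : ℝ))
      (proj Γ (ray ξ t)) = S.indicator (fun _ => (1 : ℝ)) t := fun t => rfl
  simp only [e1]
  rw [intervalIntegral.integral_of_le hT0]
  have hpt : ∀ t, ∑ i ∈ Finset.range l.length,
      (Set.Ioc (τ i) (τ i + 1)).indicator (fun _ => (1 : ℝ)) t
        ≤ N * S.indicator (fun _ => (1 : ℝ)) t := by
    classical
    intro t
    have e2 : ∑ i ∈ Finset.range l.length,
        (Set.Ioc (τ i) (τ i + 1)).indicator (fun _ => (1 : ℝ)) t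
        = ((Finset.range l.length).filter fun i => t ∈ Set.Ioc (τ i) (τ i + 1)).card := by
      rw [Finset.card_filter, Nat.cast_sum]
      refine Finset.sum_congr rfl fun i _ => ?_
      rw [Set.indicator_apply]; split_ifs <;> simp
    rw [e2]
    have hcard := hN b l hl (ray ξ t)
      ((Finset.range l.length).filter fun i => t ∈ Set.Ioc (τ i) (τ i + 1)) (fun i hi => by
        rw [Finset.mem_filter, Finset.mem_range] at hi
        exact ⟨hi.1.le, hnear i t hi.2⟩)
    by_cases ht : t ∈ S
    · rw [Set.indicator_of_mem ht, mul_one]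
      exact_mod_cast hcard
    · rw [Set.indicator_of_notMem ht, mul_zero]
      have : ((Finset.range l.length).filter fun i => t ∈ Set.Ioc (τ i) (τ i + 1)) = ∅ := by
        refine Finset.filter_eq_empty_iff.2 fun i _ hi => ht ?_
        refine (proj_mem_image_iff Γ _ _).2 ⟨(word gen b (l.take i))⁻¹,
          inv_mem (word_mem_closure _ _ _), ?_⟩
        change hdist _ _ ≤ _
        rw [hdist_comm, (hS.isIsom_word _ _).hdist_inv_apply, hdist_comm]
        exact hnear i t hi
      rw [this, Finset.card_empty, Nat.cast_zero]
  have hint : ∀ A : Set ℝ, MeasurableSet A →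
      Integrable (A.indicator fun _ => (1 : ℝ)) (volume.restrict (Set.Ioc 0 T)) := fun A hA =>
    (integrable_const 1).indicator hA
  have h1 := integral_mono (μ := volume.restrict (Set.Ioc 0 T))
    (integrable_finsetSum (Finset.range l.length) fun i _ => hint _ measurableSet_Ioc)
    ((hint S hSm).const_mul (N : ℝ)) hpt
  rw [integral_finsetSum _ fun i _ => hint _ measurableSet_Ioc, integral_const_mul] at h1
  refine le_trans (le_of_eq ?_) h1
  have h2 : ∀ i ∈ Finset.range l.length, ∫ t in Set.Ioc 0 T,
      (Set.Ioc (τ i) (τ i + 1)).indicator (fun _ => (1 : ℝ)) t = 1 := by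
    intro i hi
    rw [integral_indicator measurableSet_Ioc, Measure.restrict_restrict measurableSet_Ioc,
      Set.inter_eq_left.2 (Set.Ioc_subset_Ioc (hdist_nonneg _ _) (hT i (Finset.mem_range.1 hi)))]
    simp
  rw [Finset.sum_congr rfl h2]
  simp

/-- The defects of the prefixes of the code of a point diverging on average decay faster than any
exponential. -/
lemma IsSchottky.exists_defect_le_exp (hS : IsSchottky gen z₀) (K : ℝ) {ξ : Circle}
    (hξ : ξ ∈ divergingOnAverage (Subgroup.closure {gen true, gen false})) {M : ℝ} (hM : 0 < M) :
    ∃ k₀ : ℕ, ∀ (b : Bool) (l : List ℤ), k₀ ≤ l.length → (0 : ℤ) ∉ l →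
      (∀ i, ‖((word gen b (l.take i) z₀ : 𝔻) : ℂ) - ξ‖
        ≤ K * defect (word gen b (l.take i) z₀)) →
      defect (word gen b l z₀) ≤ Real.exp (-(M * l.length)) := by
  obtain ⟨N, R, hNR⟩ := hS.exists_length_le_integral K
  obtain ⟨K', hK', hpre⟩ := hS.exists_prefix_bound
  have hlim := hξ.2 (ray ξ) (isGeodesicRay_ray ξ) (endsAt_ray ξ) _
    (isCompact_proj_image _ (isCompact_hdist_le z₀ R))
  set Γ := Subgroup.closure {gen true, gen false} with hΓ
  set I : ℝ → ℝ := fun T => ∫ t in (0 : ℝ)..T, (proj Γ '' {z | hdist z₀ z ≤ R}).indicator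
          (fun _ => (1 : ℝ)) (proj Γ (ray ξ t)) with hI
  set M' := M + 1 with hM'
  set ε : ℝ := 1 / ((N + 1) * M') with hε
  have hεpos : 0 < ε := by positivity
  have hev : ∀ᶠ T : ℝ in atTop, 1 / T * I T < ε := hlim.eventually_lt_const hεpos
  obtain ⟨T₀, hT₀⟩ := eventually_atTop.1 (hev.and (eventually_gt_atTop 0))
  have hT₀pos : 0 < T₀ := (hT₀ T₀ le_rfl).2
  have hbound : ∀ T, T₀ ≤ T → N * I T ≤ T / M' := by
    intro T hT
    obtain ⟨h1, h2⟩ := hT₀ T hT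
    rw [one_div, inv_mul_lt_iff₀ h2] at h1
    have : N * I T ≤ N * (T * ε) := mul_le_mul_of_nonneg_left h1.le N.cast_nonneg
    refine this.trans ?_
    rw [hε, mul_one_div, mul_div_assoc', div_le_div_iff₀ (by positivity) (by positivity)]
    nlinarith [mul_pos h2 (by positivity : 0 < M')]
  set C := Real.log (4 * K') with hC
  obtain ⟨k₀, hk₀⟩ := exists_nat_gt (max (T₀ / M') (Real.log 4 + C + 1))
  refine ⟨k₀, fun b l hlen hl hsh => ?_⟩
  have hk : (k₀ : ℝ) ≤ l.length := by exact_mod_cast hlen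
  have hk1 := (le_max_left _ _).trans_lt hk₀
  have hk2 := (le_max_right _ _).trans_lt hk₀
  -- prefixes are visited before the whole word, up to a constant
  have hmono : ∀ i, hdist 0 (word gen b (l.take i) z₀) ≤ hdist 0 (word gen b l z₀) + C := by
    intro i
    have h1 := (hpre b (l.take i) (l.drop i) (fun h => hl (List.mem_of_mem_take h))
      (fun h => hl (List.mem_of_mem_drop h))).1
    rw [List.take_append_drop] at h1
    have h2 := defect_le_exp_neg_hdist (word gen b (l.take i) z₀)
    have h3 := exp_neg_hdist_le_defect (word gen b l z₀)
    have h4 := defect_le_one (word gen (nextLetter b (l.take i)) (l.drop i) z₀)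
    have h5 := defect_pos (word gen b (l.take i) z₀)
    have h6 : Real.exp (-hdist 0 (word gen b l z₀))
        ≤ 4 * K' * Real.exp (-hdist 0 (word gen b (l.take i) z₀)) := by
      calc _ ≤ _ := h3
        _ ≤ _ := h1
        _ ≤ K' * (defect (word gen b (l.take i) z₀) * 1) := by gcongr
        _ ≤ K' * (4 * Real.exp (-hdist 0 (word gen b (l.take i) z₀)) * 1) := by gcongr
        _ = _ := by ring
    have e : 4 * K' = Real.exp C := by rw [hC, Real.exp_log (by positivity)]
    rw [e, ← Real.exp_add, Real.exp_le_exp] at h6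
    linarith
  set T := hdist 0 (word gen b l z₀) + C + 1 with hT
  have hlenT : M' * l.length ≤ T := by
    rcases le_total T₀ T with h | h
    · have h1 := hNR ξ b l hl hsh T (hT₀pos.le.trans h) (fun i _ => by linarith [hmono i])
      have := h1.trans (hbound T h)
      rwa [le_div_iff₀ (by positivity), mul_comm] at this
    · exfalso
      have h1 := hNR ξ b l hl hsh T₀ hT₀pos.le (fun i _ => by linarith [hmono i])
      have := h1.trans (hbound T₀ le_rfl)
      linarith
  refine (defect_le_exp_neg_hdist _).trans ?_
  have e4 : (4 : ℝ) = Real.exp (Real.log 4) := by rw [Real.exp_log (by norm_num)]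
  rw [e4, ← Real.exp_add, Real.exp_le_exp]
  rw [hM'] at hlenT
  nlinarith

end Schottky

/-! ### Upper bound for the dimension -/

lemma summable_div_natAbs_sq_rpow {C s : ℝ} (hC : 0 ≤ C) (hs : 1 / 2 < s) :
    Summable fun n : ℤ => (C / ((n.natAbs : ℝ) + 1) ^ 2) ^ s := by
  have h1 : Summable fun n : ℕ => (C / ((n : ℝ) + 1) ^ 2) ^ s := by
    have h2 : Summable fun n : ℕ => C ^ s * (1 / ((n + 1 : ℕ) : ℝ) ^ (2 * s)) :=
      ((summable_nat_add_iff 1).2 (Real.summable_one_div_nat_rpow.2 (by linarith))).mul_left _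
    refine h2.congr fun n => ?_
    rw [Real.div_rpow hC (by positivity), ← Real.rpow_natCast, ← Real.rpow_mul (by positivity)]
    push_cast
    ring
  refine Summable.of_nat_of_neg ?_ ?_
  · simpa using h1
  · simpa using h1

lemma tsum_prod_fin_eq_pow (f : ℤ → ℝ≥0∞) (k : ℕ) :
    ∑' v : Fin k → ℤ, ∏ i, f (v i) = (∑' n, f n) ^ k := by
  induction k with
  | zero => simp
  | succ k ih =>
    rw [← (Fin.consEquiv fun _ => ℤ).tsum_eq, ENNReal.tsum_prod', pow_succ', ← ih,
      ← ENNReal.tsum_mul_right]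
    refine tsum_congr fun n => ?_
    rw [← ENNReal.tsum_mul_left]
    refine tsum_congr fun v => ?_
    rw [Fin.prod_univ_succ]
    simp [Fin.consEquiv]

instance : MeasurableSpace VisualCircle := borel _

instance : BorelSpace VisualCircle := ⟨rfl⟩

lemma VisualCircle.dist_eq (ξ η : VisualCircle) :
    dist ξ η = ‖(ξ.toCircle : ℂ) - η.toCircle‖ / 2 := visualDist_eq _ _

section Schottky

variable {gen : Bool → Equiv.Perm 𝔻} {z₀ : 𝔻}

/-- The points which for all `k ≥ k₀` lie in the shadow of a reduced word of length `k` with defect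
at most `exp (-M k)`. -/
def deepShadowSet (gen : Bool → Equiv.Perm 𝔻) (z₀ : 𝔻) (K M : ℝ) (k₀ : ℕ) : Set VisualCircle :=
  {ξ | ∀ k, k₀ ≤ k → ∃ (b : Bool) (l : List ℤ), l.length = k ∧ (0 : ℤ) ∉ l ∧
    defect (word gen b l z₀) ≤ Real.exp (-(M * k)) ∧
    ‖((word gen b l z₀ : 𝔻) : ℂ) - ξ.toCircle‖ ≤ K * defect (word gen b l z₀)}

/-- The shadows of the words of length `k` cover, and for `t < s` and `A` the sum over one letter
of the `t`-th powers of the diameters, the sum of the `s`-th powers of their diameters is at most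
`2 K ^ s (A exp (-M (s - t))) ^ k`. -/
lemma IsSchottky.hausdorffMeasure_deepShadowSet (hS : IsSchottky gen z₀) {s : ℝ}
    (hs : 1 / 2 < s) {K : ℝ} (hK : 0 < K) :
    ∃ M : ℝ, 0 < M ∧ ∀ k₀, Measure.hausdorffMeasure s (deepShadowSet gen z₀ K M k₀) = 0 := by
  obtain ⟨C, hC, hword⟩ := hS.exists_defect_word_le
  obtain ⟨t, ht, hts⟩ := exists_between hs
  have hs0 : 0 < s := by linarith
  have ht0 : 0 < t := by linarith
  set f : ℤ → ℝ≥0∞ := fun n => ENNReal.ofReal ((C / ((n.natAbs : ℝ) + 1) ^ 2) ^ t) with hf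
  have hA : ∑' n, f n ≠ ∞ := (summable_div_natAbs_sq_rpow hC.le ht).tsum_ofReal_ne_top
  set A := ∑' n, f n with hAdef
  set M := (Real.log (A.toReal + 1) + 1) / (s - t) with hM
  have hst : 0 < s - t := sub_pos.2 hts
  have hA0 : 0 ≤ A.toReal := ENNReal.toReal_nonneg
  have hlog : 0 ≤ Real.log (A.toReal + 1) := Real.log_nonneg (by linarith)
  have hMpos : 0 < M := by positivity
  refine ⟨M, hMpos, fun k₀ => ?_⟩
  set U : ∀ k : ℕ, Bool × (Fin k → ℤ) → Set VisualCircle := fun k i =>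
    {ξ | (0 : ℤ) ∉ List.ofFn i.2 ∧
      defect (word gen i.1 (List.ofFn i.2) z₀) ≤ Real.exp (-(M * k)) ∧
      ‖((word gen i.1 (List.ofFn i.2) z₀ : 𝔻) : ℂ) - ξ.toCircle‖
        ≤ K * defect (word gen i.1 (List.ofFn i.2) z₀)} with hU
  have hdiam0 : ∀ k i, Metric.ediam (U k i)
      ≤ ENNReal.ofReal (K * defect (word gen i.1 (List.ofFn i.2) z₀)) := by
    intro k i
    refine Metric.ediam_le fun ξ hξ η hη => ?_
    rw [edist_dist]
    refine ENNReal.ofReal_le_ofReal ?_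
    rw [VisualCircle.dist_eq]
    have h1 := norm_sub_le_norm_sub_add_norm_sub (ξ.toCircle : ℂ)
      (word gen i.1 (List.ofFn i.2) z₀ : 𝔻) (η.toCircle : ℂ)
    rw [norm_sub_rev (ξ.toCircle : ℂ) (word gen i.1 (List.ofFn i.2) z₀ : 𝔻)] at h1
    linarith [hξ.2.2, hη.2.2]
  have hdiam1 : ∀ k i, Metric.ediam (U k i) ≤ ENNReal.ofReal (K * Real.exp (-(M * k))) := by
    intro k i
    rcases (U k i).eq_empty_or_nonempty with h | ⟨ξ, hξ⟩
    · rw [h]; simp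
    · refine (hdiam0 k i).trans (ENNReal.ofReal_le_ofReal ?_)
      exact mul_le_mul_of_nonneg_left hξ.2.1 hK.le
  have hpow : ∀ k i, Metric.ediam (U k i) ^ s
      ≤ ENNReal.ofReal (K ^ s * Real.exp (-(M * (s - t))) ^ k) * ∏ j, f (i.2 j) := by
    intro k i
    rcases (U k i).eq_empty_or_nonempty with h | ⟨ξ, hξ⟩
    · rw [h, Metric.ediam_empty, ENNReal.zero_rpow_of_pos hs0]; exact zero_le
    · obtain ⟨h0, h1, -⟩ := hξ
      have q := defect_pos (word gen i.1 (List.ofFn i.2) z₀)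
      have h2 := hword i.1 _ h0
      set d := defect (word gen i.1 (List.ofFn i.2) z₀)
      rw [List.map_ofFn, List.prod_ofFn] at h2
      refine (ENNReal.rpow_le_rpow (hdiam0 k i) hs0.le).trans ?_
      rw [ENNReal.ofReal_rpow_of_nonneg (by positivity) hs0.le, hf,
        ← ENNReal.ofReal_prod_of_nonneg fun _ _ => by positivity,
        ← ENNReal.ofReal_mul (by positivity)]
      refine ENNReal.ofReal_le_ofReal ?_
      rw [Real.mul_rpow hK.le q.le, mul_assoc]
      refine mul_le_mul_of_nonneg_left ?_ (by positivity)
      have e1 : d ^ s = d ^ (s - t) * d ^ t := by rw [← Real.rpow_add q]; ring_nf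
      rw [e1]
      refine mul_le_mul ?_ ?_ (by positivity) (by positivity)
      · refine (Real.rpow_le_rpow q.le h1 hst.le).trans_eq ?_
        rw [← Real.exp_mul, ← Real.exp_nat_mul]
        ring_nf
      · refine (Real.rpow_le_rpow q.le h2 ht0.le).trans_eq ?_
        rw [← Real.finsetProd_rpow _ _ fun _ _ => by simp only [Function.comp_apply]; positivity]
        rfl
  have hsum : ∀ k, ∑' i, Metric.ediam (U k i) ^ s
      ≤ 2 * ENNReal.ofReal (K ^ s) * (ENNReal.ofReal (Real.exp (-(M * (s - t)))) * A) ^ k := by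
    intro k
    refine (ENNReal.tsum_le_tsum (hpow k)).trans (le_of_eq ?_)
    rw [ENNReal.tsum_mul_left, ENNReal.tsum_prod']
    simp only [tsum_prod_fin_eq_pow, tsum_bool]
    rw [ENNReal.ofReal_mul (by positivity), ENNReal.ofReal_pow (by positivity), mul_pow, ← hAdef]
    ring
  have hq : ENNReal.ofReal (Real.exp (-(M * (s - t)))) * A < 1 := by
    have h1 : M * (s - t) = Real.log (A.toReal + 1) + 1 := by
      rw [hM, div_mul_cancel₀ _ hst.ne']
    rw [← ENNReal.ofReal_toReal hA, ← ENNReal.ofReal_mul (by positivity), ← ENNReal.ofReal_one,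
      ENNReal.ofReal_lt_ofReal_iff one_pos, h1, neg_add, Real.exp_add, Real.exp_neg,
      Real.exp_log (by linarith)]
    have h2 : Real.exp (-1) < 1 := by rw [Real.exp_lt_one_iff]; norm_num
    have h3 : (A.toReal + 1)⁻¹ * A.toReal ≤ 1 := by
      rw [inv_mul_le_iff₀ (by linarith)]; linarith
    have h4 : 0 ≤ (A.toReal + 1)⁻¹ * A.toReal := by positivity
    nlinarith [Real.exp_pos (-1)]
  refine le_antisymm ?_ (zero_le)
  refine (Measure.hausdorffMeasure_le_liminf_tsum s _
    (l := atTop) (fun k : ℕ => ENNReal.ofReal (K * Real.exp (-(M * k)))) ?_ U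
    (Eventually.of_forall fun k i => hdiam1 k i) ?_).trans ?_
  · have h1 : Tendsto (fun k : ℕ => K * Real.exp (-(M * k))) atTop (𝓝 (K * 0)) := by
      refine Tendsto.const_mul _ (Real.tendsto_exp_neg_atTop_nhds_zero.comp ?_)
      exact tendsto_natCast_atTop_atTop.const_mul_atTop hMpos
    have := ENNReal.tendsto_ofReal h1
    simpa using this
  · filter_upwards [eventually_ge_atTop k₀] with k hk ξ hξ
    obtain ⟨b, l, hlen, h0, h1, h2⟩ := hξ k hk
    subst hlen
    refine Set.mem_iUnion.2 ⟨(b, l.get), ?_⟩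
    rw [hU]
    simp only [List.ofFn_get]
    exact ⟨h0, h1, h2⟩
  · have h1 : Tendsto (fun k : ℕ => 2 * ENNReal.ofReal (K ^ s) *
        (ENNReal.ofReal (Real.exp (-(M * (s - t)))) * A) ^ k) atTop (𝓝 0) := by
      have := ENNReal.Tendsto.const_mul (a := 2 * ENNReal.ofReal (K ^ s))
        (ENNReal.tendsto_pow_atTop_nhds_zero_of_lt_one hq)
        (Or.inr (ENNReal.mul_ne_top (by simp) ENNReal.ofReal_ne_top))
      simpa using this
    rw [← h1.liminf_eq]
    exact liminf_le_liminf (Eventually.of_forall hsum)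

lemma IsSchottky.dimH_le (hS : IsSchottky gen z₀) :
    dimH (VisualCircle.toCircle ⁻¹'
      divergingOnAverage (Subgroup.closure {gen true, gen false})) ≤ 1 / 2 := by
  refine le_of_forall_gt fun r hr => ?_
  obtain ⟨s, hs1, hs2⟩ := ENNReal.lt_iff_exists_nnreal_btwn.1 hr
  refine lt_of_le_of_lt ?_ hs2
  have hs : (1 / 2 : ℝ) < s := by
    have : ((1 / 2 : ℝ≥0) : ℝ≥0∞) < s := by simpa using hs1
    exact_mod_cast this
  obtain ⟨K, hK, hcode⟩ := hS.exists_coding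
  obtain ⟨M, hM, hzero⟩ := hS.hausdorffMeasure_deepShadowSet hs (by linarith : 0 < K)
  have hsub : VisualCircle.toCircle ⁻¹'
      divergingOnAverage (Subgroup.closure {gen true, gen false})
      ⊆ (VisualCircle.toCircle ⁻¹' fixedPointOrbit gen z₀) ∪ ⋃ k₀, deepShadowSet gen z₀ K M k₀ := by
    intro ξ hξ
    by_cases hfix : ξ.toCircle ∈ fixedPointOrbit gen z₀
    · exact Or.inl hfix
    right
    obtain ⟨k₀, hk₀⟩ := hS.exists_defect_le_exp K hξ hM
    refine Set.mem_iUnion.2 ⟨k₀, fun k hk => ?_⟩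
    obtain ⟨b, l, hlen, h0, hsh⟩ := hcode _ hξ.1 hfix k
    refine ⟨b, l, hlen, h0, ?_, ?_⟩
    · rw [← hlen]
      exact hk₀ b l (hlen ▸ hk) h0 hsh
    · simpa [← hlen] using hsh l.length
  have hinj : Function.Injective VisualCircle.toCircle := by
    rintro ⟨ξ⟩ ⟨η⟩ rfl
    rfl
  refine (dimH_mono hsub).trans ?_
  rw [dimH_union, dimH_countable ((countable_fixedPointOrbit gen z₀).preimage hinj), dimH_iUnion]
  refine max_le (zero_le) (iSup_le fun k₀ => ?_)
  refine dimH_le_of_hausdorffMeasure_ne_top ?_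
  rw [hzero]
  exact ENNReal.zero_ne_top

end Schottky

/-! ### The critical exponent of the parabolic subgroup -/

lemma IsNonElliptic.zpow_injective {g : Equiv.Perm 𝔻} (hg : IsNonElliptic g) :
    Function.Injective fun n : ℤ => g ^ n := by
  have h0 : (0 : 𝔻) ∉ pingSet 0 g := fun h => by
    have h1 := half_hdist_le_of_mem_pingSet hg.isIsom h
    rw [hdist_self] at h1
    linarith [hdist_pos_of_ne (hg.apply_ne 0).symm]
  intro m n hmn
  by_contra hne
  have h1 := hg.zpow_mem_pingSet h0 (sub_ne_zero.2 hne)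
  have h2 : g ^ m = g ^ n := hmn
  rw [zpow_sub, h2, mul_inv_cancel, Equiv.Perm.one_apply] at h1
  exact h0 h1

lemma tsum_zpowers_eq {g : Equiv.Perm 𝔻} (hg : IsNonElliptic g)
    (f : Equiv.Perm 𝔻 → ℝ≥0∞) :
    ∑' x : Subgroup.zpowers g, f x = ∑' n : ℤ, f (g ^ n) := by
  have hbij : Function.Bijective
      fun n : ℤ => (⟨g ^ n, n, rfl⟩ : Subgroup.zpowers g) := by
    constructor
    · intro m n hmn
      exact hg.zpow_injective (congrArg Subtype.val hmn)
    · rintro ⟨_, n, rfl⟩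
      exact ⟨n, rfl⟩
  rw [← (Equiv.ofBijective _ hbij).tsum_eq]
  rfl

/-- Since `exp (-d(0, pⁿ 0))` is comparable to `1 / n ^ 2`, the Poincaré series of `⟨p⟩` converges
exactly for `s > 1 / 2`. -/
lemma IsParabolic.criticalExponent_zpowers {p : Equiv.Perm 𝔻} (hp : IsParabolic p) :
    criticalExponent (Subgroup.zpowers p) = 1 / 2 := by
  have hne := hp.isNonElliptic
  obtain ⟨C, hC, hup⟩ := hne.exists_defect_zpow_le 0
  obtain ⟨c, hc, hlow⟩ := hp.exists_le_defect_zpow 0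
  unfold criticalExponent
  have hsum : ∀ s : ℝ≥0, ∑' g : Subgroup.zpowers p, ENNReal.ofReal
      (Real.exp (-(s : ℝ) * hdist 0 ((g : Equiv.Perm 𝔻) 0)))
      = ∑' n : ℤ, ENNReal.ofReal (Real.exp (-hdist 0 ((p ^ n) 0)) ^ (s : ℝ)) := fun s => by
    rw [tsum_zpowers_eq hne fun g => ENNReal.ofReal (Real.exp (-(s : ℝ) * hdist 0 (g 0)))]
    refine tsum_congr fun n => ?_
    rw [← Real.exp_mul]; ring_nf
  simp only [hsum]
  refine le_antisymm (le_of_forall_gt fun r hr => ?_) (le_iInf₂ fun s hs => ?_)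
  · obtain ⟨s, hs1, hs2⟩ := ENNReal.lt_iff_exists_nnreal_btwn.1 hr
    have hs : (1 / 2 : ℝ) < s := by
      have : ((1 / 2 : ℝ≥0) : ℝ≥0∞) < s := by simpa using hs1
      exact_mod_cast this
    refine lt_of_le_of_lt (iInf₂_le s ?_) hs2
    refine ne_top_of_le_ne_top (summable_div_natAbs_sq_rpow hC.le hs).tsum_ofReal_ne_top
      (ENNReal.tsum_le_tsum fun n => ENNReal.ofReal_le_ofReal ?_)
    exact Real.rpow_le_rpow (Real.exp_pos _).le ((exp_neg_hdist_le_defect _).trans (hup n)) s.2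
  · have h1 := ENNReal.summable_toReal hs
    have h2 := h1.comp_injective Nat.cast_injective
    have h3 : Summable fun n : ℕ => (c / 4) ^ (s : ℝ) * (1 / ((n + 1 : ℕ) : ℝ) ^ (2 * (s : ℝ))) := by
      refine Summable.of_nonneg_of_le (fun n => by positivity) (fun n => ?_) h2
      rw [Function.comp_apply, ENNReal.toReal_ofReal (by positivity)]
      have h4 : c / 4 / ((n : ℝ) + 1) ^ 2 ≤ Real.exp (-hdist 0 ((p ^ (n : ℤ)) 0)) := by
        have h5 := hlow n
        have h6 := defect_le_exp_neg_hdist ((p ^ (n : ℤ)) 0)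
        rw [Int.natAbs_natCast] at h5
        rw [div_right_comm]
        linarith
      refine le_trans (le_of_eq ?_) (Real.rpow_le_rpow (by positivity) h4 s.2)
      rw [Real.div_rpow (by positivity : 0 ≤ c / 4) (by positivity), ← Real.rpow_natCast,
        ← Real.rpow_mul (by positivity)]
      push_cast
      ring
    have h4 := (summable_mul_left_iff (by positivity)).1 h3
    have h5 := Real.summable_one_div_nat_rpow.1 ((summable_nat_add_iff 1).1 h4)
    have h6 : (1 / 2 : ℝ≥0) ≤ s := by
      rw [← NNReal.coe_le_coe]; push_cast; linarith
    have h7 : ((1 / 2 : ℝ≥0) : ℝ≥0∞) ≤ s := by exact_mod_cast h6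
    simpa using h7

/-! ### Excursions into the cusp -/

/-- The exponential of half the Busemann function at the boundary point `ζ`. -/
def horofunction (ζ : ℂ) (z : 𝔻) : ℝ := ‖(z : ℂ) - ζ‖ / √(defect z)

lemma horofunction_pos {ζ : ℂ} (hζ : ‖ζ‖ = 1) (z : 𝔻) : 0 < horofunction ζ z := by
  refine div_pos (norm_pos_iff.2 (sub_ne_zero.2 ?_)) (Real.sqrt_pos.2 (defect_pos z))
  rintro rfl
  exact z.norm_ne_one hζ

/-- Ptolemy's inequality, with one vertex on the circle. -/
lemma horofunction_mul_sinh_le (ζ : ℂ) (x y z : 𝔻) :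
    horofunction ζ y * Real.sinh (hdist z x / 2)
      ≤ Real.sinh (hdist y z / 2) * horofunction ζ x
        + Real.sinh (hdist y x / 2) * horofunction ζ z := by
  have qx := Real.sqrt_pos.2 (defect_pos x)
  have qy := Real.sqrt_pos.2 (defect_pos y)
  have qz := Real.sqrt_pos.2 (defect_pos z)
  simp only [horofunction, sinh_half_hdist, Real.sqrt_mul (defect_pos _).le]
  have h : ‖(y : ℂ) - ζ‖ * ‖(z : ℂ) - x‖
      ≤ ‖(y : ℂ) - z‖ * ‖(x : ℂ) - ζ‖ + ‖(y : ℂ) - x‖ * ‖(z : ℂ) - ζ‖ := by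
    rw [← norm_mul, ← norm_mul, ← norm_mul]
    have e : ((y : ℂ) - ζ) * ((z : ℂ) - x)
        = -(((y : ℂ) - z) * (x - ζ)) + ((y : ℂ) - x) * (z - ζ) := by ring
    rw [e]
    refine (norm_add_le _ _).trans ?_
    rw [norm_neg]
  calc ‖(y : ℂ) - ζ‖ / √(defect y) * (‖(z : ℂ) - x‖ / (√(defect z) * √(defect x)))
      = (‖(y : ℂ) - ζ‖ * ‖(z : ℂ) - x‖) / (√(defect y) * √(defect z) * √(defect x)) := by
        field_simp
    _ ≤ (‖(y : ℂ) - z‖ * ‖(x : ℂ) - ζ‖ + ‖(y : ℂ) - x‖ * ‖(z : ℂ) - ζ‖)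
        / (√(defect y) * √(defect z) * √(defect x)) := by gcongr
    _ = _ := by field_simp

lemma horofunction_le {ζ : ℂ} (hζ : ‖ζ‖ = 1) {x y : 𝔻} {R : ℝ} (h : hdist y x ≤ R) :
    horofunction ζ x ≤ 4 * Real.exp (R / 2) * horofunction ζ y := by
  have qx := Real.sqrt_pos.2 (defect_pos x)
  have qy := Real.sqrt_pos.2 (defect_pos y)
  have h1 : √(defect y) ≤ 2 * Real.exp (R / 2) * √(defect x) := by
    have h2 := defect_le_mul_defect y x
    rw [← Real.sqrt_sq (by positivity : 0 ≤ 2 * Real.exp (R / 2) * √(defect x))]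
    refine Real.sqrt_le_sqrt (h2.trans ?_)
    rw [mul_pow, Real.sq_sqrt (defect_pos x).le, mul_pow, ← Real.exp_nat_mul]
    have e : ((2 : ℕ) : ℝ) * (R / 2) = R := by push_cast; ring
    rw [e]
    have := defect_pos x
    norm_num
    gcongr
  have h2 : √(defect y) ≤ 2 * horofunction ζ y := by
    unfold horofunction
    rw [mul_div_assoc', le_div_iff₀ qy, Real.mul_self_sqrt (defect_pos y).le]
    have h3 : 1 - ‖(y : ℂ)‖ ≤ ‖(y : ℂ) - ζ‖ := by
      have := norm_sub_norm_le ζ (y : ℂ)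
      rwa [hζ, norm_sub_rev] at this
    unfold defect
    nlinarith [norm_nonneg (y : ℂ), y.norm_lt_one]
  have h3 : Real.sinh (hdist y x / 2) ≤ Real.exp (R / 2) :=
    (sinh_half_le_exp _).trans (Real.exp_le_exp.2 (by linarith))
  have h4 := norm_sub_eq_sinh y x
  have hy := horofunction_pos hζ y
  have e : ‖(y : ℂ) - ζ‖ = horofunction ζ y * √(defect y) := by
    unfold horofunction; field_simp
  have h5 : ‖(x : ℂ) - ζ‖ ≤ ‖(y : ℂ) - x‖ + ‖(y : ℂ) - ζ‖ := by
    have := norm_sub_le_norm_sub_add_norm_sub (x : ℂ) (y : ℂ) ζ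
    rwa [norm_sub_rev (x : ℂ) y] at this
  rw [horofunction, div_le_iff₀ qx]
  calc ‖(x : ℂ) - ζ‖ ≤ ‖(y : ℂ) - x‖ + ‖(y : ℂ) - ζ‖ := h5
    _ = Real.sinh (hdist y x / 2) * (√(defect y) * √(defect x))
        + horofunction ζ y * √(defect y) := by rw [h4, e]
    _ ≤ Real.exp (R / 2) * ((2 * horofunction ζ y) * √(defect x))
        + horofunction ζ y * (2 * Real.exp (R / 2) * √(defect x)) := by gcongr
    _ = _ := by ring

section Schottky

variable {gen : Bool → Equiv.Perm 𝔻} {z₀ : 𝔻}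

/-- The orbit of the base point avoids a horoball at the parabolic fixed point. -/
lemma IsSchottky.exists_le_horofunction (hS : IsSchottky gen z₀) {ζ : ℂ}
    (hinv : ∀ (n : ℤ) (z : 𝔻),
      horofunction ζ ((gen false ^ n) z) = horofunction ζ z) :
    ∃ c : ℝ, 0 < c ∧ ∀ g ∈ Subgroup.closure {gen true, gen false}, c ≤ horofunction ζ (g z₀) := by
  obtain ⟨δ, hδ, hsep⟩ := hS.separated
  have hlim : Tendsto (fun n : ℕ => (((gen false ^ (n + 1)) z₀ : 𝔻) : ℂ)) atTop (𝓝 ζ) := by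
    obtain ⟨C, hC, hd⟩ := (hS.nonElliptic false).exists_defect_pow_le z₀
    have h1 : Tendsto (fun n : ℕ => C / ((n : ℝ) + 1) ^ 2) atTop (𝓝 0) := by
      refine Tendsto.div_atTop tendsto_const_nhds ?_
      exact (tendsto_pow_atTop two_ne_zero).comp
        (tendsto_atTop_add_const_right _ _ tendsto_natCast_atTop_atTop)
    have h2 : Tendsto (fun n : ℕ => horofunction ζ z₀ * √(defect ((gen false ^ n) z₀))) atTop
        (𝓝 0) := by
      have := (squeeze_zero (fun n => (defect_pos _).le) hd h1).sqrt.const_mul (horofunction ζ z₀)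
      simpa using this
    have h3 : Tendsto (fun n : ℕ => (((gen false ^ n) z₀ : 𝔻) : ℂ) - ζ) atTop (𝓝 0) := by
      refine squeeze_zero_norm (fun n => le_of_eq ?_) h2
      have := hinv n z₀
      rw [zpow_natCast] at this
      rw [← this, horofunction, div_mul_cancel₀]
      exact (Real.sqrt_pos.2 (defect_pos _)).ne'
    have h4 : Tendsto (fun n : ℕ => (((gen false ^ n) z₀ : 𝔻) : ℂ)) atTop (𝓝 ζ) := by
      simpa using h3.add_const ζ
    exact h4.comp (tendsto_add_atTop_nat 1)
  have hz₀ : z₀ ∉ pingSet z₀ (gen false) := hS.notMem_pingSet (Set.mem_insert _ _)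
  have hfar : ∀ x ∈ insert z₀ (pingSet z₀ (gen true)), δ ≤ horofunction ζ x := by
    intro x hx
    have h1 : δ ≤ ‖(x : ℂ) - ζ‖ := by
      refine ge_of_tendsto' (tendsto_const_nhds.sub hlim).norm fun n => ?_
      refine hsep false x hx _ ?_
      rw [← zpow_natCast]
      exact (hS.nonElliptic false).zpow_mem_pingSet hz₀ (by positivity)
    refine h1.trans (le_div_self (norm_nonneg _) (Real.sqrt_pos.2 (defect_pos x)) ?_)
    exact Real.sqrt_le_one.2 (defect_le_one x)
  refine ⟨δ, hδ, fun g hg => ?_⟩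
  obtain ⟨b, l, hl, rfl⟩ := exists_word_of_mem_closure gen hg
  cases b
  · rcases l with _ | ⟨n, l⟩
    · exact hfar _ (Set.mem_insert _ _)
    · simp only [List.mem_cons, not_or] at hl
      rw [word, Equiv.Perm.mul_apply, hinv]
      exact hfar _ (hS.word_apply_mem _ _ hl.2)
  · exact hfar _ (hS.word_apply_mem _ _ hl)

/-- A point near the segment from `z₀` to `pⁿ z₀` can be close to the orbit of `z₀` only if it is
close to one of the endpoints: in between, the segment enters deep into the horoball. -/
lemma IsSchottky.exists_excursion_bound (hS : IsSchottky gen z₀) (hp : IsParabolic (gen false))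
    (D R : ℝ) :
    ∃ L : ℝ, 0 ≤ L ∧ ∀ (n : ℤ) (y : 𝔻) (A B : ℝ), hdist y z₀ ≤ A + D →
      hdist y ((gen false ^ n) z₀) ≤ B + D → A + B ≤ hdist z₀ ((gen false ^ n) z₀) + D →
      (∃ g ∈ Subgroup.closure {gen true, gen false}, hdist y (g z₀) ≤ R) → A ≤ L ∨ B ≤ L := by
  obtain ⟨ζ, hζ, hinv⟩ := hp.exists_fixedPoint
  have hinv' : ∀ (n : ℤ) (z : 𝔻), horofunction ζ ((gen false ^ n) z) = horofunction ζ z := hinv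
  obtain ⟨c, hc, hhoro⟩ := hS.exists_le_horofunction hinv'
  have he0 := horofunction_pos hζ z₀
  set c₁ := c / (4 * Real.exp (R / 2)) with hc₁
  set K := horofunction ζ z₀ * Real.exp (D / 2) with hK
  set k := Real.exp (-(D / 2)) with hk
  have hkpos : 0 < k := Real.exp_pos _
  have hc₁pos : 0 < c₁ := by positivity
  have hKpos : 0 < K := by positivity
  set m := max 1 ((c₁ + 4 * K) / (c₁ * k)) with hm
  have hm1 : 1 ≤ m := le_max_left _ _
  refine ⟨2 * Real.log m, by have := Real.log_nonneg hm1; linarith, ?_⟩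
  rintro n y A B h1 h2 h3 ⟨g, hg, h4⟩
  by_contra! hcon
  obtain ⟨hA, hB⟩ := hcon
  have hmpos : 0 < m := by linarith
  have ha : m < Real.exp (A / 2) := by
    rw [← Real.log_lt_iff_lt_exp hmpos]; linarith
  have hb : m < Real.exp (B / 2) := by
    rw [← Real.log_lt_iff_lt_exp hmpos]; linarith
  set a := Real.exp (A / 2) with hadef
  set b := Real.exp (B / 2) with hbdef
  have hy : c₁ ≤ horofunction ζ y := by
    rw [hc₁, div_le_iff₀ (by positivity), mul_comm]
    exact (hhoro g hg).trans (horofunction_le hζ h4)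
  have hpt := horofunction_mul_sinh_le ζ ((gen false ^ n) z₀) y z₀
  rw [hinv'] at hpt
  have hs1 : Real.sinh (hdist y z₀ / 2) ≤ a * Real.exp (D / 2) := by
    refine (sinh_half_le_exp _).trans ?_
    rw [hadef, ← Real.exp_add]
    exact Real.exp_le_exp.2 (by linarith)
  have hs2 : Real.sinh (hdist y ((gen false ^ n) z₀) / 2) ≤ b * Real.exp (D / 2) := by
    refine (sinh_half_le_exp _).trans ?_
    rw [hbdef, ← Real.exp_add]
    exact Real.exp_le_exp.2 (by linarith)
  have hs3 : (a * b * k - 1) / 2 ≤ Real.sinh (hdist z₀ ((gen false ^ n) z₀) / 2) := by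
    rw [Real.sinh_eq]
    have h5 : Real.exp (-(hdist z₀ ((gen false ^ n) z₀) / 2)) ≤ 1 := by
      rw [Real.exp_le_one_iff]
      linarith [hdist_nonneg z₀ ((gen false ^ n) z₀)]
    have h6 : a * b * k ≤ Real.exp (hdist z₀ ((gen false ^ n) z₀) / 2) := by
      rw [hadef, hbdef, hk, ← Real.exp_add, ← Real.exp_add]
      exact Real.exp_le_exp.2 (by linarith)
    linarith
  have hmain : c₁ * ((a * b * k - 1) / 2) ≤ K * (a + b) := by
    have h7 : 0 ≤ Real.sinh (hdist z₀ ((gen false ^ n) z₀) / 2) :=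
      Real.sinh_nonneg_iff.2 (by linarith [hdist_nonneg z₀ ((gen false ^ n) z₀)])
    calc c₁ * ((a * b * k - 1) / 2) ≤ c₁ * Real.sinh (hdist z₀ ((gen false ^ n) z₀) / 2) := by
          gcongr
      _ ≤ horofunction ζ y * Real.sinh (hdist z₀ ((gen false ^ n) z₀) / 2) := by gcongr
      _ ≤ _ := hpt
      _ ≤ (a * Real.exp (D / 2)) * horofunction ζ z₀
          + (b * Real.exp (D / 2)) * horofunction ζ z₀ := by gcongr
      _ = K * (a + b) := by rw [hK]; ring
  have hmk : c₁ + 4 * K ≤ m * (c₁ * k) := by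
    rw [← div_le_iff₀ (by positivity)]
    exact le_max_right _ _
  -- multiply the last inequality by `a b / m` and compare with the one before
  have hapos : 0 < a := Real.exp_pos _
  have hbpos : 0 < b := Real.exp_pos _
  have h8 : m * (a + b) < 2 * (a * b) := by nlinarith
  have h9 : m < a * b := by nlinarith
  nlinarith [mul_pos hapos hbpos, mul_le_mul_of_nonneg_left hmk (mul_pos hapos hbpos).le]

end Schottky

/-! ### Limit points with growing parabolic excursions -/

/-- The word `g₁^{n₀} g₀ g₁^{n₁} g₀ ⋯ g₁^{n_{k-1}} g₀`, with `g₁ = gen false` and `g₀ = gen true`,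
as a list of exponents. -/
def excursionList (n : ℕ → ℤ) : ℕ → List ℤ
  | 0 => []
  | k + 1 => excursionList n k ++ [n k, 1]

lemma nextLetter_excursionList (n : ℕ → ℤ) (k : ℕ) :
    nextLetter false (excursionList n k) = false := by
  induction k with
  | zero => rfl
  | succ k ih => rw [excursionList, nextLetter_append, ih]; rfl

lemma zero_notMem_excursionList {n : ℕ → ℤ} (hn : ∀ i, n i ≠ 0) (k : ℕ) :
    (0 : ℤ) ∉ excursionList n k := by
  induction k with
  | zero => simp [excursionList]
  | succ k ih =>
    simp only [excursionList, List.mem_append, List.mem_cons, not_or]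
    exact ⟨ih, (hn k).symm, by norm_num, by simp⟩

lemma exists_excursionList_eq_append {n : ℕ → ℤ} (hn : ∀ i, n i ≠ 0) {k j : ℕ} (hkj : k ≤ j) :
    ∃ t, (0 : ℤ) ∉ t ∧ excursionList n j = excursionList n k ++ t := by
  induction j, hkj using Nat.le_induction with
  | base => exact ⟨[], by simp, by simp⟩
  | succ j _ ih =>
    obtain ⟨t, ht, h⟩ := ih
    refine ⟨t ++ [n j, 1], ?_, by rw [excursionList, h, List.append_assoc]⟩
    simp only [List.mem_append, List.mem_cons, not_or]
    exact ⟨ht, (hn j).symm, by norm_num, by simp⟩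

lemma excursionList_congr {n n' : ℕ → ℤ} {k : ℕ} (h : ∀ i < k, n i = n' i) :
    excursionList n k = excursionList n' k := by
  induction k with
  | zero => rfl
  | succ k ih =>
    rw [excursionList, excursionList, ih fun i hi => h i (by omega), h k (by omega)]

/-- A quadratic exponent beats a linear one. -/
lemma exists_pow_sum_mul_pow_le {θ r : ℝ} (hθ0 : 0 ≤ θ) (hθ1 : θ < 1) (hr : 0 ≤ r) :
    ∃ C : ℝ, 0 < C ∧ ∀ k : ℕ, θ ^ (∑ i ∈ Finset.range k, i) * r ^ k ≤ C := by
  obtain ⟨k₁, hk₁⟩ : ∃ k₁ : ℕ, ∀ k ≥ k₁, θ ^ k * r < 1 := by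
    have h := (tendsto_pow_atTop_nhds_zero_of_lt_one hθ0 hθ1).mul_const r
    rw [zero_mul] at h
    exact eventually_atTop.1 (h.eventually_lt_const one_pos)
  set a : ℕ → ℝ := fun k => θ ^ (∑ i ∈ Finset.range k, i) * r ^ k with ha
  have ha0 : ∀ k, 0 ≤ a k := fun k => by positivity
  refine ⟨∑ k ∈ Finset.range (k₁ + 1), a k + 1, ?_, fun k => ?_⟩
  · have := Finset.sum_nonneg fun k (_ : k ∈ Finset.range (k₁ + 1)) => ha0 k
    linarith
  · change a k ≤ _
    suffices h : a k ≤ ∑ k ∈ Finset.range (k₁ + 1), a k by linarith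
    rcases le_total k k₁ with h | h
    · exact Finset.single_le_sum (fun k _ => ha0 k) (Finset.mem_range.2 (by omega))
    · induction k, h using Nat.le_induction with
      | base => exact Finset.single_le_sum (fun k _ => ha0 k) (Finset.mem_range.2 (by omega))
      | succ k hk ih =>
        refine le_trans ?_ ih
        have e : a (k + 1) = a k * (θ ^ k * r) := by
          simp only [ha, Finset.sum_range_succ]; ring
        rw [e]
        exact mul_le_of_le_one_right (ha0 k) (hk₁ k hk).le

/-- The measure of the set of times spent near a sequence of instants growing faster than linearly
is sublinear. -/
lemma tendsto_average_zero {f : ℝ → ℝ} (hf0 : ∀ t, 0 ≤ f t) (hf1 : ∀ t, f t ≤ 1) {τ : ℕ → ℝ}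
    {L : ℝ} (hL : 0 ≤ L) (hf : ∀ t, 0 ≤ t → f t ≠ 0 → ∃ k, |t - τ k| ≤ L)
    (hτ : ∀ M : ℝ, 0 < M → ∃ k₀ : ℕ, ∀ k ≥ k₀, M * k ≤ τ k) :
    Tendsto (fun T : ℝ => (1 / T) * ∫ t in (0 : ℝ)..T, f t) atTop (𝓝 0) := by
  rw [Metric.tendsto_atTop]
  intro ε hε
  set M := 4 * (L + 1) / ε with hM
  have hMpos : 0 < M := by positivity
  obtain ⟨k₀, hk₀⟩ := hτ M hMpos
  set Q := 2 * L * (k₀ + 2 + L / M) with hQ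
  have hQ0 : 0 ≤ Q := by positivity
  refine ⟨max 1 (4 * Q / ε), fun T hT => ?_⟩
  have hT1 : 1 ≤ T := (le_max_left _ _).trans hT
  have hT2 : 4 * Q / ε ≤ T := (le_max_right _ _).trans hT
  have hTpos : 0 < T := by linarith
  have hint0 : 0 ≤ ∫ t in (0 : ℝ)..T, f t :=
    intervalIntegral.integral_nonneg hTpos.le fun t _ => hf0 t
  set m := k₀ + ⌈(T + L) / M⌉₊ + 1 with hm
  have hmfar : ∀ k ≥ m, T + L < τ k := by
    intro k hk
    have h1 := hk₀ k (by omega)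
    have h2 : (T + L) / M ≤ ⌈(T + L) / M⌉₊ := Nat.le_ceil _
    have h3 : ((⌈(T + L) / M⌉₊ : ℕ) : ℝ) + 1 ≤ k := by
      have : ⌈(T + L) / M⌉₊ + 1 ≤ k := by omega
      exact_mod_cast this
    have h4 : (T + L) / M < k := by linarith
    rw [div_lt_iff₀ hMpos] at h4
    linarith
  have hle : ∫ t in (0 : ℝ)..T, f t ≤ m * (2 * L) := by
    rw [intervalIntegral.integral_of_le hTpos.le]
    have hind : ∀ i, Integrable ((Set.Icc (τ i - L) (τ i + L)).indicator fun _ => (1 : ℝ))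
        (volume.restrict (Set.Ioc 0 T)) := fun i =>
      (integrable_const 1).indicator measurableSet_Icc
    have hmono : ∫ t in Set.Ioc 0 T, f t ≤ ∫ t in Set.Ioc 0 T, ∑ i ∈ Finset.range m,
        (Set.Icc (τ i - L) (τ i + L)).indicator (fun _ => (1 : ℝ)) t := by
      refine integral_mono_of_nonneg (Eventually.of_forall hf0)
        (integrable_finsetSum _ fun i _ => hind i) ?_
      refine (ae_restrict_iff' measurableSet_Ioc).2 (Eventually.of_forall fun t ht => ?_)
      have hnn : ∀ i ∈ Finset.range m,
          0 ≤ (Set.Icc (τ i - L) (τ i + L)).indicator (fun _ => (1 : ℝ)) t := fun i _ =>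
        Set.indicator_nonneg (fun _ _ => zero_le_one) _
      by_cases h0 : f t = 0
      · change f t ≤ _
        rw [h0]; exact Finset.sum_nonneg hnn
      · obtain ⟨k, hk⟩ := hf t ht.1.le h0
        rw [abs_le] at hk
        have hkm : k < m := by
          by_contra hcon
          have := hmfar k (not_lt.1 hcon)
          linarith [ht.2]
        refine (hf1 t).trans (le_trans (le_of_eq ?_)
          (Finset.single_le_sum hnn (Finset.mem_range.2 hkm)))
        rw [Set.indicator_of_mem]
        constructor <;> linarith
    refine hmono.trans ?_
    rw [integral_finsetSum _ fun i _ => hind i]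
    refine (Finset.sum_le_card_nsmul _ _ (2 * L) fun i _ => ?_).trans_eq (by simp)
    rw [integral_indicator measurableSet_Icc, setIntegral_const, smul_eq_mul, mul_one]
    refine (ENNReal.toReal_mono (by simp) (Measure.restrict_apply_le _ _)).trans_eq ?_
    rw [Real.volume_Icc, ENNReal.toReal_ofReal (by linarith)]
    ring
  have hm' : (m : ℝ) ≤ k₀ + 2 + (T + L) / M := by
    have := Nat.ceil_lt_add_one (by positivity : 0 ≤ (T + L) / M)
    rw [hm]; push_cast; linarith
  have hfinal : ∫ t in (0 : ℝ)..T, f t ≤ Q + 2 * L / M * T := by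
    refine hle.trans ((mul_le_mul_of_nonneg_right hm' (by positivity)).trans_eq ?_)
    rw [hQ]; field_simp; ring
  have hLM : 2 * L / M ≤ ε / 2 := by
    rw [hM, div_div_eq_mul_div, div_le_div_iff₀ (by positivity) two_pos]
    nlinarith
  rw [Real.dist_eq, sub_zero, abs_of_nonneg (by positivity), one_div, inv_mul_lt_iff₀ hTpos]
  have hQT : Q ≤ ε / 4 * T := by
    rw [div_le_iff₀ hε] at hT2
    linarith
  nlinarith

section Schottky

variable {gen : Bool → Equiv.Perm 𝔻} {z₀ : 𝔻}

/-- Growth of the excursions: the defects along the word decay superexponentially. -/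
lemma IsSchottky.exists_excursion_defect_le (hS : IsSchottky gen z₀) (M : ℝ) :
    ∃ k₀ : ℕ, ∀ n : ℕ → ℤ, (∀ i, 2 ^ i ≤ n i) → ∀ k ≥ k₀,
      defect (word gen false (excursionList n k) z₀) ≤ Real.exp (-(M * k)) := by
  obtain ⟨C, hC, hword⟩ := hS.exists_defect_word_le
  set C' := C * C with hC'
  obtain ⟨B, hB, hquad⟩ := exists_pow_sum_mul_pow_le (θ := 1 / 4) (r := C' * Real.exp (M + 1))
    (by norm_num) (by norm_num) (by positivity)
  obtain ⟨k₀, hk₀⟩ := exists_nat_gt (Real.log B)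
  refine ⟨k₀, fun n hn k hk => ?_⟩
  have hn0 : ∀ i, n i ≠ 0 := fun i => by
    have := hn i
    have h2 : (0 : ℤ) < 2 ^ i := by positivity
    omega
  refine (hword false _ (zero_notMem_excursionList hn0 k)).trans ?_
  have hprod : ((excursionList n k).map fun n : ℤ => C / ((n.natAbs : ℝ) + 1) ^ 2).prod
      ≤ C' ^ k * (1 / 4) ^ (∑ i ∈ Finset.range k, i) := by
    clear hk
    induction k with
    | zero => simp [excursionList]
    | succ k ih =>
      rw [excursionList, List.map_append, List.prod_append, Finset.sum_range_succ, pow_succ,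
        pow_add]
      have h1 : (2 : ℝ) ^ k ≤ (n k).natAbs := by
        have h2 := hn k
        have h3 : (2 : ℤ) ^ k ≤ ((n k).natAbs : ℤ) := by omega
        exact_mod_cast h3
      have h2 : ([n k, 1].map fun n : ℤ => C / ((n.natAbs : ℝ) + 1) ^ 2).prod
          ≤ C' * (1 / 4) ^ k := by
        have e : ([n k, 1].map fun n : ℤ => C / ((n.natAbs : ℝ) + 1) ^ 2).prod
            = C / (((n k).natAbs : ℝ) + 1) ^ 2 * (C / 4) := by
          simp; norm_num
        have e2 : ((1 : ℝ) / 4) ^ k = 1 / ((2 : ℝ) ^ k) ^ 2 := by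
          rw [one_div_pow, ← pow_mul, mul_comm, pow_mul]; norm_num
        rw [e, e2]
        calc C / (((n k).natAbs : ℝ) + 1) ^ 2 * (C / 4)
            ≤ C / ((2 : ℝ) ^ k) ^ 2 * C := by
              gcongr
              · linarith
              · linarith
          _ = _ := by rw [hC']; ring
      have h3 : 0 ≤ ([n k, 1].map fun n : ℤ => C / ((n.natAbs : ℝ) + 1) ^ 2).prod :=
        List.prod_nonneg (by
          intro x hx
          obtain ⟨y, -, rfl⟩ := List.mem_map.1 hx
          positivity)
      refine (mul_le_mul ih h2 h3 (by positivity)).trans_eq ?_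
      ring
  refine hprod.trans ?_
  have h1 := hquad k
  have hkB : Real.log B ≤ k := hk₀.le.trans (by exact_mod_cast hk)
  have h2 : B ≤ Real.exp k := by rwa [← Real.log_le_iff_le_exp hB]
  rw [mul_pow, ← Real.exp_nat_mul] at h1
  have h3 : Real.exp (k * (M + 1)) = Real.exp (M * k) * Real.exp k := by
    rw [← Real.exp_add]; ring_nf
  rw [h3] at h1
  rw [Real.exp_neg, ← one_div, le_div_iff₀ (Real.exp_pos _)]
  have hk' := Real.exp_pos (k : ℝ)
  refine le_of_mul_le_mul_right ?_ hk'
  linarith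

/-- Existence of the limit point with given excursions, together with the shadow estimate. -/
lemma IsSchottky.exists_excursion_limit (hS : IsSchottky gen z₀) :
    ∃ K : ℝ, 1 ≤ K ∧ ∀ n : ℕ → ℤ, (∀ i, 2 ^ i ≤ n i) → ∃ ξ : Circle,
      Tendsto (fun k => ((word gen false (excursionList n k) z₀ : 𝔻) : ℂ)) atTop (𝓝 (ξ : ℂ)) ∧
      ∀ k, ‖((word gen false (excursionList n k) z₀ : 𝔻) : ℂ) - ξ‖
        ≤ K * defect (word gen false (excursionList n k) z₀) := by
  obtain ⟨K, hK, hpre⟩ := hS.exists_prefix_bound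
  refine ⟨K, hK, fun n hn => ?_⟩
  have hn0 : ∀ i, n i ≠ 0 := fun i => by
    have := hn i
    have h2 : (0 : ℤ) < 2 ^ i := by positivity
    omega
  set x : ℕ → 𝔻 := fun k => word gen false (excursionList n k) z₀ with hx
  have hdist : ∀ k j, k ≤ j → ‖(x k : ℂ) - x j‖ ≤ K * defect (x k) := by
    intro k j hkj
    obtain ⟨t, ht, h⟩ := exists_excursionList_eq_append hn0 hkj
    have := (hpre false (excursionList n k) t (zero_notMem_excursionList hn0 k) ht).2
    rwa [← h] at this
  have hzero : Tendsto (fun k => defect (x k)) atTop (𝓝 0) := by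
    obtain ⟨k₀, hk₀⟩ := hS.exists_excursion_defect_le 1
    refine squeeze_zero' (Eventually.of_forall fun k => (defect_pos _).le)
      (eventually_atTop.2 ⟨k₀, fun k hk => hk₀ n hn k hk⟩) ?_
    exact (Real.tendsto_exp_neg_atTop_nhds_zero.comp tendsto_natCast_atTop_atTop).congr
      fun k => by simp
  have hcauchy : CauchySeq fun k => (x k : ℂ) := by
    refine cauchySeq_of_le_tendsto_0' (fun k => K * defect (x k)) (fun k j hkj => ?_) ?_
    · rw [dist_eq_norm]; exact hdist k j hkj
    · simpa using hzero.const_mul K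
  obtain ⟨y, hy⟩ := cauchySeq_tendsto_of_complete hcauchy
  have hnorm : ‖y‖ = 1 := by
    have h1 : Tendsto (fun k => defect (x k)) atTop (𝓝 (1 - ‖y‖ ^ 2)) :=
      tendsto_const_nhds.sub (hy.norm.pow 2)
    have h2 := tendsto_nhds_unique h1 hzero
    nlinarith [norm_nonneg y]
  refine ⟨⟨y, mem_sphere_zero_iff_norm.2 hnorm⟩, hy, fun k => ?_⟩
  refine le_of_tendsto (tendsto_const_nhds.sub hy).norm
    (eventually_atTop.2 ⟨k, fun j hj => hdist k j hj⟩)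

/-- The compact subsets of the surface are covered by the projections of balls. -/
lemma IsSchottky.exists_subset_proj_ball (hS : IsSchottky gen z₀)
    {W : Set (Surface (Subgroup.closure {gen true, gen false}))} (hW : IsCompact W) :
    ∃ R : ℝ, W ⊆ proj (Subgroup.closure {gen true, gen false}) '' {z | hdist z₀ z ≤ R} := by
  revert W
  set Γ := Subgroup.closure {gen true, gen false} with hΓ
  intro W hW
  set O : ℕ → Set (Surface Γ) := fun n => proj Γ '' {z | hdist z₀ z < n} with hO
  have hopen : ∀ n, IsOpen (O n) := by
    intro n
    change IsOpen (proj Γ ⁻¹' O n)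
    have e : proj Γ ⁻¹' O n
        = ⋃ g : Γ, {z : 𝔻 | hdist z₀ ((g : Equiv.Perm 𝔻) z) < n} := by
      ext z
      change proj Γ z ∈ proj Γ '' _ ↔ _
      rw [proj_mem_image_iff]
      simp
    rw [e]
    refine isOpen_iUnion fun g => isOpen_lt ?_ continuous_const
    exact (continuous_hdist z₀).comp (hS.isIsom_of_mem g.2).continuous
  have hmono : Monotone O := fun m n hmn => Set.image_mono
    fun z (hz : hdist z₀ z < m) => (hz.trans_le (by exact_mod_cast hmn) : hdist z₀ z < n)
  have hcov : W ⊆ ⋃ n, O n := by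
    intro w _
    obtain ⟨z, rfl⟩ := Quotient.exists_rep w
    obtain ⟨n, hn⟩ := exists_nat_gt (hdist z₀ z)
    exact Set.mem_iUnion.2 ⟨n, z, hn, rfl⟩
  obtain ⟨n, hn⟩ := hW.elim_directed_cover O hopen hcov hmono.directed_le
  exact ⟨n, hn.trans (Set.image_mono fun z (hz : hdist z₀ z < n) => hz.le)⟩

/-- Points with excursions of exponentially growing lengths diverge on average: outside bounded
neighbourhoods of the instants `d(0, w_k z₀)`, which grow faster than linearly in `k`, the ray
lies deep in the cusp. -/
lemma IsSchottky.excursion_limit_mem (hS : IsSchottky gen z₀) (hp : IsParabolic (gen false))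
    {n : ℕ → ℤ} (hn : ∀ i, 2 ^ i ≤ n i) {ξ : Circle} {K : ℝ}
    (hlim : Tendsto (fun k => ((word gen false (excursionList n k) z₀ : 𝔻) : ℂ)) atTop
      (𝓝 (ξ : ℂ)))
    (hsh : ∀ k, ‖((word gen false (excursionList n k) z₀ : 𝔻) : ℂ) - ξ‖
      ≤ K * defect (word gen false (excursionList n k) z₀)) :
    ξ ∈ divergingOnAverage (Subgroup.closure {gen true, gen false}) := by
  refine ⟨mem_limitSet_of_tendsto (fun g hg => hS.isIsom_of_mem hg)
    (fun k => word_mem_closure gen _ _) hlim, fun σ hσ hσξ W hW => ?_⟩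
  obtain ⟨R₀, hR₀⟩ := hS.exists_subset_proj_ball hW
  obtain ⟨C, hC⟩ := hσ.exists_hdist_ray_le hσξ
  set w : ℕ → Equiv.Perm 𝔻 := fun k => word gen false (excursionList n k) with hw
  set τ : ℕ → ℝ := fun k => hdist 0 (w k z₀) with hτ
  set D₀ := 2 * Real.arsinh (K + 1) with hD₀
  set H := hdist z₀ (gen true z₀) with hH
  have hH0 : 0 ≤ H := hdist_nonneg _ _
  have hray : ∀ k, hdist (w k z₀) (ray ξ (τ k)) ≤ D₀ := fun k => hdist_ray_le_of_shadow (hsh k)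
  have hD₀0 : 0 ≤ D₀ := (hdist_nonneg _ _).trans (hray 0)
  obtain ⟨L, hL, hexc⟩ := hS.exists_excursion_bound hp (D₀ + H) (R₀ + C)
  have hgrow : ∀ M : ℝ, 0 < M → ∃ k₀ : ℕ, ∀ k ≥ k₀, M * k ≤ τ k := by
    intro M _
    obtain ⟨k₀, hk₀⟩ := hS.exists_excursion_defect_le M
    refine ⟨k₀, fun k hk => ?_⟩
    have h1 := (exp_neg_hdist_le_defect _).trans (hk₀ n hn k hk)
    rw [Real.exp_le_exp] at h1
    linarith
  have hisom : ∀ k, IsIsom (w k) := fun k => hS.isIsom_word _ _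
  have hnear : ∀ t, 0 ≤ t →
      W.indicator (fun _ => (1 : ℝ)) (proj (Subgroup.closure {gen true, gen false}) (σ t)) ≠ 0 → ∃ k, |t - τ k| ≤ L + τ 0 := by
    intro t ht hne
    have hτ0 : 0 ≤ τ 0 := hdist_nonneg _ _
    have hmem : proj (Subgroup.closure {gen true, gen false}) (σ t) ∈ W := Set.mem_of_indicator_ne_zero hne
    obtain ⟨g, hg, hgR⟩ := (proj_mem_image_iff _ _ _).1 (hR₀ hmem)
    have hgR' : hdist z₀ (g (σ t)) ≤ R₀ := hgR
    have hgi : IsIsom g := hS.isIsom_of_mem hg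
    have hgt : hdist (ray ξ t) (g⁻¹ z₀) ≤ R₀ + C := by
      have h1 := hdist_triangle (ray ξ t) (σ t) (g⁻¹ z₀)
      rw [hdist_comm (σ t) (g⁻¹ z₀), hgi.hdist_inv_apply, hdist_comm (ray ξ t) (σ t)] at h1
      linarith [hC t ht]
    rcases lt_or_ge t (τ 0) with h0 | h0
    · exact ⟨0, by rw [abs_le]; constructor <;> linarith⟩
    have hexists : ∃ j, t < τ j := by
      obtain ⟨k₀, hk₀⟩ := hgrow 1 one_pos
      obtain ⟨m, hm⟩ := exists_nat_gt t
      refine ⟨max k₀ m, hm.trans_le ?_⟩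
      have h1 := hk₀ (max k₀ m) (le_max_left _ _)
      have h2 : (m : ℝ) ≤ (max k₀ m : ℕ) := by exact_mod_cast le_max_right _ _
      linarith
    classical
    obtain ⟨k, hk⟩ : ∃ k, Nat.find hexists = k + 1 := by
      refine Nat.exists_eq_succ_of_ne_zero fun h => ?_
      have := Nat.find_spec hexists
      rw [h] at this
      linarith
    have hk1 : t < τ (k + 1) := hk ▸ Nat.find_spec hexists
    have hk2 : τ k ≤ t := not_lt.1 (Nat.find_min hexists (by omega))
    have hstep : w (k + 1) z₀ = w k ((gen false ^ n k) (gen true z₀)) := by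
      simp only [hw, excursionList, word_append, nextLetter_excursionList]
      simp [word]
    have hpi : IsIsom (gen false ^ n k) := hp.isNonElliptic.isIsom.zpow _
    -- the endpoint of the parabolic excursion is close to the next orbit point
    have hH' : hdist (w (k + 1) z₀) (w k ((gen false ^ n k) z₀)) = H := by
      rw [hstep, (hisom k).hdist_eq, hpi.hdist_eq, hdist_comm]
    have key := hexc (n k) ((w k)⁻¹ (ray ξ t)) (t - τ k) (τ (k + 1) - t) ?_ ?_ ?_
      ⟨(w k)⁻¹ * g⁻¹, mul_mem (inv_mem (word_mem_closure _ _ _)) (inv_mem hg), ?_⟩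
    · rcases key with h | h
      · exact ⟨k, by rw [abs_of_nonneg (by linarith)]; linarith⟩
      · exact ⟨k + 1, by rw [abs_sub_comm, abs_of_nonneg (by linarith)]; linarith⟩
    · rw [(hisom k).hdist_inv_apply]
      have h1 := hdist_triangle (ray ξ t) (ray ξ (τ k)) (w k z₀)
      rw [hdist_ray, abs_of_nonneg (by linarith), hdist_comm (ray ξ (τ k)) (w k z₀)] at h1
      linarith [hray k]
    · rw [(hisom k).hdist_inv_apply]
      have h1 := hdist_triangle (ray ξ t) (ray ξ (τ (k + 1))) (w k ((gen false ^ n k) z₀))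
      have h2 := hdist_triangle (ray ξ (τ (k + 1))) (w (k + 1) z₀) (w k ((gen false ^ n k) z₀))
      rw [hH', hdist_comm (ray ξ (τ (k + 1))) (w (k + 1) z₀)] at h2
      rw [hdist_ray, abs_sub_comm, abs_of_nonneg (by linarith)] at h1
      linarith [hray (k + 1)]
    · have h1 := hdist_triangle 0 (w k z₀) (w (k + 1) z₀)
      have h2 := hdist_triangle (w k z₀) (w k ((gen false ^ n k) z₀)) (w (k + 1) z₀)
      rw [hdist_comm (w k ((gen false ^ n k) z₀)) (w (k + 1) z₀), hH', (hisom k).hdist_eq] at h2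
      have h3 : τ (k + 1) ≤ τ k + hdist (w k z₀) (w (k + 1) z₀) := h1
      linarith
    · rw [Equiv.Perm.mul_apply, (hisom k).inv.hdist_eq]
      exact hgt
  refine tendsto_average_zero (fun t => Set.indicator_nonneg (fun _ _ => zero_le_one) _)
    (fun t => ?_) (L := L + τ 0) (add_nonneg hL (hdist_nonneg _ _)) hnear hgrow
  exact Set.indicator_le_self' (fun _ _ => zero_le_one) _

end Schottky

/-! ### Separation of the limit points with growing excursions -/

/-- Up to a constant, isometries contract Euclidean distances by at most the defect of the image of
the base point. -/
lemma IsIsom.norm_sub_mul_defect_le {g : Equiv.Perm 𝔻} (hg : IsIsom g) (z₀ u v : 𝔻) :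
    ‖(u : ℂ) - v‖ * defect (g z₀)
      ≤ 16 * Real.exp (hdist 0 z₀) * ‖((g u : 𝔻) : ℂ) - (g v : 𝔻)‖ := by
  have h1 := hg.mul_defect_le z₀ u
  have h2 := hg.mul_defect_le z₀ v
  have q := defect_pos (g z₀)
  have h3 := mul_le_mul h1 h2 (mul_pos q (defect_pos v)).le
    (mul_pos (by positivity) (defect_pos (g u))).le
  have h4 := mul_le_mul_of_nonneg_left h3 (sq_nonneg (Real.sinh (hdist u v / 2)))
  refine le_of_sq_le_sq ?_ (by positivity)
  have e1 := sq_sinh_half_hdist u v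
  have e2 := sq_sinh_half_hdist (g u) (g v)
  rw [hg.hdist_eq] at e2
  rw [mul_pow, mul_pow, ← e1, ← e2]
  linarith

lemma exists_first_ne {n n' : ℕ → ℤ} (hne : n ≠ n') :
    ∃ k, (∀ i < k, n i = n' i) ∧ n k ≠ n' k := by
  classical
  have h : ∃ k, n k ≠ n' k := Function.ne_iff.1 hne
  exact ⟨Nat.find h, fun i hi => not_not.1 (Nat.find_min h hi), Nat.find_spec h⟩

section Schottky

variable {gen : Bool → Equiv.Perm 𝔻} {z₀ : 𝔻}

/-- Two sequences of excursions which differ for the first time at the rank `k` lead to limit points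
whose distance is at least comparable to the defect at the end of the first `k` excursions and the
next power of the parabolic generator. -/
lemma IsSchottky.exists_le_norm_sub_limit (hS : IsSchottky gen z₀) :
    ∃ c : ℝ, 0 < c ∧ ∀ (n n' : ℕ → ℤ) (ξ ξ' : Circle), (∀ i, n i ≠ 0) → (∀ i, n' i ≠ 0) →
      Tendsto (fun k => ((word gen false (excursionList n k) z₀ : 𝔻) : ℂ)) atTop (𝓝 (ξ : ℂ)) →
      Tendsto (fun k => ((word gen false (excursionList n' k) z₀ : 𝔻) : ℂ)) atTop (𝓝 (ξ' : ℂ)) →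
      ∀ k, (∀ i < k, n i = n' i) → n k ≠ n' k →
        c * defect (word gen false (excursionList n k) ((gen false ^ n k) z₀))
          ≤ ‖(ξ : ℂ) - ξ'‖ := by
  obtain ⟨δ, hδ, hsep⟩ := hS.separated
  refine ⟨δ / (16 * Real.exp (hdist 0 z₀)), by positivity,
    fun n n' ξ ξ' hn hn' hξ hξ' k hk hne => ?_⟩
  set w := word gen false (excursionList n k) with hw
  set γ := w * gen false ^ n k with hγ
  have hγi : IsIsom γ := (hS.isIsom_word _ _).mul ((hS.nonElliptic false).isIsom.zpow _)
  have hstep : ∀ m : ℕ → ℤ, (∀ i, m i ≠ 0) → (∀ i < k, n i = m i) → ∀ j ≥ k + 1,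
      ∃ u ∈ pingSet z₀ (gen true),
        word gen false (excursionList m j) z₀ = w ((gen false ^ m k) u) := by
    intro m hm hmk j hj
    obtain ⟨t, ht, h⟩ := exists_excursionList_eq_append hm hj
    have h1 : (0 : ℤ) ∉ 1 :: t := by simpa using ht
    refine ⟨word gen true (1 :: t) z₀, hS.word_apply_mem_pingSet true h1 (by simp), ?_⟩
    rw [h, excursionList, ← excursionList_congr hmk, List.append_assoc, word_append,
      nextLetter_excursionList]
    rfl
  refine ge_of_tendsto (hξ.sub hξ').norm (eventually_atTop.2 ⟨k + 1, fun j hj => ?_⟩)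
  obtain ⟨u, hu, eu⟩ := hstep n hn (fun _ _ => rfl) j hj
  obtain ⟨u', hu', eu'⟩ := hstep n' hn' hk j hj
  have hv : (gen false ^ (n' k - n k)) u' ∈ pingSet z₀ (gen false) :=
    (hS.nonElliptic false).zpow_mem_pingSet (hS.notMem_pingSet (b := false) (Or.inr hu'))
      (sub_ne_zero.2 hne.symm)
  have h1 := hsep false u (Or.inr hu) _ hv
  have h2 := hγi.norm_sub_mul_defect_le z₀ u ((gen false ^ (n' k - n k)) u')
  have e : γ ((gen false ^ (n' k - n k)) u') = w ((gen false ^ n' k) u') := by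
    rw [hγ, Equiv.Perm.mul_apply, ← Equiv.Perm.mul_apply (gen false ^ n k), ← zpow_add,
      add_sub_cancel]
  rw [eu, eu', ← e, div_mul_eq_mul_div, div_le_iff₀ (by positivity)]
  have h3 := mul_le_mul_of_nonneg_right h1 (defect_pos (γ z₀)).le
  exact (h3.trans h2).trans_eq (mul_comm _ _)

/-- Lower bound for the defects along excursions of lengths comparable to `2 ^ i`. -/
lemma IsSchottky.exists_le_defect_excursion (hS : IsSchottky gen z₀)
    (hp : IsParabolic (gen false)) :
    ∃ A r : ℝ, 0 < A ∧ 0 < r ∧ ∀ n : ℕ → ℤ, (∀ i, 0 ≤ n i) → (∀ i, n i < 2 ^ (i + 1)) → ∀ k,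
      A * (r ^ k * (1 / 4) ^ (∑ i ∈ Finset.range k, i))
        ≤ defect (word gen false (excursionList n k) ((gen false ^ n k) z₀)) := by
  obtain ⟨c, hc, hlow⟩ := hp.exists_le_defect_zpow z₀
  set E := 16 * Real.exp (hdist 0 z₀) with hE
  have hE0 : 0 < E := by positivity
  set q := defect (gen true z₀) with hq
  have hq0 : 0 < q := defect_pos _
  set a := c / (4 * E) with ha
  have ha0 : 0 < a := by positivity
  refine ⟨a * defect z₀, a * q / E / 4, mul_pos ha0 (defect_pos _), by positivity,
    fun n hn0 hn k => ?_⟩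
  -- the two estimates for the letters of an excursion
  have h1 : ∀ k, a * (1 / 4) ^ k * defect (word gen false (excursionList n k) z₀)
      ≤ defect (word gen false (excursionList n k) ((gen false ^ n k) z₀)) := by
    intro k
    have h := (hS.isIsom_word false (excursionList n k)).mul_defect_le z₀ ((gen false ^ n k) z₀)
    have h' : c / 4 * (1 / 4) ^ k ≤ defect ((gen false ^ n k) z₀) := by
      refine le_trans ?_ (hlow (n k))
      have h2 : ((n k).natAbs : ℝ) + 1 ≤ 2 ^ (k + 1) := by
        have h3 := hn k
        have h4 := hn0 k
        have h5 : ((n k).natAbs : ℤ) + 1 ≤ 2 ^ (k + 1) := by omega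
        exact_mod_cast h5
      have e : c / 4 * (1 / 4) ^ k = c / ((2 : ℝ) ^ (k + 1)) ^ 2 := by
        rw [← pow_mul, mul_comm (k + 1), pow_mul, pow_succ, one_div_pow]
        norm_num
        field_simp
      rw [e]
      gcongr
    have q0 := defect_pos (word gen false (excursionList n k) z₀)
    have h2 := mul_le_mul_of_nonneg_left h' q0.le
    have e : a * (1 / 4) ^ k * defect (word gen false (excursionList n k) z₀)
        = defect (word gen false (excursionList n k) z₀) * (c / 4 * (1 / 4) ^ k) / E := by
      rw [ha]; field_simp
    rw [e, div_le_iff₀ hE0, mul_comm _ E]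
    exact h2.trans h
  have h2 : ∀ k, q / E * defect (word gen false (excursionList n k) ((gen false ^ n k) z₀))
      ≤ defect (word gen false (excursionList n (k + 1)) z₀) := by
    intro k
    have h := ((hS.isIsom_word false (excursionList n k)).mul
      (hp.isNonElliptic.isIsom.zpow (n k))).mul_defect_le z₀ (gen true z₀)
    have e : word gen false (excursionList n (k + 1)) z₀
        = (word gen false (excursionList n k) * gen false ^ n k) (gen true z₀) := by
      simp only [excursionList, word_append, nextLetter_excursionList]
      simp [word]
    rw [e, div_mul_eq_mul_div, div_le_iff₀ hE0, mul_comm _ E, mul_comm q]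
    exact h
  have h3 : ∀ k, defect z₀ * ((a * q / E) ^ k * (1 / 4) ^ (∑ i ∈ Finset.range k, i))
      ≤ defect (word gen false (excursionList n k) z₀) := by
    intro k
    induction k with
    | zero => simp [excursionList, word]
    | succ k ih =>
      rw [Finset.sum_range_succ, pow_add, pow_succ (a * q / E)]
      refine le_trans ?_ (h2 k)
      refine le_trans ?_ (mul_le_mul_of_nonneg_left (h1 k) (by positivity))
      have := mul_le_mul_of_nonneg_left ih
        (by positivity : 0 ≤ a * q / E * (1 / 4 : ℝ) ^ k)
      refine le_trans (le_of_eq ?_) (this.trans_eq ?_) <;> ring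
  refine le_trans ?_ (h1 k)
  refine le_trans (le_of_eq ?_) (mul_le_mul_of_nonneg_left (h3 k) (by positivity))
  rw [div_pow _ (4 : ℝ), one_div_pow 4 k]
  ring

/-- If the lengths of the excursions are comparable to `2 ^ i`, there are `2 ^ S` possible choices
of the first `k` excursions, with `S = ∑ i < k, i`. The inverse of their number is bounded by the
distance of two limit points to any power less than `1 / 2`. -/
lemma IsSchottky.exists_pow_sum_le_rpow (hS : IsSchottky gen z₀) (hp : IsParabolic (gen false))
    {s : ℝ} (hs0 : 0 < s) (hs : s < 1 / 2) :
    ∃ C : ℝ, 0 < C ∧ ∀ (n n' : ℕ → ℤ) (ξ ξ' : Circle), (∀ i, 2 ^ i ≤ n i) →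
      (∀ i, n i < 2 ^ (i + 1)) → (∀ i, 2 ^ i ≤ n' i) →
      Tendsto (fun k => ((word gen false (excursionList n k) z₀ : 𝔻) : ℂ)) atTop (𝓝 (ξ : ℂ)) →
      Tendsto (fun k => ((word gen false (excursionList n' k) z₀ : 𝔻) : ℂ)) atTop (𝓝 (ξ' : ℂ)) →
      ∀ k, (∀ i < k, n i = n' i) → n k ≠ n' k →
        (1 / 2) ^ (∑ i ∈ Finset.range k, i) ≤ C * ‖(ξ : ℂ) - ξ'‖ ^ s := by
  obtain ⟨c, hc, hsep⟩ := hS.exists_le_norm_sub_limit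
  obtain ⟨A, r, hA, hr, hlow⟩ := hS.exists_le_defect_excursion hp
  have h4 : 0 < (1 / 4 : ℝ) ^ s := by positivity
  have h41 : 1 / 2 < (1 / 4 : ℝ) ^ s := by
    have : (1 / 2 : ℝ) = (1 / 4) ^ (1 / 2 : ℝ) := by
      rw [← Real.sqrt_eq_rpow, show (1 / 4 : ℝ) = (1 / 2) ^ 2 by norm_num,
        Real.sqrt_sq (by norm_num)]
    rw [this]
    exact Real.rpow_lt_rpow_of_exponent_gt (by norm_num) (by norm_num) hs
  obtain ⟨C, hC, hquad⟩ := exists_pow_sum_mul_pow_le (θ := 1 / 2 / (1 / 4 : ℝ) ^ s)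
    (r := (r ^ s)⁻¹) (by positivity) ((div_lt_one h4).2 h41) (by positivity)
  refine ⟨C / (c * A) ^ s, by positivity, fun n n' ξ ξ' hn hn2 hn' hξ hξ' k hk hne => ?_⟩
  have hpos : ∀ i, (0 : ℤ) < 2 ^ i := fun i => by positivity
  have h1 := hsep n n' ξ ξ' (fun i => ((hpos i).trans_le (hn i)).ne')
    (fun i => ((hpos i).trans_le (hn' i)).ne') hξ hξ' k hk hne
  have h2 := hlow n (fun i => ((hpos i).trans_le (hn i)).le) hn2 k
  set S := ∑ i ∈ Finset.range k, i with hSdef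
  have h3 : c * A * (r ^ k * (1 / 4) ^ S) ≤ ‖(ξ : ℂ) - ξ'‖ := by
    refine le_trans ?_ h1
    rw [mul_assoc]
    exact mul_le_mul_of_nonneg_left h2 hc.le
  have h5 := Real.rpow_le_rpow (by positivity) h3 hs0.le
  have hcomm : ∀ (x : ℝ) (m : ℕ), 0 ≤ x → (x ^ m) ^ s = (x ^ s) ^ m := fun x m hx => by
    rw [← Real.rpow_natCast, ← Real.rpow_natCast, ← Real.rpow_mul hx, ← Real.rpow_mul hx, mul_comm]
  rw [Real.mul_rpow (mul_pos hc hA).le (by positivity),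
    Real.mul_rpow (pow_pos hr k).le (by positivity), hcomm r k hr.le, hcomm (1 / 4) S (by norm_num)] at h5
  have h6 := hquad k
  rw [← hSdef, div_pow (1 / 2 : ℝ), inv_pow, ← div_eq_mul_inv, div_div,
    div_le_iff₀ (by positivity)] at h6
  refine h6.trans ?_
  rw [div_mul_eq_mul_div, le_div_iff₀ (by positivity)]
  have := mul_le_mul_of_nonneg_left h5 hC.le
  linarith

/-! ### The coding of the unit interval -/

/-- The digits of a real number in the expansion with successive bases `2 ^ 0, 2 ^ 1, 2 ^ 2, …`,
shifted so that the digit of rank `i` lies in `[2 ^ i, 2 ^ (i + 1))`. -/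
def digit (x : ℝ) (i : ℕ) : ℤ :=
  2 ^ i + ((⌊x * 2 ^ (∑ j ∈ Finset.range (i + 1), j)⌋₊ % 2 ^ i : ℕ) : ℤ)

lemma le_digit (x : ℝ) (i : ℕ) : 2 ^ i ≤ digit x i := by
  unfold digit; omega

lemma digit_lt (x : ℝ) (i : ℕ) : digit x i < 2 ^ (i + 1) := by
  have h := Nat.mod_lt ⌊x * 2 ^ (∑ j ∈ Finset.range (i + 1), j)⌋₊ (Nat.two_pow_pos i)
  have h' : ((⌊x * 2 ^ (∑ j ∈ Finset.range (i + 1), j)⌋₊ % 2 ^ i : ℕ) : ℤ) < 2 ^ i := by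
    exact_mod_cast h
  rw [digit, pow_succ]
  linarith

lemma floor_eq_of_digit_eq {x y : ℝ} (hx : x ∈ Set.Ico (0 : ℝ) 1) (hy : y ∈ Set.Ico (0 : ℝ) 1)
    {k : ℕ} (h : ∀ i < k, digit x i = digit y i) :
    ⌊x * 2 ^ (∑ j ∈ Finset.range k, j)⌋₊ = ⌊y * 2 ^ (∑ j ∈ Finset.range k, j)⌋₊ := by
  induction k with
  | zero =>
    simp [Nat.floor_eq_zero.2 hx.2, Nat.floor_eq_zero.2 hy.2]
  | succ k ih =>
    have hdiv : ∀ x : ℝ, ⌊x * 2 ^ (∑ j ∈ Finset.range (k + 1), j)⌋₊ / 2 ^ k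
        = ⌊x * 2 ^ (∑ j ∈ Finset.range k, j)⌋₊ := fun x => by
      rw [← Nat.floor_div_natCast, Finset.sum_range_succ, pow_add]
      congr 1
      push_cast
      field_simp
    have h1 := h k (by omega)
    simp only [digit, add_right_inj, Nat.cast_inj] at h1
    rw [← Nat.div_add_mod ⌊x * 2 ^ (∑ j ∈ Finset.range (k + 1), j)⌋₊ (2 ^ k),
      ← Nat.div_add_mod ⌊y * 2 ^ (∑ j ∈ Finset.range (k + 1), j)⌋₊ (2 ^ k), hdiv, hdiv, h1,
      ih fun i hi => h i (by omega)]

lemma abs_sub_le_of_digit_eq {x y : ℝ} (hx : x ∈ Set.Ico (0 : ℝ) 1) (hy : y ∈ Set.Ico (0 : ℝ) 1)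
    {k : ℕ} (h : ∀ i < k, digit x i = digit y i) :
    |x - y| ≤ (1 / 2) ^ (∑ j ∈ Finset.range k, j) := by
  have e := floor_eq_of_digit_eq hx hy h
  set S := ∑ j ∈ Finset.range k, j
  have h2 : (0 : ℝ) < 2 ^ S := by positivity
  have hx1 := Nat.floor_le (mul_nonneg hx.1 h2.le)
  have hx2 := Nat.lt_floor_add_one (x * 2 ^ S)
  have hy1 := Nat.floor_le (mul_nonneg hy.1 h2.le)
  have hy2 := Nat.lt_floor_add_one (y * 2 ^ S)
  rw [e] at hx1 hx2
  rw [one_div_pow, le_div_iff₀ h2, ← abs_of_pos h2, ← abs_mul, abs_le, sub_mul]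
  constructor <;> linarith

lemma digit_injOn : Set.InjOn digit (Set.Ico (0 : ℝ) 1) := by
  intro x hx y hy h
  have hle : ∀ k : ℕ, |x - y| ≤ (1 / 2) ^ k := fun k => by
    refine (abs_sub_le_of_digit_eq (k := k + 1) hx hy fun i _ => congrFun h i).trans ?_
    refine pow_le_pow_of_le_one (by norm_num) (by norm_num) ?_
    exact Finset.single_le_sum (f := fun i => i) (fun _ _ => Nat.zero_le _)
      (Finset.mem_range.2 (Nat.lt_succ_self k))
  have h0 := ge_of_tendsto' (tendsto_pow_atTop_nhds_zero_of_lt_one (r := (1 / 2 : ℝ))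
    (by norm_num) (by norm_num)) hle
  exact sub_eq_zero.1 (abs_nonpos_iff.1 h0)

/-- The limit points whose excursions are the digits of a number of the unit interval form a set
which is mapped onto this interval by a map which is Hölder continuous of any exponent less than
`1 / 2`. -/
lemma IsSchottky.le_dimH (hS : IsSchottky gen z₀) (hp : IsParabolic (gen false)) :
    1 / 2 ≤ dimH (VisualCircle.toCircle ⁻¹'
      divergingOnAverage (Subgroup.closure {gen true, gen false})) := by
  refine le_of_forall_lt fun r hr => ?_
  obtain ⟨s, hs1, hs2⟩ := ENNReal.lt_iff_exists_nnreal_btwn.1 hr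
  refine lt_of_lt_of_le hs1 ?_
  have hs0 : (0 : ℝ) < s := by
    have : (0 : ℝ≥0∞) < s := lt_of_le_of_lt (zero_le) hs1
    exact_mod_cast this
  have hs : (s : ℝ) < 1 / 2 := by
    have : (s : ℝ≥0∞) < ((1 / 2 : ℝ≥0) : ℝ≥0∞) := by simpa using hs2
    exact_mod_cast this
  obtain ⟨K, -, hlim⟩ := hS.exists_excursion_limit
  choose F hF hFsh using fun x : ℝ => hlim (digit x) (le_digit x)
  obtain ⟨C, hC, hhol⟩ := hS.exists_pow_sum_le_rpow hp hs0 hs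
  set I := Set.Ico (0 : ℝ) 1 with hI
  set G : ℝ → VisualCircle := fun x => ⟨F x⟩ with hG
  have hdist : ∀ x ∈ I, ∀ y ∈ I, |x - y| ≤ C * 2 ^ (s : ℝ) * dist (G x) (G y) ^ (s : ℝ) := by
    intro x hx y hy
    rcases eq_or_ne x y with rfl | hxy
    · rw [sub_self, abs_zero]; positivity
    obtain ⟨k, hk, hne⟩ := exists_first_ne fun h => hxy (digit_injOn hx hy h)
    refine (abs_sub_le_of_digit_eq hx hy hk).trans ((hhol _ _ (F x) (F y) (le_digit x) (digit_lt x)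
      (le_digit y) (hF x) (hF y) k hk hne).trans_eq ?_)
    rw [VisualCircle.dist_eq, Real.div_rpow (norm_nonneg _) two_pos.le]
    have : (0 : ℝ) < 2 ^ (s : ℝ) := by positivity
    field_simp
    rfl
  have hinj : Set.InjOn G I := by
    intro x hx y hy h
    have h1 := hdist x hx y hy
    rw [h, dist_self, Real.zero_rpow hs0.ne', mul_zero] at h1
    exact sub_eq_zero.1 (abs_nonpos_iff.1 h1)
  set f := Function.invFunOn G I with hf
  have hfG : ∀ x ∈ I, f (G x) = x := hinj.leftInvOn_invFunOn
  have hholder : HolderOnWith (C * 2 ^ (s : ℝ)).toNNReal s f (G '' I) := by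
    rintro _ ⟨x, hx, rfl⟩ _ ⟨y, hy, rfl⟩
    rw [hfG x hx, hfG y hy, edist_dist, edist_dist, Real.dist_eq,
      ENNReal.ofReal_rpow_of_nonneg dist_nonneg hs0.le]
    change _ ≤ ENNReal.ofReal _ * _
    rw [← ENNReal.ofReal_mul (by positivity)]
    exact ENNReal.ofReal_le_ofReal (hdist x hx y hy)
  have himage : f '' (G '' I) = I := by
    rw [Set.image_image]
    exact (Set.image_congr hfG).trans (Set.image_id' I)
  have hs0' : 0 < s := by exact_mod_cast hs0
  have h1 := hholder.dimH_image_le hs0'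
  have hdimI : dimH I = 1 := by
    rw [Real.dimH_of_nonempty_interior (by rw [hI, interior_Ico]; exact Set.nonempty_Ioo.2 one_pos)]
    simp
  rw [himage, hdimI, ENNReal.le_div_iff_mul_le (Or.inl (by exact_mod_cast hs0'.ne'))
    (Or.inl ENNReal.coe_ne_top), one_mul] at h1
  refine h1.trans (dimH_mono ?_)
  rintro _ ⟨x, -, rfl⟩
  exact hS.excursion_limit_mem hp (le_digit x) (hF x) (hFsh x)

end Schottky

end HypDisc

end

theorem theorem2 (h p : Equiv.Perm Complex.UnitDisc)
    (hh : HypDisc.IsHyperbolic h) (hp : HypDisc.IsParabolic p)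
    (z₀ : Complex.UnitDisc) (hS : HypDisc.IsSchottkyPair z₀ h p) :
    dimH (HypDisc.VisualCircle.toCircle ⁻¹'
        HypDisc.divergingOnAverage (Subgroup.closure {h, p})) =
      HypDisc.criticalExponent (Subgroup.zpowers p) ∧
    HypDisc.criticalExponent (Subgroup.zpowers p) = 1 / 2 := by
  have hcrit := hp.criticalExponent_zpowers
  have hS' := hS.isSchottky hh hp
  exact ⟨(le_antisymm hS'.dimH_le (hS'.le_dimH hp)).trans hcrit.symm, hcrit⟩
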